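/- Let $d,k,N\ge 1$ be integers, $\gamma\in(0,1]$, $\rho,h_0>0$, let $\Omega\subset\mathbb R^d$ be a compact set with Lipschitz boundary and exterior unit normal $n$, and let $\{\psi_j\}$ be a basis of $\mathbb P_k(\mathbb R^d)$, the polynomials of degree at most $k$, regarded as shape functions on the reference simplex $\widehat T$. Discrete setting. Let $0<h\le h_0$ and let $\mathcal T_{h,0}$ be a finite conforming mesh of closed $d$-simplices whose union contains $\Omega$; every element has diameter at most $h$ and contains a ball of radius $\rho h$. Let $\mathcal T_h$ be the set of elements that meet $\Omega$, $\Omega_h$ their union, and $V_h$ the space of restrictions to $\Omega_h$ of the continuous functions on the mesh that are in $\mathbb P_k$ on each element. Let $\mathcal T_h^L=\{T\in\mathcal T_h:|T\cap\Omega|\ge\gamma|T|\}$ and $\mathcal T_h^S=\mathcal T_h\setminus\mathcal T_h^L$ (large and small elements), and let $S_h:\mathcal T_h^S\to\mathcal T_h^L$ be a map. Let $\{\varphi_i\}_{i\in I}$ be a basis of $V_h$ and $I_T=\{i:T\subset\operatorname{supp}\varphi_i\}$; assume that the elements are affine equivalent to $(\widehat T,\{\psi_j\})$, i.e. for each $T\in\mathcal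 T_h$ there is an invertible affine map $F$ with $F(\widehat T)=T$ such that $\{\varphi_i\circ F\}_{i\in I_T}$ is, up to numbering, $\{\psi_j\}$ on $\widehat T$ (for instance the Lagrange nodal basis). Let $\varphi_{i,T}^*$, $i\in I_T$, be the degrees of freedom dual to $\{\varphi_i|_T\}_{i\in I_T}$. Let $I^S$ be the set of those $i\in I$ for which no large element is contained in $\operatorname{supp}\varphi_i$, let $I^L=I\setminus I^S$, and for each $i\in I$ let $T_i\in\mathcal T_h$ be an element with $T_i\subset\operatorname{supp}\varphi_i$. For $v\in V_h$ let $(v|_T)^e\in\mathbb P_k(\mathbb R^d)$ be the canonical polynomial extension of $v|_T$, and $[v]_{T,T'}=(v|_T)^e-(v|_{T'})^e$. Assume: (i) each $T\in\mathcal T_h^S$ is joined to $S_h(T)$ by a path of at most $N$ face-neighboring elements of $\mathcal T_h$; (ii) if $T_1,T_2\in\mathcal T_h^S$ (respectively $T_1\in\mathcal T_h^L$, $T_2\in\mathcal T_h^S$) are contained in the support of the same $\varphi_i$, then $S_h(T_1)$ (respectively $T_1$) is joined to $S_h(T_2)$ by a path of at most $N$ face-neighboring elements of $\mathcal T_h^L$.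 Method. For $f\in L^2(\Omega)$ and $\beta,\tau>0$ find $u_{h,\tau}\in V_h$ such that $a_h(u_{h,\tau},v)+s_{h,\tau}(u_{h,\tau},v)=(f,v)_\Omega$ for all $v\in V_h$, where $$a_h(v,w)=(\nabla v,\nabla w)_\Omega-(\nabla_n v,w)_{\partial\Omega}-(v,\nabla_n w)_{\partial\Omega}+\beta h^{-1}(v,w)_{\partial\Omega},$$ $$s_{h,\tau}(v,w)=\sum_{i\in I^S}\tau h^{d-2}\,\varphi^*_{i,T_i}\big([v]_{T_i,S_h(T_i)}\big)\,\varphi^*_{i,T_i}\big([w]_{T_i,S_h(T_i)}\big),$$ with normal derivatives $\nabla_n$ on $\partial\Omega$ taken from inside $\Omega$. Let $$\widetilde\Pi_h v=\sum_{i\in I^S}\varphi^*_{i,T_i}\big((v|_{S_h(T_i)})^e\big)\varphi_i+\sum_{i\in I^L}\varphi^*_{i,T_i}(v)\varphi_i .$$ Claim. There are constants $\beta_0,c_0,C>0$, depending only on $d,k,N,\Omega,\gamma,\rho,h_0$ and $\{\psi_j\}$ (thus not on $h$, the mesh, the position of $\Omega$ in it, $S_h$, $\beta$, $\tau$ or $f$),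 such that for every discrete setting as above, every $\beta\ge\beta_0$ and every $f\in L^2(\Omega)$, with $\tau_0=c_0/\beta$: 1. for every $\tau\ge\tau_0$ the method has a unique solution $u_{h,\tau}\in V_h$; 2. for every $\tau\ge\tau_0$, $$\sum_{i\in I^S}h^{d-2}\,\big|\varphi^*_{i,T_i}\big(u_{h,\tau}-\widetilde\Pi_h u_{h,\tau}\big)\big|^2\le \frac{C}{\tau}\,\|f\|_\Omega^2;$$ 3. as $\tau\to\infty$ (with the mesh fixed), $u_{h,\tau}$ and $\widetilde\Pi_h u_{h,\tau}$ converge uniformly to one and the same limit $u_{h,\infty}\in V_h$. It satisfies $\widetilde\Pi_h u_{h,\infty}=u_{h,\infty}$, that is, its small-node degrees of freedom equal the discrete extension values: $\varphi^*_{i,T_i}(u_{h,\infty})=\varphi^*_{i,T_i}\big((u_{h,\infty}|_{S_h(T_i)})^e\big)$ for all $i\in I^S$. -/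

import Mathlib

open MeasureTheory Filter Topology

noncomputable section

namespace CutFEM

/-! ### Domain, boundary measure, normal, normal derivative -/

/-- The ambient Euclidean space `ℝ^d`. -/
abbrev E (d : ℕ) := EuclideanSpace ℝ (Fin d)

/-- A compact set with Lipschitz boundary: near every boundary point it is, in the direction of some
unit vector `e`, the region below the graph of a Lipschitz function `g` of the component
`y - ⟪e, y⟫ e` of `y` orthogonal to `e`. -/
structure IsLipschitzDomain {d : ℕ} (Ω : Set (E d)) : Prop where
  isCompact : IsCompact Ω
  locally_subgraph : ∀ x ∈ frontier Ω, ∃ e : E d, ‖e‖ = 1 ∧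
    ∃ (L : NNReal) (g : E d → ℝ), LipschitzWith L g ∧
      ∀ᶠ y in 𝓝 x, (y ∈ Ω ↔ inner ℝ e y ≤ g (y - (inner ℝ e y) • e))

/-- `ν` is the exterior unit normal to `Ω` at `x`: up to an angle that tends to zero at `x`, the set
`Ω` fills the half space `⟪ν, y - x⟫ < 0` and misses the half space `⟪ν, y - x⟫ > 0`. -/
def IsOuterNormal {d : ℕ} (Ω : Set (E d)) (x ν : E d) : Prop :=
  ‖ν‖ = 1 ∧ ∀ ε > 0, ∀ᶠ y in 𝓝 x,
    (inner ℝ ν (y - x) < -ε * ‖y - x‖ → y ∈ Ω) ∧ (inner ℝ ν (y - x) > ε * ‖y - x‖ → y ∉ Ω)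

open Classical in
/-- The exterior unit normal field. It exists (and is unique) at almost every boundary point of a
Lipschitz domain; at the remaining points it is set to zero. -/
def outerNormal {d : ℕ} (Ω : Set (E d)) (x : E d) : E d :=
  if h : ∃ ν, IsOuterNormal Ω x ν then h.choose else 0

/-- The derivative `∇_n v` in the direction of the exterior normal, taken from the inside of `Ω`:
minus the right derivative at `t = 0` of `t ↦ v (x - t n(x))`. Where `v` is smooth on both sides this
is `∇v · n`, and where a mesh face lies in the boundary it is the trace from inside `Ω`. -/
def normalDeriv {d : ℕ} (Ω : Set (E d)) (v : E d → ℝ) (x : E d) : ℝ :=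
  -derivWithin (fun t : ℝ => v (x - t • outerNormal Ω x)) (Set.Ici 0) 0

/-- The surface measure on `∂Ω`: the `(d-1)`-dimensional Hausdorff measure, normalized to agree with
Lebesgue measure on `(d-1)`-dimensional Euclidean space. -/
def surfaceMeasure {d : ℕ} (Ω : Set (E d)) : Measure (E d) :=
  (Measure.euclideanHausdorffMeasure (d - 1)).restrict (frontier Ω)

/-! ### Polynomials, meshes, finite element spaces -/

/-- Evaluation of polynomials in `d` variables as functions on `ℝ^d`. -/
def evalPoly (d : ℕ) : MvPolynomial (Fin d) ℝ →ₗ[ℝ] (E d → ℝ) where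
  toFun p := fun x => MvPolynomial.eval (fun i => x i) p
  map_add' p q := by ext x; simp
  map_smul' c p := by ext x; simp

/-- `P_k(ℝ^d)`: polynomial functions of total degree at most `k`. -/
def polySpace (d k : ℕ) : Submodule ℝ (E d → ℝ) :=
  (MvPolynomial.restrictTotalDegree (Fin d) ℝ k).map (evalPoly d)

/-- A conforming simplicial mesh of a (closed, polygonal) set in `ℝ^d`: a finite simplicial complex in
which every face is a face of a `d`-simplex. -/
structure Mesh (d : ℕ) where
  complex : Geometry.SimplicialComplex ℝ (E d)
  finite_faces : complex.faces.Finite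
  pure : ∀ s ∈ complex.faces, ∃ t ∈ complex.faces, s ⊆ t ∧ t.card = d + 1

/-- The closed simplex with vertex set `T`. -/
def cell {d : ℕ} (T : Finset (E d)) : Set (E d) := convexHull ℝ (T : Set (E d))

/-- Two elements share a (codimension one) face. -/
def FaceNeighbors {d : ℕ} (T T' : Finset (E d)) : Prop :=
  ∃ F : Finset (E d), F.card = d ∧ F ⊆ T ∧ F ⊆ T'

/-- There is a path of at most `N` elements, all in the collection `𝒯`, successive ones sharing a
face, that starts in `T` and ends in `T'`. -/
def HasFacePath {d : ℕ} (𝒯 : Set (Finset (E d))) (N : ℕ) (T T' : Finset (E d)) : Prop :=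
  ∃ (n : ℕ) (P : ℕ → Finset (E d)), n + 1 ≤ N ∧ P 0 = T ∧ P n = T' ∧
    (∀ j ≤ n, P j ∈ 𝒯) ∧ ∀ j < n, FaceNeighbors (P j) (P (j + 1))

open Classical in
/-- The canonical extension `(v|_T)^e ∈ P_k(ℝ^d)` of a function that agrees on the element `T` with a
polynomial of degree at most `k` (that polynomial is unique, since `T` has interior points). -/
def polyExt {d : ℕ} (k : ℕ) (T : Finset (E d)) (v : E d → ℝ) : E d → ℝ :=
  if h : ∃ p ∈ polySpace d k, Set.EqOn v p (cell T) then h.choose else 0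

/-- The jump `[v]_{T₁,T₂} = (v|_{T₁})^e - (v|_{T₂})^e ∈ P_k(ℝ^d)`. -/
def jump {d : ℕ} (k : ℕ) (T₁ T₂ : Finset (E d)) (v : E d → ℝ) : E d → ℝ :=
  polyExt k T₁ v - polyExt k T₂ v

namespace Mesh

variable {d : ℕ} (M : Mesh d)

/-- The elements `𝒯_{h,0}`, given by their vertex sets. -/
def elements : Set (Finset (E d)) := {T | T ∈ M.complex.faces ∧ T.card = d + 1}

/-- The mesh is quasiuniform with mesh parameter `h` and constant `ρ`. -/
def IsQuasiUniform (h ρ : ℝ) : Prop :=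
  ∀ T ∈ M.elements, Metric.diam (cell T) ≤ h ∧ ∃ c, Metric.closedBall c (ρ * h) ⊆ cell T

/-- The active mesh `𝒯_h`. -/
def active (Ω : Set (E d)) : Set (Finset (E d)) := {T ∈ M.elements | (cell T ∩ Ω).Nonempty}

/-- The large elements `𝒯_h^L`. -/
def large (Ω : Set (E d)) (γ : ℝ) : Set (Finset (E d)) :=
  {T ∈ M.active Ω | ENNReal.ofReal γ * volume (cell T) ≤ volume (cell T ∩ Ω)}

/-- The small elements `𝒯_h^S`. -/
def small (Ω : Set (E d)) (γ : ℝ) : Set (Finset (E d)) := M.active Ω \ M.large Ω γ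

/-- `Ω_h`, the union of the active elements. -/
def activeDomain (Ω : Set (E d)) : Set (E d) := ⋃ T ∈ M.active Ω, cell T

/-- `V_{h,0}`: continuous functions on the meshed set that are polynomials of degree at most `k` on
every element (values outside the meshed set are irrelevant). -/
def backgroundSpace (k : ℕ) : Submodule ℝ (E d → ℝ) where
  carrier := {v | ContinuousOn v M.complex.space ∧
    ∀ T ∈ M.elements, ∃ p ∈ polySpace d k, Set.EqOn v p (cell T)}
  add_mem' := by
    rintro v w ⟨hv, hv'⟩ ⟨hw, hw'⟩
    refine ⟨hv.add hw, fun T hT => ?_⟩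
    obtain ⟨p, hp, hvp⟩ := hv' T hT
    obtain ⟨q, hq, hwq⟩ := hw' T hT
    exact ⟨p + q, add_mem hp hq, fun x hx => by simp [hvp hx, hwq hx]⟩
  zero_mem' := ⟨continuousOn_const, fun T _ => ⟨0, zero_mem _, fun _ _ => rfl⟩⟩
  smul_mem' := by
    rintro c v ⟨hv, hv'⟩
    refine ⟨hv.const_smul c, fun T hT => ?_⟩
    obtain ⟨p, hp, hvp⟩ := hv' T hT
    exact ⟨c • p, Submodule.smul_mem _ c hp, fun x hx => by simp [hvp hx]⟩

/-- Restriction of functions to `X`, the result being represented by its extension by zero. -/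
def restrictTo (X : Set (E d)) : (E d → ℝ) →ₗ[ℝ] (E d → ℝ) where
  toFun v := X.indicator v
  map_add' v w := Set.indicator_add X v w
  map_smul' c v := Set.indicator_const_smul X c v

/-- The active finite element space `V_h = V_{h,0}|_{Ω_h}`; its elements are functions on `Ω_h`,
represented by their extension by zero. -/
def activeSpace (Ω : Set (E d)) (k : ℕ) : Submodule ℝ (E d → ℝ) :=
  (M.backgroundSpace k).map (restrictTo (M.activeDomain Ω))

end Mesh

/-! ### The discrete setting -/

/-- The data of the cut finite element method with nodal stabilization on a domain `Ω`: a background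
mesh covering `Ω`, the mesh parameter `h`, a basis `{φ_i}` of `V_h`, the map `S_h` from small to large
elements, and for each index `i` an element `T_i` in the support of `φ_i`. -/
structure Discretization (d k : ℕ) (Ω : Set (E d)) (γ : ℝ) where
  mesh : Mesh d
  covers : Ω ⊆ mesh.complex.space
  h : ℝ
  h_pos : 0 < h
  /-- The index set `I`. -/
  ι : Type
  [fintype : Fintype ι]
  /-- The global finite element basis `{φ_i : i ∈ I}` of `V_h`. -/
  φ : Module.Basis ι ℝ (mesh.activeSpace Ω k)
  /-- The map `S_h`. -/
  S : Finset (E d) → Finset (E d)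
  S_mem : ∀ T ∈ mesh.small Ω γ, S T ∈ mesh.large Ω γ
  /-- The elements `T_i`. -/
  node : ι → Finset (E d)
  node_mem : ∀ i, node i ∈ mesh.active Ω
  node_subset : ∀ i, cell (node i) ⊆ tsupport (φ i : E d → ℝ)

attribute [instance] Discretization.fintype

/-- The reference simplex with vertices `0, e_1, …, e_d`. -/
def refSimplex (d : ℕ) : Set (E d) :=
  convexHull ℝ (insert 0 (Set.range fun i : Fin d => EuclideanSpace.single i (1 : ℝ)))

namespace Discretization

variable {d k : ℕ} {Ω : Set (E d)} {γ : ℝ} (D : Discretization d k Ω γ)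

/-- The space `V_h`. -/
def V : Submodule ℝ (E d → ℝ) := D.mesh.activeSpace Ω k

/-- The basis function `φ_i`, as a function. -/
def shape (i : D.ι) : E d → ℝ := (D.φ i : E d → ℝ)

/-- The local index set `I_T`: the `i` with `T ⊆ supp φ_i`. -/
def localIdx (T : Finset (E d)) : Set D.ι := {i | cell T ⊆ tsupport (D.shape i)}

/-- The elements of the active mesh are affine equivalent to the reference element with shape
functions `ψ` (a basis of `P_k`): every active element `T` is an affine image `F(T̂)` of the reference
simplex such that the functions `φ_i ∘ F`, `i ∈ I_T`, are, up to numbering, the `ψ_j` on `T̂`. -/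
def IsAffineFamily {κ : Type} (ψ : Module.Basis κ ℝ (polySpace d k)) : Prop :=
  ∀ T ∈ D.mesh.active Ω, ∃ (F : E d ≃ᵃ[ℝ] E d) (σ : D.localIdx T ≃ κ),
    F '' refSimplex d = cell T ∧
    ∀ (i : D.localIdx T), ∀ x ∈ refSimplex d, D.shape i (F x) = (ψ (σ i) : E d → ℝ) x

/-- From each small element `T` a path of at most `N` active elements leads to `S_h(T)`. -/
def HasPaths (N : ℕ) : Prop :=
  ∀ T ∈ D.mesh.small Ω γ, HasFacePath (D.mesh.active Ω) N T (D.S T)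

/-- For elements `T₁, T₂` in the support of the same basis function, `T₂` small, a path of at most `N`
large elements leads from `S_h(T₁)` (`T₁` small) or `T₁` (`T₁` large) to `S_h(T₂)`. -/
def HasLargePaths (N : ℕ) : Prop :=
  ∀ (i : D.ι) (T₁ T₂ : Finset (E d)), i ∈ D.localIdx T₁ → i ∈ D.localIdx T₂ →
    T₂ ∈ D.mesh.small Ω γ →
    (T₁ ∈ D.mesh.small Ω γ → HasFacePath (D.mesh.large Ω γ) N (D.S T₁) (D.S T₂)) ∧
    (T₁ ∈ D.mesh.large Ω γ → HasFacePath (D.mesh.large Ω γ) N T₁ (D.S T₂))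

open Classical in
/-- The element degree of freedom `φ*_{i,T}`, dual to the element basis `{φ_j|_T : j ∈ I_T}`: the
coefficient of `φ_i|_T` in the expansion of `p|_T`. -/
def dof (T : Finset (E d)) (i : D.ι) (p : E d → ℝ) : ℝ :=
  if h : ∃ c : D.ι → ℝ, (∀ j ∉ D.localIdx T, c j = 0) ∧
      Set.EqOn p (∑ j, c j • D.shape j) (cell T)
  then h.choose i else 0

/-- The index set `I^S`: no large element is contained in the support of `φ_i`. -/
def smallIdx : Set D.ι := {i | ∀ T ∈ D.mesh.large Ω γ, i ∉ D.localIdx T}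

open Classical in
/-- The nodal stabilization form
`s_{h,τ}(v,w) = ∑_{i ∈ I^S} τ h^{d-2} φ*_{i,T_i}([v]_{T_i,S_h(T_i)}) φ*_{i,T_i}([w]_{T_i,S_h(T_i)})`. -/
def stab (τ : ℝ) (v w : E d → ℝ) : ℝ :=
  ∑ i with i ∈ D.smallIdx, τ * D.h ^ ((d : ℤ) - 2) *
    D.dof (D.node i) i (jump k (D.node i) (D.S (D.node i)) v) *
    D.dof (D.node i) i (jump k (D.node i) (D.S (D.node i)) w)

/-- The Nitsche form
`a_h(v,w) = (∇v,∇w)_Ω - (∇_n v,w)_∂Ω - (v,∇_n w)_∂Ω + β h⁻¹ (v,w)_∂Ω`. -/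
def nitsche (β : ℝ) (v w : E d → ℝ) : ℝ :=
  (∫ x in Ω, inner ℝ (gradient v x) (gradient w x))
    - (∫ x, normalDeriv Ω v x * w x ∂surfaceMeasure Ω)
    - (∫ x, v x * normalDeriv Ω w x ∂surfaceMeasure Ω)
    + β * D.h⁻¹ * ∫ x, v x * w x ∂surfaceMeasure Ω

/-- `u ∈ V_h` solves the cut finite element method
`a_h(u,v) + s_{h,τ}(u,v) = (f,v)_Ω` for all `v ∈ V_h`. -/
def IsSolution (β τ : ℝ) (f u : E d → ℝ) : Prop :=
  u ∈ D.V ∧ ∀ v ∈ D.V, D.nitsche β u v + D.stab τ u v = ∫ x in Ω, f x * v x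

open Classical in
/-- The operator `Π̃_h v = ∑_{i ∈ I^S} φ*_{i,T_i}((v|_{S_h(T_i)})^e) φ_i
+ ∑_{i ∈ I^L} φ*_{i,T_i}(v) φ_i`. -/
def extOp (v : E d → ℝ) : E d → ℝ :=
  (∑ i with i ∈ D.smallIdx, D.dof (D.node i) i (polyExt k (D.S (D.node i)) v) • D.shape i)
    + ∑ i with i ∉ D.smallIdx, D.dof (D.node i) i v • D.shape i

end Discretization

end CutFEM

end

noncomputable section

namespace CutFEM

/-! ### Polynomial functions -/

/-! The core is an estimate that does not see how Ω cuts the mesh (`exists_energy_bound`): the sum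
over all active elements of the full-element energies ‖∇(v|_T)^e‖²_T is at most a constant times
‖∇v‖²_Ω plus the stabilization seminorm ∑ h^{d-2} |φ*([v])|² over I^S. On a large element this holds
because a polynomial is controlled by its mean square over any subset of a ball whose measure is
bounded below: this is compactness of the unit sphere of coefficients (`exists_coeff_bound`), scaled
to size h (`exists_scaled_bounds`). On a small element T, v is compared with its extension from
S_h(T). A coefficient of the difference is a stabilization functional (for small indices only) plus
the difference of the extensions from two large elements joined by a path of large elements.
Extensions from neighbors agree at a common vertex, so they differ by at most h times gradients,
that is, by energies of large elements along the path (`abs_coeff_sub_le`, `energy_small_le`).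
Quasiuniformity bounds how often each term is counted.

Since a ball of radius h carries boundary measure O(h^{d-1}), the energy estimate yields h‖∇_n
v‖²_∂Ω ≤ Cn (‖∇v‖²_Ω + stabilization) (`exists_normalDeriv_bound`). Young's inequality then makes
the stabilized Nitsche form coercive when β ≥ 4 Cn and τ ≥ 4 Cn/β (`coercive_aux`), which is where
τ₀ = c₀/β comes from. Friedrichs' inequality (`exists_friedrichs`) and `eq_zero_of_stabSq` upgrade
this to positive definiteness on V_h, hence unique solvability. An exterior normal is never required
to exist: where there is none the zero vector serves, and only ‖n‖ ≤ 1 enters the bounds.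

The number φ*_{i,T_i}(v - Π̃_h v) is exactly the stabilization functional (`dof_sub_extOp`), so the
second claim is a bound on the stabilization seminorm of the solution, obtained by testing with the
solution and absorbing (f,u) (`stabSq_le_of_isSolution`).

The third claim is the abstract penalty limit (`exists_penalty_limit`): solutions of a + τ s = F
converge to the solution of the problem restricted to ker s. Coefficients and jump functionals
converge because they are linear functionals, and finitely many bounded basis functions turn this
into uniform convergence. At an element of ker s all jump functionals vanish, so Π̃_h fixes the
limit (`extOp_eq`). -/

theorem measurePreserving_cons (n : ℕ) :
    MeasurePreserving (fun z : (Fin n → ℝ) × ℝ => (Fin.cons z.2 z.1 : Fin (n + 1) → ℝ)) := by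
  have h1 := (volume_preserving_piFinSuccAbove (fun _ : Fin (n + 1) => ℝ) 0).symm
  have h2 : MeasurePreserving (Prod.swap : (Fin n → ℝ) × ℝ → ℝ × (Fin n → ℝ)) :=
    Measure.measurePreserving_swap
  have h3 := h1.comp h2
  convert h3 using 1
  ext z i
  simp [MeasurableEquiv.piFinSuccAbove, Fin.insertNthEquiv, Function.comp]

/-- Fubini and induction: viewed as a univariate polynomial in the first variable, p has a leading
coefficient that is nonzero almost everywhere in the other variables, and there the fibre of the
zero set is finite. -/
theorem volume_mvPolynomial_zeros (n : ℕ) : ∀ p : MvPolynomial (Fin n) ℝ, p ≠ 0 →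
    volume {x : Fin n → ℝ | MvPolynomial.eval x p = 0} = 0 := by
  induction n with
  | zero =>
    intro p hp
    obtain ⟨c, rfl⟩ := MvPolynomial.C_surjective (Fin 0) p
    have hc : c ≠ 0 := by rintro rfl; simp at hp
    simp [hc]
  | succ n ih =>
    intro p hp
    set q := MvPolynomial.finSuccEquiv ℝ n p with hq
    have hq0 : q ≠ 0 := by simpa [hq] using hp
    have hlead : q.leadingCoeff ≠ 0 := by simpa using hq0
    have hZm : MeasurableSet {x : Fin (n + 1) → ℝ | MvPolynomial.eval x p = 0} :=
      (isClosed_eq (MvPolynomial.continuous_eval p) continuous_const).measurableSet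
    have hmp := measurePreserving_cons n
    rw [← hmp.measure_preimage hZm.nullMeasurableSet, Measure.volume_eq_prod,
      Measure.measure_prod_null (hmp.measurable hZm)]
    have h2 : ∀ᵐ x : Fin n → ℝ, MvPolynomial.eval x q.leadingCoeff ≠ 0 := by
      rw [ae_iff]; simpa using ih _ hlead
    filter_upwards [h2] with x hx
    have hne : q.map (MvPolynomial.eval x) ≠ 0 := by
      intro h0
      apply hx
      have := congrArg (fun r => Polynomial.coeff r q.natDegree) h0
      simpa [Polynomial.coeff_map] using this
    refine Set.Finite.measure_zero ?_ _
    refine (Polynomial.finite_setOfPred_isRoot hne).subset ?_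
    intro y hy
    simp only [Set.mem_preimage, Set.mem_ofPred_eq] at hy
    rw [MvPolynomial.eval_eq_eval_mv_eval'] at hy
    exact hy

theorem continuous_evalPoly {d : ℕ} (p : MvPolynomial (Fin d) ℝ) : Continuous (evalPoly d p) := by
  show Continuous fun x : E d => MvPolynomial.eval (fun i => x i) p
  exact (MvPolynomial.continuous_eval p).comp (by fun_prop)

theorem volume_evalPoly_zeros {d : ℕ} {p : MvPolynomial (Fin d) ℝ} (hp : p ≠ 0) :
    volume {x : E d | evalPoly d p x = 0} = 0 := by
  have h := (EuclideanSpace.volume_preserving_symm_measurableEquiv_toLp (Fin d)).symm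
  have h := EuclideanSpace.volume_preserving_symm_measurableEquiv_toLp (Fin d)
  have hm : MeasurableSet {x : Fin d → ℝ | MvPolynomial.eval x p = 0} :=
    (isClosed_eq (MvPolynomial.continuous_eval p) continuous_const).measurableSet
  rw [← volume_mvPolynomial_zeros d p hp, ← h.measure_preimage hm.nullMeasurableSet]
  rfl

section PolySpace

variable {d k : ℕ}

instance : FiniteDimensional ℝ (polySpace d k) := by
  unfold polySpace; infer_instance

theorem continuous_of_mem_polySpace {q : E d → ℝ} (hq : q ∈ polySpace d k) : Continuous q := by
  obtain ⟨p, -, rfl⟩ := hq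
  exact continuous_evalPoly p

theorem volume_zeros_of_mem_polySpace {q : E d → ℝ} (hq : q ∈ polySpace d k) (h0 : q ≠ 0) :
    volume {x | q x = 0} = 0 := by
  obtain ⟨p, -, rfl⟩ := hq
  exact volume_evalPoly_zeros (by rintro rfl; simp at h0)

/-- The source of all uniqueness statements for polynomial extensions, including those from cut
pieces of elements. -/
theorem eq_of_eqOn_of_volume_ne_zero {p q : E d → ℝ} (hp : p ∈ polySpace d k)
    (hq : q ∈ polySpace d k) {A : Set (E d)} (hA : volume A ≠ 0) (h : Set.EqOn p q A) : p = q := by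
  by_contra hne
  refine hA (measure_mono_null ?_ (volume_zeros_of_mem_polySpace (sub_mem hp hq) (sub_ne_zero.2 hne)))
  intro x hx
  simp [h hx]

theorem hasFDerivAt_evalPoly (p : MvPolynomial (Fin d) ℝ) (x : E d) :
    HasFDerivAt (evalPoly d p) (∑ j, evalPoly d (MvPolynomial.pderiv j p) x •
      (EuclideanSpace.proj j : E d →L[ℝ] ℝ)) x := by
  induction p using MvPolynomial.induction_on with
  | C a =>
    have : evalPoly d (MvPolynomial.C a) = fun _ => a := by ext; simp [evalPoly]
    rw [this]
    simpa using hasFDerivAt_const a x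
  | add p q hp hq =>
    rw [map_add]
    refine (hp.add hq).congr_fderiv ?_
    simp [add_smul, Finset.sum_add_distrib]
  | mul_X p n hp =>
    have h1 : evalPoly d (p * MvPolynomial.X n) = fun y => evalPoly d p y * y n := by
      ext; simp [evalPoly]
    have hX : HasFDerivAt (fun y : E d => y n) (EuclideanSpace.proj n : E d →L[ℝ] ℝ) x :=
      (EuclideanSpace.proj n : E d →L[ℝ] ℝ).hasFDerivAt
    rw [h1]
    refine (hp.mul hX).congr_fderiv ?_
    ext v
    simp only [sum_apply, smul_apply, add_apply, smul_eq_mul, Finset.mul_sum,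
      MvPolynomial.pderiv_mul]
    have : ∀ j : Fin d, evalPoly d (MvPolynomial.pderiv j p * MvPolynomial.X n +
        p * MvPolynomial.pderiv j (MvPolynomial.X n)) x * (EuclideanSpace.proj j : E d →L[ℝ] ℝ) v =
        x n * (evalPoly d (MvPolynomial.pderiv j p) x * (EuclideanSpace.proj j : E d →L[ℝ] ℝ) v) +
        if j = n then evalPoly d p x * v n else 0 := by
      intro j
      rw [MvPolynomial.pderiv_X]
      by_cases hj : j = n
      · subst hj; simp [evalPoly]; ring
      · simp [evalPoly, hj, Ne.symm hj]; ring
    simp_rw [this]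
    rw [Finset.sum_add_distrib]
    simp [add_comm]

theorem gradient_evalPoly (p : MvPolynomial (Fin d) ℝ) (x : E d) (j : Fin d) :
    gradient (evalPoly d p) x j = evalPoly d (MvPolynomial.pderiv j p) x := by
  have h : inner ℝ (gradient (evalPoly d p) x) (EuclideanSpace.single j (1:ℝ)) =
      fderiv ℝ (evalPoly d p) x (EuclideanSpace.single j (1:ℝ)) := by
    simp [gradient]
  rw [(hasFDerivAt_evalPoly p x).fderiv, EuclideanSpace.inner_single_right] at h
  simpa [sum_apply, Pi.single_apply] using h

theorem totalDegree_pderiv_le (p : MvPolynomial (Fin d) ℝ) (j : Fin d) :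
    (MvPolynomial.pderiv j p).totalDegree ≤ p.totalDegree := by
  conv_lhs => rw [p.as_sum, map_sum]
  refine MvPolynomial.totalDegree_finsetSum_le fun s hs => ?_
  rw [MvPolynomial.pderiv_monomial]
  refine (MvPolynomial.totalDegree_monomial_le _ _).trans
    (le_trans ?_ (MvPolynomial.le_totalDegree hs))
  rw [Finsupp.sum_fintype _ _ (by simp), Finsupp.sum_fintype _ _ (by simp)]
  exact Finset.sum_le_sum fun i _ => by simp

theorem gradient_apply_mem_polySpace {q : E d → ℝ} (hq : q ∈ polySpace d k) (j : Fin d) :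
    (fun x => gradient q x j) ∈ polySpace d k := by
  obtain ⟨p, hp, rfl⟩ := hq
  refine ⟨MvPolynomial.pderiv j p, ?_, ?_⟩
  · have hp' : p.totalDegree ≤ k := (MvPolynomial.mem_restrictTotalDegree _ _ _).1 hp
    exact (MvPolynomial.mem_restrictTotalDegree _ _ _).2 ((totalDegree_pderiv_le p j).trans hp')
  · ext x; rw [gradient_evalPoly]

theorem differentiable_of_mem_polySpace {q : E d → ℝ} (hq : q ∈ polySpace d k) :
    Differentiable ℝ q := by
  obtain ⟨p, -, rfl⟩ := hq
  exact fun x => (hasFDerivAt_evalPoly p x).differentiableAt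

theorem continuous_gradient_of_mem_polySpace {q : E d → ℝ} (hq : q ∈ polySpace d k) :
    Continuous (gradient q) := by
  have : gradient q = fun x => WithLp.toLp 2 (fun j => gradient q x j) := rfl
  rw [this]
  refine (PiLp.continuous_toLp 2 _).comp (continuous_pi fun j => ?_)
  exact continuous_of_mem_polySpace (gradient_apply_mem_polySpace hq j)

theorem comp_affine_mem_polySpace {q : E d → ℝ} (hq : q ∈ polySpace d k) (c : E d) (h : ℝ) :
    (fun x => q (c + h • x)) ∈ polySpace d k := by
  obtain ⟨p, hp, rfl⟩ := hq
  have hp' : p.totalDegree ≤ k := (MvPolynomial.mem_restrictTotalDegree _ _ _).1 hp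
  refine ⟨MvPolynomial.bind₁ (fun i => MvPolynomial.C (c i) + MvPolynomial.C h * MvPolynomial.X i) p,
    (MvPolynomial.mem_restrictTotalDegree _ _ _).2 ?_, ?_⟩
  · conv_lhs => rw [p.as_sum, map_sum]
    refine MvPolynomial.totalDegree_finsetSum_le fun s hs => ?_
    rw [MvPolynomial.bind₁_monomial]
    refine (MvPolynomial.totalDegree_mul _ _).trans ?_
    rw [MvPolynomial.totalDegree_C, zero_add]
    refine (MvPolynomial.totalDegree_finsetProd _ _).trans
      (le_trans ?_ ((MvPolynomial.le_totalDegree hs).trans hp'))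
    refine Finset.sum_le_sum fun i _ => (MvPolynomial.totalDegree_pow _ _).trans ?_
    have h1 : (MvPolynomial.C (c i) + MvPolynomial.C h * MvPolynomial.X i :
        MvPolynomial (Fin d) ℝ).totalDegree ≤ 1 := by
      refine (MvPolynomial.totalDegree_add _ _).trans (max_le (by simp) ?_)
      refine (MvPolynomial.totalDegree_mul _ _).trans ?_
      simp
    exact (Nat.mul_le_mul_left _ h1).trans (by simp)
  · ext x
    show MvPolynomial.eval (fun i => x i) _ = MvPolynomial.eval (fun i => (c + h • x) i) p
    rw [MvPolynomial.eval, MvPolynomial.eval₂Hom_bind₁]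
    congr 2
    ext i
    simp

end PolySpace

end CutFEM

/-! ### Norm equivalence on polynomials, and scaling to size h -/

namespace CutFEM

section

variable {d k : ℕ} {ι : Type*} [Fintype ι]

/-- On a finite dimensional space of polynomials, the coefficients are controlled by the mean square
over an arbitrary subset of a ball with measure bounded from below. -/
theorem exists_coeff_bound (b : Module.Basis ι ℝ (polySpace d k)) (R θ : ℝ) (hθ : 0 < θ) :
    ∃ C > 0, ∀ A : Set (E d), MeasurableSet A → A ⊆ Metric.closedBall 0 R →
      ENNReal.ofReal θ ≤ volume A → ∀ a : ι → ℝ,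
        ‖a‖ ^ 2 ≤ C * ∫ x in A, (∑ j, a j * (b j : E d → ℝ) x) ^ 2 := by
  classical
  let Q : (ι → ℝ) → E d → ℝ := fun a x => ∑ j, a j * (b j : E d → ℝ) x
  have hQc : ∀ a, Continuous (Q a) := fun a =>
    continuous_finsetSum _ fun j _ => continuous_const.mul (continuous_of_mem_polySpace (b j).2)
  have hQm : ∀ a, Q a ∈ polySpace d k := by
    intro a
    have : Q a = ((∑ j, a j • b j : polySpace d k) : E d → ℝ) := by
      ext x; simp [Q]
    rw [this]; exact Submodule.coe_mem _
  have hQ0 : ∀ a, Q a = 0 → a = 0 := by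
    intro a ha
    have h1 : (∑ j, a j • b j : polySpace d k) = 0 := by
      apply Subtype.ext; rw [ZeroMemClass.coe_zero, ← ha]; ext x; simp [Q]
    ext j
    exact Fintype.linearIndependent_iff.1 b.linearIndependent a h1 j
  set B := Metric.closedBall (0 : E d) R with hB
  obtain ⟨M, hM⟩ : ∃ M, ∀ x ∈ B, ∑ j, |(b j : E d → ℝ) x| ≤ M := by
    have hc : Continuous fun x : E d => ∑ j, |(b j : E d → ℝ) x| :=
      continuous_finsetSum _ fun j _ => (continuous_of_mem_polySpace (b j).2).abs
    obtain ⟨M, hM⟩ := (isCompact_closedBall (0 : E d) R).bddAbove_image hc.continuousOn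
    exact ⟨M, fun x hx => hM ⟨x, hx, rfl⟩⟩
  have hclose : ∀ a a' : ι → ℝ, ∀ x ∈ B, |Q a x - Q a' x| ≤ ‖a - a'‖ * M := by
    intro a a' x hx
    have : Q a x - Q a' x = ∑ j, (a j - a' j) * (b j : E d → ℝ) x := by
      simp [Q, sub_mul]
    rw [this]
    refine (Finset.abs_sum_le_sum_abs _ _).trans ?_
    refine le_trans ?_ (mul_le_mul_of_nonneg_left (hM x hx) (norm_nonneg _))
    rw [Finset.mul_sum]
    refine Finset.sum_le_sum fun j _ => ?_
    rw [abs_mul]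
    exact mul_le_mul_of_nonneg_right (norm_le_pi_norm (a - a') j) (abs_nonneg _)
  -- A lower bound uniform in A is found near each unit coefficient vector, and compactness of the
  -- sphere makes it global. The general case follows by homogeneity.
  have hmain : ∃ c > 0, ∀ a ∈ Metric.sphere (0 : ι → ℝ) 1, ∀ A : Set (E d), MeasurableSet A → A ⊆ B →
      ENNReal.ofReal θ ≤ volume A → c ≤ ∫ x in A, (Q a x) ^ 2 := by
    refine (isCompact_sphere (0 : ι → ℝ) 1).induction_on
      (p := fun s => ∃ c > 0, ∀ a ∈ s, ∀ A : Set (E d), MeasurableSet A → A ⊆ B →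
      ENNReal.ofReal θ ≤ volume A → c ≤ ∫ x in A, (Q a x) ^ 2) ?_ ?_ ?_ ?_
    · exact ⟨1, one_pos, by simp⟩
    · rintro s t hst ⟨c, hc, h⟩
      exact ⟨c, hc, fun a ha => h a (hst ha)⟩
    · rintro s t ⟨c, hc, h⟩ ⟨c', hc', h'⟩
      refine ⟨min c c', lt_min hc hc', ?_⟩
      rintro a (ha | ha) A hA hAB hAθ
      · exact (min_le_left _ _).trans (h a ha A hA hAB hAθ)
      · exact (min_le_right _ _).trans (h' a ha A hA hAB hAθ)
    · intro a ha
      have ha0 : a ≠ 0 := by rintro rfl; simp at ha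
      have hnull := volume_zeros_of_mem_polySpace (hQm a) (fun h => ha0 (hQ0 a h))
      -- The sublevel sets shrink to the null zero set, so one of them has measure below θ/2. Every
      -- admissible A therefore keeps measure at least θ/2 outside it, which is what makes ε
      -- independent of A.
      obtain ⟨ε, hε, hεm⟩ : ∃ ε > 0, volume (B ∩ {x | |Q a x| < 2 * ε}) < ENNReal.ofReal (θ / 2) := by
        let S : ℕ → Set (E d) := fun n => B ∩ {x | |Q a x| < 2 * (1 / ((n:ℝ) + 1))}
        have hSm : ∀ n, MeasurableSet (S n) := fun n =>
          Metric.isClosed_closedBall.measurableSet.inter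
            (isOpen_lt (hQc a).abs continuous_const).measurableSet
        have hanti : Antitone S := by
          intro m n hmn x hx
          refine ⟨hx.1, show |Q a x| < _ from lt_of_lt_of_le hx.2 ?_⟩
          have := Nat.one_div_le_one_div (α := ℝ) hmn
          linarith
        have hlim := tendsto_measure_iInter_atTop (μ := volume) (s := S)
          (fun n => (hSm n).nullMeasurableSet) hanti
          ⟨0, ((measure_mono Set.inter_subset_left).trans_lt
            (isCompact_closedBall (0 : E d) R).measure_lt_top).ne⟩
        have h0 : volume (⋂ n, S n) = 0 := by
          refine measure_mono_null ?_ hnull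
          intro x hx
          rw [Set.mem_iInter] at hx
          have h1 : Tendsto (fun n : ℕ => 2 * (1 / ((n:ℝ) + 1))) atTop (𝓝 (2 * 0)) :=
            tendsto_one_div_add_atTop_nhds_zero_nat.const_mul 2
          have h2 := ge_of_tendsto' h1 fun n => (hx n).2.le
          simpa using h2
        rw [h0] at hlim
        have hpos : (0 : ENNReal) < ENNReal.ofReal (θ / 2) := by simpa using hθ
        obtain ⟨n, hn⟩ := (hlim.eventually (gt_mem_nhds hpos)).exists
        exact ⟨1 / ((n:ℝ) + 1), Nat.one_div_pos_of_nat, hn⟩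
      have hMpos : 0 < |M| + 1 := by positivity
      -- Within this radius the polynomials differ by at most ε on the ball, so the lower bound 2ε
      -- for `Q a` leaves ε for `Q a'`.
      refine ⟨Metric.ball a (ε / (|M| + 1)),
        mem_nhdsWithin_of_mem_nhds (Metric.ball_mem_nhds a (by positivity)),
        ε ^ 2 * (θ / 2), by positivity, ?_⟩
      intro a' ha' A hA hAB hAθ
      have hfin : volume A < ⊤ :=
        (measure_mono hAB).trans_lt (isCompact_closedBall (0 : E d) R).measure_lt_top
      have hsub : A \ (B ∩ {x | |Q a x| < 2 * ε}) ⊆ {x | ε ^ 2 ≤ Q a' x ^ 2} ∩ A := by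
        rintro x ⟨hxA, hx⟩
        refine ⟨?_, hxA⟩
        have h1 : 2 * ε ≤ |Q a x| := by
          by_contra hlt
          exact hx ⟨hAB hxA, not_le.1 hlt⟩
        have h2 := hclose a' a x (hAB hxA)
        have h3 : ‖a' - a‖ * M ≤ ε := by
          have h4 : ‖a' - a‖ < ε / (|M| + 1) := by simpa [dist_eq_norm] using ha'
          calc ‖a' - a‖ * M ≤ ‖a' - a‖ * (|M| + 1) :=
                mul_le_mul_of_nonneg_left (by linarith [le_abs_self M]) (norm_nonneg _)
            _ ≤ ε / (|M| + 1) * (|M| + 1) := mul_le_mul_of_nonneg_right h4.le hMpos.le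
            _ = ε := by field_simp
        have h5 : ε ≤ |Q a' x| := by
          have := abs_sub_abs_le_abs_sub (Q a x) (Q a' x)
          rw [abs_sub_comm] at this
          linarith
        show ε ^ 2 ≤ Q a' x ^ 2
        rw [← sq_abs (Q a' x)]
        exact pow_le_pow_left₀ hε.le h5 2
      have hint : Integrable (fun x => Q a' x ^ 2) (volume.restrict A) :=
        (((hQc a').pow 2).continuousOn.integrableOn_compact
          (isCompact_closedBall (0 : E d) R)).mono_set hAB
      have hmk := mul_meas_ge_le_integral_of_nonneg (μ := volume.restrict A)
        (f := fun x => Q a' x ^ 2) (ae_of_all _ fun x => sq_nonneg _) hint (ε ^ 2)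
      refine le_trans (mul_le_mul_of_nonneg_left ?_ (sq_nonneg ε)) hmk
      rw [measureReal_def, Measure.restrict_apply (by
        exact (isClosed_le continuous_const ((hQc a').pow 2)).measurableSet)]
      have h6 : ENNReal.ofReal (θ / 2) ≤ volume ({x | ε ^ 2 ≤ Q a' x ^ 2} ∩ A) := by
        refine le_trans ?_ (measure_mono hsub)
        refine le_trans ?_ (le_measure_sdiff)
        have h7 : ENNReal.ofReal (θ / 2) = ENNReal.ofReal θ - ENNReal.ofReal (θ / 2) := by
          rw [← ENNReal.ofReal_sub _ (by positivity)]; congr 1; ring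
        rw [h7]
        exact tsub_le_tsub hAθ hεm.le
      exact (ENNReal.ofReal_le_iff_le_toReal
        ((measure_mono Set.inter_subset_right).trans_lt hfin).ne).1 h6
  obtain ⟨c, hc, h⟩ := hmain
  refine ⟨c⁻¹, inv_pos.2 hc, ?_⟩
  intro A hA hAB hAθ a
  by_cases ha : a = 0
  · subst ha
    simp
  have hn : 0 < ‖a‖ := norm_pos_iff.2 ha
  have h1 := h (‖a‖⁻¹ • a) (by simp [norm_smul, hn.ne']) A hA hAB hAθ
  have h2 : ∀ x, Q (‖a‖⁻¹ • a) x ^ 2 = (‖a‖⁻¹) ^ 2 * (∑ j, a j * (b j : E d → ℝ) x) ^ 2 := by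
    intro x
    rw [← mul_pow, Finset.mul_sum]
    simp [Q, mul_assoc]
  simp_rw [h2, integral_const_mul] at h1
  rw [inv_pow, ← div_eq_inv_mul, le_div_iff₀ (by positivity)] at h1
  rw [← div_eq_inv_mul, le_div_iff₀ hc]
  linarith

theorem setIntegral_affine (f : E d → ℝ) {A : Set (E d)} (c : E d) {h : ℝ}
    (hh : 0 < h) (hA : MeasurableSet A) :
    ∫ x in A, f x = h ^ d * ∫ y in (fun y => c + h • y) ⁻¹' A, f (c + h • y) := by
  have hm : Measurable fun y : E d => c + h • y := by fun_prop
  rw [← integral_indicator hA, ← integral_indicator (hm hA)]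
  have h1 : ((fun y => c + h • y) ⁻¹' A).indicator (fun y => f (c + h • y)) =
      fun y => (fun z => A.indicator f (c + z)) (h • y) := by
    ext y; exact Set.indicator_comp_right (fun y : E d => c + h • y) (g := f)
  rw [h1, Measure.integral_comp_smul volume, integral_add_left_eq_self]
  have : (0:ℝ) < h ^ d := by positivity
  simp [abs_of_pos this, this.ne']

theorem volume_preimage_affine {A : Set (E d)} (c : E d) {h : ℝ} (hh : 0 < h) :
    volume ((fun y : E d => c + h • y) ⁻¹' A) = ENNReal.ofReal ((h ^ d)⁻¹) * volume A := by
  have : (fun y : E d => c + h • y) ⁻¹' A = (fun y => h • y) ⁻¹' ((fun y => c + y) ⁻¹' A) := rfl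
  rw [this, Measure.addHaar_preimage_smul volume hh.ne', measure_preimage_add]
  simp [abs_of_pos hh]

theorem gradient_comp_affine {q : E d → ℝ} (hq : Differentiable ℝ q) (c : E d) (h : ℝ) (y : E d) :
    gradient (fun y => q (c + h • y)) y = h • gradient q (c + h • y) := by
  have h1 : HasFDerivAt (fun y : E d => c + h • y) (h • ContinuousLinearMap.id ℝ (E d)) y :=
    ((hasFDerivAt_id y).const_smul h).const_add c
  have h2 := (hq (c + h • y)).hasFDerivAt.comp y h1
  have h3 : fderiv ℝ (fun y => q (c + h • y)) y = h • fderiv ℝ q (c + h • y) := by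
    refine h2.fderiv.trans ?_
    ext v; simp
  rw [gradient, h3, map_smul, gradient]

theorem gradient_sum_smul {b : ι → E d → ℝ} (hb : ∀ j, Differentiable ℝ (b j)) (a : ι → ℝ) (y : E d) :
    gradient (fun x => ∑ j, a j * b j x) y = ∑ j, a j • gradient (b j) y := by
  have h2 : HasFDerivAt (fun x => ∑ j, a j * b j x) (∑ j, a j • fderiv ℝ (b j) y) y :=
    HasFDerivAt.fun_sum fun j _ => ((hb j y).hasFDerivAt.const_mul (a j))
  rw [gradient, h2.fderiv, map_sum]
  simp [gradient]

/-- The substitution x = c + h y reduces both estimates to a fixed ball, where the coefficients are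
bounded by `exists_coeff_bound` and the basis and its gradients by compactness. The gradient picks
up the factor h from the chain rule, the integral the factor h^d. -/
theorem exists_scaled_bounds_fun (d k : ℕ) (R θ : ℝ) (hθ : 0 < θ) :
    ∃ C > 0, ∀ (h : ℝ) (c : E d) (A : Set (E d)), 0 < h → MeasurableSet A →
      A ⊆ Metric.closedBall c (R * h) → ENNReal.ofReal (θ * h ^ d) ≤ volume A →
      ∀ q ∈ polySpace d k, ∀ x ∈ Metric.closedBall c (R * h),
        h ^ d * q x ^ 2 ≤ C * ∫ y in A, q y ^ 2 ∧
        h ^ d * (h ^ 2 * ‖gradient q x‖ ^ 2) ≤ C * ∫ y in A, q y ^ 2 := by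
  classical
  let b := Module.finBasis ℝ (polySpace d k)
  have hbc : ∀ j, Continuous (b j : E d → ℝ) := fun j => continuous_of_mem_polySpace (b j).2
  have hbd : ∀ j, Differentiable ℝ (b j : E d → ℝ) := fun j => differentiable_of_mem_polySpace (b j).2
  obtain ⟨C, hC, hcoef⟩ := exists_coeff_bound b R θ hθ
  obtain ⟨M, hM⟩ : ∃ M, ∀ x ∈ Metric.closedBall (0 : E d) R,
      (∑ j, |(b j : E d → ℝ) x|) + ∑ j, ‖gradient (b j : E d → ℝ) x‖ ≤ M := by
    have hc : Continuous fun x : E d =>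
        (∑ j, |(b j : E d → ℝ) x|) + ∑ j, ‖gradient (b j : E d → ℝ) x‖ :=
      (continuous_finsetSum _ fun j _ => (hbc j).abs).add
        (continuous_finsetSum _ fun j _ => (continuous_gradient_of_mem_polySpace (b j).2).norm)
    obtain ⟨M, hM⟩ := (isCompact_closedBall (0 : E d) R).bddAbove_image hc.continuousOn
    exact ⟨M, fun x hx => hM ⟨x, hx, rfl⟩⟩
  -- Nothing excludes M = 0, so the summand 1 secures positivity.
  refine ⟨C * M ^ 2 + 1, by positivity, ?_⟩
  intro h c A hh hA hAB hAθ q hq x hx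
  set φ : E d → E d := fun y => c + h • y with hφ
  have hφm : Measurable φ := by fun_prop
  let q' : polySpace d k := ⟨fun y => q (φ y), comp_affine_mem_polySpace hq c h⟩
  set a : Fin (Module.finrank ℝ (polySpace d k)) → ℝ := fun j => b.repr q' j with ha
  have hq' : ∀ y, q (φ y) = ∑ j, a j * (b j : E d → ℝ) y := by
    intro y
    have h1 : (q' : E d → ℝ) y = ((∑ j, a j • b j : polySpace d k) : E d → ℝ) y := by
      rw [ha, b.sum_repr]
    simpa using h1
  have hball : ∀ y, φ y ∈ Metric.closedBall c (R * h) ↔ y ∈ Metric.closedBall 0 R := by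
    intro y
    simp [hφ, norm_smul, abs_of_pos hh, mul_comm R, hh]
  have hcA := hcoef (φ ⁻¹' A) (hφm hA) (fun y hy => (hball y).1 (hAB hy)) (by
    rw [volume_preimage_affine c hh]
    refine le_trans ?_ (mul_le_mul_right hAθ _)
    rw [← ENNReal.ofReal_mul (by positivity)]
    refine ENNReal.ofReal_le_ofReal (le_of_eq ?_)
    field_simp) a
  simp_rw [← hq'] at hcA
  have hI := setIntegral_affine (fun y => q y ^ 2) c hh hA
  set I := ∫ y in φ ⁻¹' A, q (φ y) ^ 2
  have hI0 : 0 ≤ I := integral_nonneg fun _ => sq_nonneg _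
  obtain ⟨y, rfl⟩ : ∃ y, φ y = x := ⟨h⁻¹ • (x - c), by simp [hφ, smul_smul, hh.ne']⟩
  have hy := (hball y).1 hx
  have hMy := hM y hy
  have hs1 : 0 ≤ ∑ j, |(b j : E d → ℝ) y| := Finset.sum_nonneg fun _ _ => abs_nonneg _
  have hs2 : 0 ≤ ∑ j, ‖gradient (b j : E d → ℝ) y‖ := Finset.sum_nonneg fun _ _ => norm_nonneg _
  have hhd : 0 < h ^ d := by positivity
  have hfin : ∀ t : ℝ, 0 ≤ t → t ≤ ‖a‖ * M →
      h ^ d * t ^ 2 ≤ (C * M ^ 2 + 1) * ∫ y in A, q y ^ 2 := by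
    intro t ht0 ht
    rw [hI]
    have h1 : t ^ 2 ≤ ‖a‖ ^ 2 * M ^ 2 := by rw [← mul_pow]; exact pow_le_pow_left₀ ht0 ht 2
    have h2 : ‖a‖ ^ 2 * M ^ 2 ≤ (C * I) * M ^ 2 := mul_le_mul_of_nonneg_right hcA (sq_nonneg M)
    calc h ^ d * t ^ 2 ≤ h ^ d * ((C * I) * M ^ 2) := by gcongr; linarith
      _ ≤ h ^ d * ((C * I) * M ^ 2) + h ^ d * I := le_add_of_nonneg_right (by positivity)
      _ = _ := by ring
  constructor
  · rw [← sq_abs]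
    refine hfin _ (abs_nonneg _) ?_
    rw [hq']
    refine (Finset.abs_sum_le_sum_abs _ _).trans ?_
    refine le_trans ?_ (mul_le_mul_of_nonneg_left (by linarith : ∑ j, |(b j : E d → ℝ) y| ≤ M)
      (norm_nonneg a))
    rw [Finset.mul_sum]
    refine Finset.sum_le_sum fun j _ => ?_
    rw [abs_mul]
    exact mul_le_mul_of_nonneg_right (norm_le_pi_norm a j) (abs_nonneg _)
  · rw [← mul_pow]
    refine hfin _ (by positivity) ?_
    have h1 : h * ‖gradient q (φ y)‖ = ‖gradient (fun y => q (φ y)) y‖ := by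
      rw [gradient_comp_affine (differentiable_of_mem_polySpace hq), norm_smul, Real.norm_eq_abs,
        abs_of_pos hh]
    rw [h1]
    simp_rw [hq']
    rw [gradient_sum_smul hbd]
    refine (norm_sum_le _ _).trans ?_
    refine le_trans ?_ (mul_le_mul_of_nonneg_left
      (by linarith : ∑ j, ‖gradient (b j : E d → ℝ) y‖ ≤ M) (norm_nonneg a))
    rw [Finset.mul_sum]
    refine Finset.sum_le_sum fun j _ => ?_
    rw [norm_smul]
    exact mul_le_mul_of_nonneg_right (norm_le_pi_norm a j) (norm_nonneg _)

/-- Scaled norm equivalences for polynomials: pointwise values and gradients in a ball of radius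
`R h` are controlled by mean squares over any subset of measure at least `θ h ^ d`. -/
theorem exists_scaled_bounds (d k : ℕ) (R θ : ℝ) (hθ : 0 < θ) :
    ∃ C > 0, ∀ (h : ℝ) (c : E d) (A : Set (E d)), 0 < h → MeasurableSet A →
      A ⊆ Metric.closedBall c (R * h) → ENNReal.ofReal (θ * h ^ d) ≤ volume A →
      ∀ q ∈ polySpace d k, ∀ x ∈ Metric.closedBall c (R * h),
        h ^ d * q x ^ 2 ≤ C * ∫ y in A, q y ^ 2 ∧
        h ^ d * (h ^ 2 * ‖gradient q x‖ ^ 2) ≤ C * ∫ y in A, q y ^ 2 ∧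
        h ^ d * ‖gradient q x‖ ^ 2 ≤ C * ∫ y in A, ‖gradient q y‖ ^ 2 := by
  obtain ⟨C, hC, H⟩ := exists_scaled_bounds_fun d k R θ hθ
  refine ⟨C, hC, fun h c A hh hA hAB hAθ q hq x hx => ?_⟩
  refine ⟨(H h c A hh hA hAB hAθ q hq x hx).1, (H h c A hh hA hAB hAθ q hq x hx).2, ?_⟩
  -- The third bound is the first one applied to each partial derivative, again a polynomial of
  -- degree at most k.
  simp_rw [EuclideanSpace.real_norm_sq_eq]
  rw [integral_finsetSum, Finset.mul_sum, Finset.mul_sum]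
  · exact Finset.sum_le_sum fun j _ =>
      (H h c A hh hA hAB hAθ _ (gradient_apply_mem_polySpace hq j) x hx).1
  · intro j _
    exact (((continuous_of_mem_polySpace (gradient_apply_mem_polySpace hq j)).pow
      2).continuousOn.integrableOn_compact (isCompact_closedBall c (R * h))).mono_set hAB

end

end CutFEM

/-! ### Geometry of quasiuniform meshes and the finite element space -/

namespace CutFEM

section Mesh

variable {d k : ℕ}

theorem isCompact_cell (T : Finset (E d)) : IsCompact (cell T) :=
  T.finite_toSet.isCompact_convexHull ℝ

theorem measurableSet_cell (T : Finset (E d)) : MeasurableSet (cell T) :=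
  (isCompact_cell T).isClosed.measurableSet

theorem convex_cell (T : Finset (E d)) : Convex ℝ (cell T) := convex_convexHull ℝ _

theorem subset_cell (T : Finset (E d)) : (T : Set (E d)) ⊆ cell T := subset_convexHull ℝ _

/-- The volume of the Euclidean unit ball. -/
def ballVolume (d : ℕ) : ℝ := (volume (Metric.ball (0 : E d) 1)).toReal

theorem ballVolume_pos (d : ℕ) : 0 < ballVolume d :=
  ENNReal.toReal_pos (Metric.measure_ball_pos volume _ one_pos).ne' measure_ball_lt_top.ne

theorem volume_closedBall_eq (x : E d) {r : ℝ} (hr : 0 ≤ r) :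
    volume (Metric.closedBall x r) = ENNReal.ofReal (ballVolume d * r ^ d) := by
  rw [Measure.addHaar_closedBall volume x hr, ballVolume, ENNReal.ofReal_mul ENNReal.toReal_nonneg,
    ENNReal.ofReal_toReal measure_ball_lt_top.ne, mul_comm]
  simp

namespace Mesh

variable {M : Mesh d} {h ρ : ℝ}

theorem finite_elements (M : Mesh d) : M.elements.Finite :=
  M.finite_faces.subset fun _ hT => hT.1

/-- By conformity the intersection lies in the hull of the common vertices. Distinct elements have
equally many vertices, so some vertex of T is missing, and by affine independence the common ones
span a proper affine subspace. -/
theorem volume_cell_inter {T T' : Finset (E d)} (hT : T ∈ M.elements) (hT' : T' ∈ M.elements)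
    (hne : T ≠ T') : volume (cell T ∩ cell T') = 0 := by
  classical
  have hsub : cell T ∩ cell T' ⊆ convexHull ℝ ((T : Set (E d)) ∩ T') :=
    M.complex.inter_subset_convexHull hT.1 hT'.1
  obtain ⟨v, hvT, hvT'⟩ : ∃ v ∈ T, v ∉ T' := by
    by_contra! hcon
    exact hne (Finset.eq_of_subset_of_card_le hcon (by rw [hT.2, hT'.2]))
  have hind : AffineIndependent ℝ ((↑) : T → E d) := M.complex.indep hT.1
  have hnot := hind.notMem_affineSpan_sdiff ⟨v, hvT⟩ Set.univ
  have hspan : affineSpan ℝ ((T : Set (E d)) ∩ T') ≠ ⊤ := by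
    intro htop
    apply hnot
    have h1 : (T : Set (E d)) ∩ T' ⊆ ((↑) : T → E d) '' (Set.univ \ {⟨v, hvT⟩}) := by
      rintro x ⟨hx, hx'⟩
      refine ⟨⟨x, hx⟩, ⟨trivial, ?_⟩, rfl⟩
      intro hxv
      rw [Set.mem_singleton_iff, Subtype.mk.injEq] at hxv
      exact hvT' (hxv ▸ hx')
    have h2 := affineSpan_mono ℝ h1
    rw [htop] at h2
    exact h2 (AffineSubspace.mem_top ℝ _ _)
  exact measure_mono_null (hsub.trans (convexHull_subset_affineSpan _))
    (Measure.addHaar_affineSubspace volume _ hspan)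

theorem IsQuasiUniform.cell_subset_closedBall (hM : M.IsQuasiUniform h ρ) {T : Finset (E d)}
    (hT : T ∈ M.elements) {x : E d} (hx : x ∈ cell T) : cell T ⊆ Metric.closedBall x h :=
  fun _ hy => (Metric.dist_le_diam_of_mem (isCompact_cell T).isBounded hy hx).trans (hM T hT).1

theorem IsQuasiUniform.le_volume_cell (hM : M.IsQuasiUniform h ρ) (hh : 0 < h) (hρ : 0 < ρ)
    {T : Finset (E d)} (hT : T ∈ M.elements) :
    ENNReal.ofReal (ballVolume d * ρ ^ d * h ^ d) ≤ volume (cell T) := by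
  obtain ⟨c, hc⟩ := (hM T hT).2
  refine le_trans (le_of_eq ?_) (measure_mono hc)
  rw [volume_closedBall_eq c (by positivity), mul_pow, mul_assoc]

theorem IsQuasiUniform.interior_cell_nonempty (hM : M.IsQuasiUniform h ρ) (hh : 0 < h) (hρ : 0 < ρ)
    {T : Finset (E d)} (hT : T ∈ M.elements) : (interior (cell T)).Nonempty := by
  obtain ⟨c, hc⟩ := (hM T hT).2
  exact ⟨c, interior_mono hc (Metric.ball_subset_interior_closedBall
    (Metric.mem_ball_self (by positivity)))⟩

theorem IsQuasiUniform.volume_cell_ne_zero (hM : M.IsQuasiUniform h ρ) (hh : 0 < h) (hρ : 0 < ρ)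
    {T : Finset (E d)} (hT : T ∈ M.elements) : volume (cell T) ≠ 0 := by
  intro h0
  have h1 := hM.le_volume_cell hh hρ hT
  rw [h0, nonpos_iff_eq_zero, ENNReal.ofReal_eq_zero] at h1
  have := ballVolume_pos d
  exact absurd h1 (not_le.2 (by positivity))

theorem measure_biUnion_cell {F : Finset (Finset (E d))} (hF : ∀ T ∈ F, T ∈ M.elements) :
    volume (⋃ T ∈ F, cell T) = ∑ T ∈ F, volume (cell T) :=
  measure_biUnion_finset₀ (fun T hT T' hT' hne => volume_cell_inter (hF T hT) (hF T' hT') hne)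
    fun T _ => (measurableSet_cell T).nullMeasurableSet

/-- The number of elements in a ball of radius `R h` is bounded. -/
theorem IsQuasiUniform.card_le (hM : M.IsQuasiUniform h ρ) (hh : 0 < h) (hρ : 0 < ρ) {x : E d}
    {R : ℝ} (hR : 0 ≤ R) {F : Finset (Finset (E d))} (hF : ∀ T ∈ F, T ∈ M.elements)
    (hFx : ∀ T ∈ F, cell T ⊆ Metric.closedBall x (R * h)) : (F.card : ℝ) ≤ (R / ρ) ^ d := by
  -- Packing: almost disjoint cells, each of volume at least that of a ball of radius ρ h, lie in a
  -- ball of radius R h.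
  have h1 : volume (⋃ T ∈ F, cell T) ≤ volume (Metric.closedBall x (R * h)) :=
    measure_mono (Set.iUnion₂_subset hFx)
  rw [measure_biUnion_cell hF, volume_closedBall_eq x (by positivity)] at h1
  have h2 := (Finset.sum_le_sum fun T hT => hM.le_volume_cell hh hρ (hF T hT)).trans h1
  have hb := ballVolume_pos d
  rw [Finset.sum_const, nsmul_eq_mul, ← ENNReal.ofReal_natCast, ← ENNReal.ofReal_mul (by positivity),
    ENNReal.ofReal_le_ofReal_iff (by positivity), mul_pow] at h2
  rw [div_pow, le_div_iff₀ (by positivity)]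
  refine le_of_mul_le_mul_left ?_ (by positivity : 0 < ballVolume d * h ^ d)
  linarith

theorem finite_active (M : Mesh d) (Ω : Set (E d)) : (M.active Ω).Finite :=
  M.finite_elements.subset fun _ hT => hT.1

theorem subset_activeDomain {Ω : Set (E d)} (hΩ : Ω ⊆ M.complex.space) : Ω ⊆ M.activeDomain Ω := by
  intro x hx
  obtain ⟨s, hs, hxs⟩ := Geometry.SimplicialComplex.mem_space_iff.1 (hΩ hx)
  obtain ⟨t, ht, hst, hcard⟩ := M.pure s hs
  have hxt : x ∈ cell t := convexHull_mono (by exact_mod_cast hst) hxs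
  exact Set.mem_biUnion (⟨⟨ht, hcard⟩, x, hxt, hx⟩ : t ∈ M.active Ω) hxt

theorem cell_subset_activeDomain {Ω : Set (E d)} {T : Finset (E d)} (hT : T ∈ M.active Ω) :
    cell T ⊆ M.activeDomain Ω := Set.subset_biUnion_of_mem (u := fun T => cell T) hT

theorem isCompact_activeDomain (M : Mesh d) (Ω : Set (E d)) : IsCompact (M.activeDomain Ω) :=
  (M.finite_active Ω).isCompact_biUnion fun T _ => isCompact_cell T

theorem activeDomain_subset_space (M : Mesh d) (Ω : Set (E d)) :
    M.activeDomain Ω ⊆ M.complex.space :=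
  Set.iUnion₂_subset fun _ hT => Geometry.SimplicialComplex.convexHull_subset_space hT.1.1

/-- Almost every point of the domain is interior to an active element. -/
theorem ae_mem_interior {Ω : Set (E d)} (hΩ : Ω ⊆ M.complex.space) :
    ∀ᵐ x : E d, x ∈ Ω → ∃ T ∈ M.active Ω, x ∈ interior (cell T) := by
  have h1 : ∀ T ∈ M.active Ω, ∀ᵐ x : E d, x ∉ frontier (cell T) := fun T _ =>
    measure_eq_zero_iff_ae_notMem.1 ((convex_cell T).addHaar_frontier volume)
  have h2 := (ae_ball_iff (M.finite_active Ω).countable).2 h1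
  filter_upwards [h2] with x hx hxΩ
  obtain ⟨T, hT, hxT⟩ := Set.mem_iUnion₂.1 (subset_activeDomain hΩ hxΩ)
  refine ⟨T, hT, ?_⟩
  have := hx T hT
  rw [(isCompact_cell T).isClosed.frontier_eq] at this
  by_contra hni
  exact this ⟨hxT, hni⟩

variable {Ω : Set (E d)} {v w : E d → ℝ}

theorem eq_zero_of_notMem (hv : v ∈ M.activeSpace Ω k) {x : E d} (hx : x ∉ M.activeDomain Ω) :
    v x = 0 := by
  obtain ⟨w, -, rfl⟩ := hv
  exact Set.indicator_of_notMem hx w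

theorem continuousOn_of_mem_activeSpace (hv : v ∈ M.activeSpace Ω k) :
    ContinuousOn v (M.activeDomain Ω) := by
  obtain ⟨w, hw, rfl⟩ := hv
  exact (hw.1.mono (M.activeDomain_subset_space Ω)).congr fun x hx => Set.indicator_of_mem hx w

theorem measurable_of_mem_activeSpace (hv : v ∈ M.activeSpace Ω k) : Measurable v := by
  classical
  have h1 : v = (M.activeDomain Ω).piecewise v 0 := by
    ext x
    by_cases hx : x ∈ M.activeDomain Ω
    · simp [hx]
    · simp [hx, eq_zero_of_notMem hv hx]
  rw [h1]
  exact (continuousOn_of_mem_activeSpace hv).measurable_piecewise continuousOn_const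
    (M.isCompact_activeDomain Ω).isClosed.measurableSet

theorem exists_abs_le_of_mem_activeSpace (hv : v ∈ M.activeSpace Ω k) : ∃ B, ∀ x, |v x| ≤ B := by
  obtain ⟨B, hB⟩ := ((M.isCompact_activeDomain Ω).image_of_continuousOn
    (continuousOn_of_mem_activeSpace hv).abs).bddAbove
  refine ⟨max B 0, fun x => ?_⟩
  by_cases hx : x ∈ M.activeDomain Ω
  · exact le_max_of_le_left (hB ⟨x, hx, rfl⟩)
  · simp [eq_zero_of_notMem hv hx]

theorem exists_poly_of_mem_activeSpace (hv : v ∈ M.activeSpace Ω k) {T : Finset (E d)}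
    (hT : T ∈ M.active Ω) : ∃ p ∈ polySpace d k, Set.EqOn v p (cell T) := by
  obtain ⟨w, hw, rfl⟩ := hv
  obtain ⟨p, hp, hwp⟩ := hw.2 T hT.1
  refine ⟨p, hp, fun x hx => ?_⟩
  rw [← hwp hx]
  exact Set.indicator_of_mem (cell_subset_activeDomain hT hx) w

theorem polyExt_spec (hv : v ∈ M.activeSpace Ω k) {T : Finset (E d)} (hT : T ∈ M.active Ω) :
    polyExt k T v ∈ polySpace d k ∧ Set.EqOn v (polyExt k T v) (cell T) := by
  have h := exists_poly_of_mem_activeSpace hv hT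
  rw [polyExt, dif_pos h]
  exact h.choose_spec

/-- The extension is a choice; positive volume of the cell makes it unique, and linearity in v
follows from this. -/
theorem IsQuasiUniform.polyExt_eq (hM : M.IsQuasiUniform h ρ) (hh : 0 < h) (hρ : 0 < ρ)
    (hv : v ∈ M.activeSpace Ω k) {T : Finset (E d)} (hT : T ∈ M.active Ω)
    {p : E d → ℝ} (hp : p ∈ polySpace d k) (hvp : Set.EqOn v p (cell T)) : polyExt k T v = p :=
  eq_of_eqOn_of_volume_ne_zero (polyExt_spec hv hT).1 hp (hM.volume_cell_ne_zero hh hρ hT.1)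
    fun _ hx => ((polyExt_spec hv hT).2 hx).symm.trans (hvp hx)

theorem IsQuasiUniform.polyExt_add (hM : M.IsQuasiUniform h ρ) (hh : 0 < h) (hρ : 0 < ρ)
    (hv : v ∈ M.activeSpace Ω k) (hw : w ∈ M.activeSpace Ω k) {T : Finset (E d)}
    (hT : T ∈ M.active Ω) : polyExt k T (v + w) = polyExt k T v + polyExt k T w :=
  hM.polyExt_eq hh hρ (add_mem hv hw) hT (add_mem (polyExt_spec hv hT).1 (polyExt_spec hw hT).1)
    fun x hx => by simp [← (polyExt_spec hv hT).2 hx, ← (polyExt_spec hw hT).2 hx]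

theorem IsQuasiUniform.polyExt_smul (hM : M.IsQuasiUniform h ρ) (hh : 0 < h) (hρ : 0 < ρ)
    (hv : v ∈ M.activeSpace Ω k) (c : ℝ) {T : Finset (E d)}
    (hT : T ∈ M.active Ω) : polyExt k T (c • v) = c • polyExt k T v :=
  hM.polyExt_eq hh hρ (Submodule.smul_mem _ c hv) hT
    (Submodule.smul_mem _ c (polyExt_spec hv hT).1)
    fun x hx => by simp [← (polyExt_spec hv hT).2 hx]

/-- The restriction of a polynomial to the active domain belongs to the finite element space. -/
theorem indicator_mem_activeSpace {q : E d → ℝ} (hq : q ∈ polySpace d k) :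
    (M.activeDomain Ω).indicator q ∈ M.activeSpace Ω k :=
  ⟨q, ⟨(continuous_of_mem_polySpace hq).continuousOn, fun _ _ => ⟨q, hq, fun _ _ => rfl⟩⟩, rfl⟩

end Mesh

/-! ### Degrees of freedom -/

theorem isCompact_refSimplex (d : ℕ) : IsCompact (refSimplex d) :=
  (Set.Finite.insert _ (Set.finite_range _)).isCompact_convexHull ℝ

theorem volume_refSimplex_ne_zero (d : ℕ) : volume (refSimplex d) ≠ 0 := by
  have h1 : (interior (refSimplex d)).Nonempty := by
    rw [refSimplex, interior_convexHull_nonempty_iff_affineSpan_eq_top]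
    apply SetLike.coe_injective
    rw [affineSpan_insert_zero]
    have h2 := (EuclideanSpace.basisFun (Fin d) ℝ).toBasis.span_eq
    have h3 : (Set.range (EuclideanSpace.basisFun (Fin d) ℝ).toBasis) =
        Set.range fun i : Fin d => EuclideanSpace.single i (1 : ℝ) := by
      congr 1; ext i; simp
    rw [← h3, h2]
    simp
  exact (Measure.measure_pos_of_nonempty_interior _ h1).ne'

end Mesh
end CutFEM

/-! ### Local coefficients and the dual degrees of freedom -/

namespace CutFEM

namespace Discretization

variable {d k : ℕ} {Ω : Set (E d)} {γ ρ : ℝ} {D : Discretization d k Ω γ}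

theorem shape_mem (D : Discretization d k Ω γ) (i : D.ι) : D.shape i ∈ D.mesh.activeSpace Ω k :=
  (D.φ i).2

/-- A cell is contained in the closure of its interior, so if it sticks out of the closed support,
φ_i vanishes on an open part of it, hence on all of it because it is a polynomial there. Thus only
the indices in I_T are active on T. -/
theorem shape_eq_zero (hM : D.mesh.IsQuasiUniform D.h ρ) (hρ : 0 < ρ) {T : Finset (E d)}
    (hT : T ∈ D.mesh.active Ω) {i : D.ι} (hi : i ∉ D.localIdx T) {x : E d} (hx : x ∈ cell T) :
    D.shape i x = 0 := by
  obtain ⟨p, hp, hpT⟩ := Mesh.exists_poly_of_mem_activeSpace (D.shape_mem i) hT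
  obtain ⟨y, hyT, hy⟩ := Set.not_subset.1 hi
  have hU : (tsupport (D.shape i))ᶜ ∈ 𝓝 y := (isClosed_tsupport _).isOpen_compl.mem_nhds hy
  obtain ⟨z, hz1, hz2⟩ : ((tsupport (D.shape i))ᶜ ∩ interior (cell T)).Nonempty := by
    have h1 : y ∈ closure (interior (cell T)) := by
      rw [(convex_cell T).closure_interior_eq_closure_of_nonempty_interior
        (hM.interior_cell_nonempty D.h_pos hρ hT.1)]
      exact subset_closure hyT
    exact mem_closure_iff_nhds.1 h1 _ hU
  have hopen : IsOpen ((tsupport (D.shape i))ᶜ ∩ interior (cell T)) :=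
    (isClosed_tsupport _).isOpen_compl.inter isOpen_interior
  have hp0 : p = 0 := by
    refine eq_of_eqOn_of_volume_ne_zero hp (zero_mem _) (hopen.measure_pos volume ⟨z, hz1, hz2⟩).ne' ?_
    rintro w ⟨hw1, hw2⟩
    rw [← hpT (interior_subset hw2)]
    exact image_eq_zero_of_notMem_tsupport hw1
  rw [hpT hx, hp0]; rfl

variable {κ : Type} {ψ : Module.Basis κ ℝ (polySpace d k)}

/-- The coefficients of an element of the finite element space in the basis `φ`. -/
def coeff (D : Discretization d k Ω γ) {v : E d → ℝ} (hv : v ∈ D.V) (i : D.ι) : ℝ :=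
  D.φ.repr ⟨v, hv⟩ i

theorem sum_coeff {v : E d → ℝ} (hv : v ∈ D.V) : ∑ j, D.coeff hv j • D.shape j = v := by
  have h := congrArg (Subtype.val) (D.φ.sum_repr (⟨v, hv⟩ : D.mesh.activeSpace Ω k))
  rw [Submodule.coe_sum] at h
  exact h

theorem sum_local (hM : D.mesh.IsQuasiUniform D.h ρ) (hρ : 0 < ρ)
    {T : Finset (E d)} (hT : T ∈ D.mesh.active Ω) [DecidablePred (· ∈ D.localIdx T)]
    (c : D.ι → ℝ) {x : E d} (hx : x ∈ cell T) :
    (∑ j, c j • D.shape j) x = ∑ j with j ∈ D.localIdx T, c j * D.shape j x := by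
  rw [Finset.sum_apply, Finset.sum_filter]
  refine Finset.sum_congr rfl fun j _ => ?_
  split_ifs with h
  · simp
  · simp [shape_eq_zero hM hρ hT h hx]

/-- Pulled back to the reference simplex, the coefficients are those in the fixed basis ψ. The
constant therefore depends on ψ alone and not on the affine map. -/
theorem IsAffineFamily.coeff_bound [Fintype κ] (ψ : Module.Basis κ ℝ (polySpace d k)) :
    ∃ C > 0, ∀ (Ω : Set (E d)) (γ ρ : ℝ) (D : Discretization d k Ω γ), 0 < ρ →
      D.mesh.IsQuasiUniform D.h ρ → D.IsAffineFamily ψ →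
      ∀ T ∈ D.mesh.active Ω, ∀ (c : D.ι → ℝ) (B : ℝ),
        (∀ x ∈ cell T, |(∑ j, c j • D.shape j) x| ≤ B) → ∀ i ∈ D.localIdx T, |c i| ≤ C * B := by
  classical
  obtain ⟨R, hR⟩ := (isCompact_refSimplex d).isBounded.subset_closedBall 0
  set θ := (volume (refSimplex d)).toReal with hθdef
  have hfin : volume (refSimplex d) ≠ ⊤ := (isCompact_refSimplex d).measure_lt_top.ne
  have hθ : 0 < θ := ENNReal.toReal_pos (volume_refSimplex_ne_zero d) hfin
  obtain ⟨C, hC, H⟩ := exists_coeff_bound ψ R θ hθ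
  refine ⟨Real.sqrt (C * θ), by positivity, ?_⟩
  intro Ω γ ρ D hρ hM hA T hT c B hB i hi
  obtain ⟨F, σ, hF, hσ⟩ := hA T hT
  have h1 := H (refSimplex d) (isCompact_refSimplex d).measurableSet hR
    (by rw [hθdef, ENNReal.ofReal_toReal hfin]) (fun j => c (σ.symm j))
  have h2 : ∀ x ∈ refSimplex d, ∑ j, c (σ.symm j) * (ψ j : E d → ℝ) x =
      (∑ j, c j • D.shape j) (F x) := by
    intro x hx
    have hFx : F x ∈ cell T := hF ▸ ⟨x, hx, rfl⟩
    rw [sum_local hM hρ hT c hFx, Finset.sum_subtype (Finset.univ.filter (· ∈ D.localIdx T))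
      (p := (· ∈ D.localIdx T)) (by simp), ← Equiv.sum_comp σ]
    refine Finset.sum_congr rfl fun j _ => ?_
    rw [Equiv.symm_apply_apply, hσ j x hx]
  have hB0 : 0 ≤ B := by
    obtain ⟨x, hx⟩ := hT.2
    exact (abs_nonneg _).trans (hB x hx.1)
  have h3 : ∫ x in refSimplex d, (∑ j, c (σ.symm j) * (ψ j : E d → ℝ) x) ^ 2 ≤ B ^ 2 * θ := by
    have h4 : ∀ x ∈ refSimplex d, ‖(∑ j, c (σ.symm j) * (ψ j : E d → ℝ) x) ^ 2‖ ≤ B ^ 2 := by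
      intro x hx
      rw [h2 x hx, Real.norm_eq_abs, abs_pow]
      exact pow_le_pow_left₀ (abs_nonneg _) (hB _ (hF ▸ ⟨x, hx, rfl⟩)) 2
    exact (le_abs_self _).trans (norm_setIntegral_le_of_norm_le_const hfin.lt_top h4)
  have h5 : |c i| ≤ ‖fun j => c (σ.symm j)‖ := by
    have := norm_le_pi_norm (fun j => c (σ.symm j)) (σ ⟨i, hi⟩)
    simpa using this
  rw [← abs_of_nonneg (norm_nonneg _)] at h5
  have h6 : |c i| ^ 2 ≤ C * θ * B ^ 2 := by
    calc |c i| ^ 2 ≤ ‖fun j => c (σ.symm j)‖ ^ 2 := pow_le_pow_left₀ (abs_nonneg _) (by simpa using h5) 2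
      _ ≤ C * (B ^ 2 * θ) := h1.trans (mul_le_mul_of_nonneg_left h3 hC.le)
      _ = _ := by ring
  calc |c i| = Real.sqrt (|c i| ^ 2) := (Real.sqrt_sq (abs_nonneg _)).symm
    _ ≤ Real.sqrt (C * θ * B ^ 2) := Real.sqrt_le_sqrt h6
    _ = _ := by rw [Real.sqrt_mul (by positivity), Real.sqrt_sq hB0]

/-- Makes the choice in `dof` harmless: any global expansion valid on T may be used to read off the
coefficient, since terms outside I_T vanish there. -/
theorem dof_eq [Finite κ] (hM : D.mesh.IsQuasiUniform D.h ρ) (hρ : 0 < ρ) (hA : D.IsAffineFamily ψ)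
    {T : Finset (E d)} (hT : T ∈ D.mesh.active Ω) {p : E d → ℝ} {c : D.ι → ℝ}
    (hp : Set.EqOn p (∑ j, c j • D.shape j) (cell T)) {i : D.ι} (hi : i ∈ D.localIdx T) :
    D.dof T i p = c i := by
  classical
  have := Fintype.ofFinite κ
  have hex : ∃ c : D.ι → ℝ, (∀ j ∉ D.localIdx T, c j = 0) ∧
      Set.EqOn p (∑ j, c j • D.shape j) (cell T) := by
    refine ⟨fun j => if j ∈ D.localIdx T then c j else 0, fun j hj => by simp [hj], fun x hx => ?_⟩
    rw [hp hx, sum_local hM hρ hT c hx, sum_local hM hρ hT _ hx]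
    refine Finset.sum_congr rfl fun j hj => ?_
    simp [(Finset.mem_filter.1 hj).2]
  rw [dof, dif_pos hex]
  obtain ⟨C, -, hC⟩ := IsAffineFamily.coeff_bound ψ
  -- Uniqueness is the coefficient bound with B = 0, applied to the difference of the two
  -- expansions.
  have h := hC Ω γ ρ D hρ hM hA T hT (fun j => hex.choose j - c j) 0 (fun x hx => by
    have h1 := hex.choose_spec.2 hx
    rw [hp hx] at h1
    simp only [sub_smul, Finset.sum_sub_distrib, Pi.sub_apply, h1]
    simp) i hi
  simp only [mul_zero] at h
  exact sub_eq_zero.1 (abs_nonpos_iff.1 h)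

theorem dof_of_mem [Finite κ] (hM : D.mesh.IsQuasiUniform D.h ρ) (hρ : 0 < ρ)
    (hA : D.IsAffineFamily ψ) {T : Finset (E d)} (hT : T ∈ D.mesh.active Ω) {v : E d → ℝ}
    (hv : v ∈ D.V) {i : D.ι} (hi : i ∈ D.localIdx T) : D.dof T i v = D.coeff hv i :=
  dof_eq hM hρ hA hT (by rw [sum_coeff hv]; exact Set.eqOn_refl _ _) hi

theorem dof_polyExt [Finite κ] (hM : D.mesh.IsQuasiUniform D.h ρ) (hρ : 0 < ρ)
    (hA : D.IsAffineFamily ψ) {T : Finset (E d)} (hT : T ∈ D.mesh.active Ω) {v : E d → ℝ}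
    (hv : v ∈ D.V) {i : D.ι} (hi : i ∈ D.localIdx T) :
    D.dof T i (polyExt k T v) = D.coeff hv i :=
  dof_eq hM hρ hA hT (by
    rw [sum_coeff hv]; exact (Mesh.polyExt_spec hv hT).2.symm) hi

/-- The coefficients of (the restriction of) a polynomial in the finite element basis. -/
def polyCoeff (D : Discretization d k Ω γ) {q : E d → ℝ} (hq : q ∈ polySpace d k) (i : D.ι) : ℝ :=
  D.coeff (Mesh.indicator_mem_activeSpace (M := D.mesh) (Ω := Ω) hq) i

theorem sum_polyCoeff {q : E d → ℝ} (hq : q ∈ polySpace d k) {T : Finset (E d)}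
    (hT : T ∈ D.mesh.active Ω) : Set.EqOn q (∑ j, D.polyCoeff hq j • D.shape j) (cell T) := by
  intro x hx
  have := sum_coeff (D := D) (Mesh.indicator_mem_activeSpace (M := D.mesh) (Ω := Ω) hq)
  unfold polyCoeff
  rw [this, Set.indicator_of_mem (Mesh.cell_subset_activeDomain hT hx)]

theorem dof_poly [Finite κ] (hM : D.mesh.IsQuasiUniform D.h ρ) (hρ : 0 < ρ)
    (hA : D.IsAffineFamily ψ) {T : Finset (E d)} (hT : T ∈ D.mesh.active Ω) {q : E d → ℝ}
    (hq : q ∈ polySpace d k) {i : D.ι} (hi : i ∈ D.localIdx T) :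
    D.dof T i q = D.polyCoeff hq i :=
  dof_eq hM hρ hA hT (sum_polyCoeff hq hT) hi

/-- Shape functions are bounded on the elements, in terms of the reference shape functions only. -/
theorem IsAffineFamily.shape_bound [Fintype κ] (ψ : Module.Basis κ ℝ (polySpace d k)) :
    ∃ C > 0, ∀ (Ω : Set (E d)) (γ : ℝ) (D : Discretization d k Ω γ), D.IsAffineFamily ψ →
      ∀ T ∈ D.mesh.active Ω, ∀ i ∈ D.localIdx T, ∀ x ∈ cell T, |D.shape i x| ≤ C := by
  have hc : Continuous fun x : E d => ∑ j, |(ψ j : E d → ℝ) x| :=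
    continuous_finsetSum _ fun j _ => (continuous_of_mem_polySpace (ψ j).2).abs
  obtain ⟨B, hB⟩ := ((isCompact_refSimplex d).image_of_continuousOn hc.continuousOn).bddAbove
  refine ⟨max B 1, by positivity, ?_⟩
  intro Ω γ D hA T hT i hi x hx
  obtain ⟨F, σ, hF, hσ⟩ := hA T hT
  obtain ⟨y, hy, rfl⟩ := hF ▸ hx
  rw [hσ ⟨i, hi⟩ y hy]
  refine le_max_of_le_left (le_trans ?_ (hB ⟨y, hy, rfl⟩))
  exact Finset.single_le_sum (f := fun j => |(ψ j : E d → ℝ) y|) (fun _ _ => abs_nonneg _)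
    (Finset.mem_univ _)

theorem IsAffineFamily.card_localIdx [Fintype κ] (hA : D.IsAffineFamily ψ) {T : Finset (E d)}
    (hT : T ∈ D.mesh.active Ω) [DecidablePred (· ∈ D.localIdx T)] :
    (Finset.univ.filter (· ∈ D.localIdx T)).card = Fintype.card κ := by
  obtain ⟨F, σ, -, -⟩ := hA T hT
  rw [← Fintype.card_congr σ, ← Fintype.card_subtype]

end Discretization
end CutFEM

/-! ### Comparing polynomial extensions along paths of elements -/

namespace CutFEM

section Stability

variable {d k : ℕ}

/-- The conclusion of `exists_scaled_bounds` for given constants. -/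
def ScaledBound (d k : ℕ) (R θ C : ℝ) : Prop :=
  ∀ (h : ℝ) (c : E d) (A : Set (E d)), 0 < h → MeasurableSet A →
    A ⊆ Metric.closedBall c (R * h) → ENNReal.ofReal (θ * h ^ d) ≤ volume A →
    ∀ q ∈ polySpace d k, ∀ x ∈ Metric.closedBall c (R * h),
      h ^ d * q x ^ 2 ≤ C * ∫ y in A, q y ^ 2 ∧
      h ^ d * (h ^ 2 * ‖gradient q x‖ ^ 2) ≤ C * ∫ y in A, q y ^ 2 ∧
      h ^ d * ‖gradient q x‖ ^ 2 ≤ C * ∫ y in A, ‖gradient q y‖ ^ 2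

/-- The elementwise energy `‖∇ (v|_T)^e‖²` on `T`. -/
def energy (k : ℕ) (T : Finset (E d)) (v : E d → ℝ) : ℝ :=
  ∫ x in cell T, ‖gradient (polyExt k T v) x‖ ^ 2

theorem energy_nonneg (T : Finset (E d)) (v : E d → ℝ) : 0 ≤ energy k T v :=
  integral_nonneg fun _ => sq_nonneg _

theorem FaceNeighbors.exists_mem (hd : 1 ≤ d) {T T' : Finset (E d)} (h : FaceNeighbors T T') :
    ∃ z, z ∈ cell T ∧ z ∈ cell T' := by
  obtain ⟨F, hF, hFT, hFT'⟩ := h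
  obtain ⟨z, hz⟩ := Finset.card_pos.1 (by omega : 0 < F.card)
  exact ⟨z, subset_cell T (hFT hz), subset_cell T' (hFT' hz)⟩

variable {Ω : Set (E d)} {M : Mesh d} {h ρ γ θ R C : ℝ}

theorem dist_le_of_path (hd : 1 ≤ d) (hM : M.IsQuasiUniform h ρ) {n : ℕ} {P : ℕ → Finset (E d)}
    (hP : ∀ j ≤ n, P j ∈ M.elements) (hN : ∀ j < n, FaceNeighbors (P j) (P (j + 1))) {j l : ℕ}
    (hjl : j ≤ l) (hl : l ≤ n) {x y : E d} (hx : x ∈ cell (P j)) (hy : y ∈ cell (P l)) :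
    dist x y ≤ ((l - j : ℕ) + 1) * h := by
  induction l, hjl using Nat.le_induction generalizing y with
  | base => simpa using hM.cell_subset_closedBall (hP j hl) hy hx
  | succ l hjl ih =>
    obtain ⟨z, hz, hz'⟩ := (hN l (by omega)).exists_mem hd
    have h1 := ih (by omega) hz
    have h2 : dist z y ≤ h := hM.cell_subset_closedBall (hP _ hl) hy hz'
    have h3 := dist_triangle x z y
    rw [Nat.succ_sub hjl]
    push_cast
    linarith

theorem HasFacePath.dist_le (hd : 1 ≤ d) (hM : M.IsQuasiUniform h ρ) (hh : 0 < h) {N : ℕ}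
    {𝒯 : Set (Finset (E d))} (h𝒯 : 𝒯 ⊆ M.elements) {T T' : Finset (E d)}
    (hp : HasFacePath 𝒯 N T T') {x y : E d} (hx : x ∈ cell T) (hy : y ∈ cell T') :
    dist x y ≤ N * h := by
  obtain ⟨n, P, hn, rfl, rfl, hP, hN⟩ := hp
  refine (dist_le_of_path hd hM (fun j hj => h𝒯 (hP j hj)) hN (Nat.zero_le n) le_rfl hx hy).trans ?_
  refine mul_le_mul_of_nonneg_right ?_ hh.le
  have : ((n + 1 : ℕ) : ℝ) ≤ N := by exact_mod_cast hn
  simpa using this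

theorem abs_sub_le_of_gradient {q : E d → ℝ} (hq : q ∈ polySpace d k) {z x : E d} {r B : ℝ}
    (hx : x ∈ Metric.closedBall z r) (hr : 0 ≤ r)
    (hB : ∀ y ∈ Metric.closedBall z r, ‖gradient q y‖ ≤ B) : |q x - q z| ≤ B * r := by
  have hg : ∀ y, ‖fderiv ℝ q y‖ = ‖gradient q y‖ := fun y => by simp [gradient]
  have h1 := (convex_closedBall z r).norm_image_sub_le_of_norm_fderiv_le (𝕜 := ℝ) (f := q) (C := B)
    (fun y _ => differentiable_of_mem_polySpace hq y) (fun y hy => by rw [hg]; exact hB y hy)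
    (Metric.mem_closedBall_self hr) hx
  have hB0 : 0 ≤ B := (norm_nonneg _).trans (hB z (Metric.mem_closedBall_self hr))
  refine h1.trans (mul_le_mul_of_nonneg_left ?_ hB0)
  simpa [dist_eq_norm] using hx

theorem gradient_sub_of_mem {p q : E d → ℝ} (hp : p ∈ polySpace d k) (hq : q ∈ polySpace d k)
    (x : E d) : gradient (p - q) x = gradient p x - gradient q x := by
  rw [gradient, fderiv_sub (differentiable_of_mem_polySpace hp x)
    (differentiable_of_mem_polySpace hq x), map_sub]
  rfl

theorem norm_gradient_le_of_energy_le (hC : ScaledBound d k R θ C) (hM : M.IsQuasiUniform h ρ)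
    (hh : 0 < h) (hρ : 0 < ρ) (hθ : θ ≤ ballVolume d * ρ ^ d) (hR : 1 ≤ R) {v : E d → ℝ}
    (hv : v ∈ M.activeSpace Ω k) {T : Finset (E d)} (hT : T ∈ M.active Ω) {z x : E d}
    (hz : z ∈ cell T) (hx : x ∈ Metric.closedBall z (R * h)) {B : ℝ} (hB : C * energy k T v ≤ C * B) :
    ‖gradient (polyExt k T v) x‖ ≤ Real.sqrt (C * B / h ^ d) := by
  have h1 := (hC h z (cell T) hh (measurableSet_cell T)
    ((hM.cell_subset_closedBall hT.1 hz).trans (Metric.closedBall_subset_closedBall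
      (by nlinarith))) (le_trans (ENNReal.ofReal_le_ofReal (by gcongr))
        (hM.le_volume_cell hh hρ hT.1)) _ (Mesh.polyExt_spec hv hT).1 x hx).2.2
  have h2 : ‖gradient (polyExt k T v) x‖ ^ 2 ≤ C * B / h ^ d := by
    rw [le_div_iff₀ (by positivity)]
    have := h1.trans hB
    linarith
  exact Real.le_sqrt_of_sq_le h2

/-- The extensions from two neighbors coincide at a common vertex, so at distance R h they differ by
at most R h times the sum of their gradient bounds. Summing along the path gives the factor n. Only
one shared point is used, not the whole face. -/
theorem abs_polyExt_sub_le_of_path (hC : ScaledBound d k R θ C) (hC0 : 0 < C) (hd : 1 ≤ d)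
    (hM : M.IsQuasiUniform h ρ)
    (hh : 0 < h) (hρ : 0 < ρ) (hθ : θ ≤ ballVolume d * ρ ^ d) (hR : 1 ≤ R) {v : E d → ℝ}
    (hv : v ∈ M.activeSpace Ω k) {n : ℕ} {P : ℕ → Finset (E d)}
    (hP : ∀ j ≤ n, P j ∈ M.active Ω) (hN : ∀ j < n, FaceNeighbors (P j) (P (j + 1))) {x : E d}
    (hx : ∀ j ≤ n, ∀ z ∈ cell (P j), x ∈ Metric.closedBall z (R * h)) {B : ℝ}
    (hB : ∀ j ≤ n, energy k (P j) v ≤ B) :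
    |polyExt k (P 0) v x - polyExt k (P n) v x| ≤ n * (2 * Real.sqrt (C * B / h ^ d) * (R * h)) := by
  induction n with
  | zero => simp
  | succ n ih =>
    have h1 := ih (fun j hj => hP j (by omega)) (fun j hj => hN j (by omega))
      (fun j hj => hx j (by omega)) (fun j hj => hB j (by omega))
    obtain ⟨z, hz, hz'⟩ := (hN n (by omega)).exists_mem hd
    have hT := hP n (by omega)
    have hT' := hP (n + 1) le_rfl
    have hp := Mesh.polyExt_spec hv hT
    have hp' := Mesh.polyExt_spec hv hT'
    have h2 : |(polyExt k (P n) v - polyExt k (P (n + 1)) v) x -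
        (polyExt k (P n) v - polyExt k (P (n + 1)) v) z| ≤
        2 * Real.sqrt (C * B / h ^ d) * (R * h) := by
      refine abs_sub_le_of_gradient (sub_mem hp.1 hp'.1) (hx n (by omega) z hz) (by positivity) ?_
      intro y hy
      rw [gradient_sub_of_mem hp.1 hp'.1, two_mul]
      refine (norm_sub_le _ _).trans (add_le_add ?_ ?_)
      · exact norm_gradient_le_of_energy_le hC hM hh hρ hθ hR hv hT hz hy
          (mul_le_mul_of_nonneg_left (hB n (by omega)) hC0.le)
      · exact norm_gradient_le_of_energy_le hC hM hh hρ hθ hR hv hT' hz' hy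
          (mul_le_mul_of_nonneg_left (hB _ le_rfl) hC0.le)
    have h3 : (polyExt k (P n) v - polyExt k (P (n + 1)) v) z = 0 := by
      simp [← hp.2 hz, ← hp'.2 hz']
    rw [h3, sub_zero, Pi.sub_apply] at h2
    have h4 := abs_sub_le (polyExt k (P 0) v x) (polyExt k (P n) v x) (polyExt k (P (n + 1)) v x)
    push_cast
    linarith

end Stability

namespace Discretization

variable {d k N : ℕ} {Ω : Set (E d)} {γ ρ : ℝ} {D : Discretization d k Ω γ}
variable {κ : Type} {ψ : Module.Basis κ ℝ (polySpace d k)}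

/-- The stabilization functional `φ*_{i,T_i}([v]_{T_i,S_h(T_i)})`. -/
def jumpDof (D : Discretization d k Ω γ) (v : E d → ℝ) (i : D.ι) : ℝ :=
  D.dof (D.node i) i (jump k (D.node i) (D.S (D.node i)) v)

theorem large_subset_elements : D.mesh.large Ω γ ⊆ D.mesh.elements := fun _ hT => hT.1.1

theorem active_subset_elements : D.mesh.active Ω ⊆ D.mesh.elements := fun _ hT => hT.1

theorem node_mem_small {i : D.ι} (hi : i ∈ D.smallIdx) : D.node i ∈ D.mesh.small Ω γ :=
  ⟨D.node_mem i, fun hL => hi _ hL (D.node_subset i)⟩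

theorem S_node_mem {i : D.ι} (hi : i ∈ D.smallIdx) : D.S (D.node i) ∈ D.mesh.active Ω :=
  (D.S_mem _ (node_mem_small hi)).1

theorem polyCoeff_sub {p q : E d → ℝ} (hp : p ∈ polySpace d k) (hq : q ∈ polySpace d k) (i : D.ι) :
    D.polyCoeff (sub_mem hp hq) i = D.polyCoeff hp i - D.polyCoeff hq i := by
  unfold polyCoeff coeff
  rw [← Finsupp.sub_apply, ← map_sub]
  congr 2
  apply Subtype.ext
  simp [Set.indicator_sub']

/-- Since T_i carries the index i, the functional applied to (v|_{T_i})^e returns the global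
coefficient of v. -/
theorem jumpDof_eq [Finite κ] (hM : D.mesh.IsQuasiUniform D.h ρ) (hρ : 0 < ρ)
    (hA : D.IsAffineFamily ψ) {v : E d → ℝ} (hv : v ∈ D.V) {i : D.ι} (hi : i ∈ D.smallIdx) :
    D.jumpDof v i = D.coeff hv i - D.polyCoeff (Mesh.polyExt_spec hv (S_node_mem hi)).1 i := by
  have hT := D.node_mem i
  have hiT : i ∈ D.localIdx (D.node i) := D.node_subset i
  rw [jumpDof, jump, dof_poly hM hρ hA hT (sub_mem (Mesh.polyExt_spec hv hT).1
    (Mesh.polyExt_spec hv (S_node_mem hi)).1) hiT,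
    polyCoeff_sub (Mesh.polyExt_spec hv hT).1 (Mesh.polyExt_spec hv (S_node_mem hi)).1,
    ← dof_poly hM hρ hA hT (Mesh.polyExt_spec hv hT).1 hiT, dof_polyExt hM hρ hA hT hv hiT]

/-- Two elements lie within distance `r h` of each other. -/
def Near (D : Discretization d k Ω γ) (r : ℝ) (T T' : Finset (E d)) : Prop :=
  ∀ x ∈ cell T, ∀ z ∈ cell T', dist x z ≤ r * D.h

theorem near_symm {r : ℝ} {T T' : Finset (E d)} (h : D.Near r T T') : D.Near r T' T :=
  fun x hx z hz => by rw [dist_comm]; exact h z hz x hx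

theorem near_trans {r s : ℝ} {T T' T'' : Finset (E d)} (h : D.Near r T T') (h' : D.Near s T' T'')
    (hne : T'.Nonempty) : D.Near (r + s) T T'' := by
  intro x hx z hz
  obtain ⟨w, hw⟩ := hne
  have h1 := h x hx w (subset_cell T' hw)
  have h2 := h' w (subset_cell T' hw) z hz
  have h3 := dist_triangle x w z
  linarith

theorem _root_.CutFEM.Mesh.nonempty_of_mem_elements {M : Mesh d} {T : Finset (E d)}
    (hT : T ∈ M.elements) : T.Nonempty :=
  Finset.card_pos.1 (by rw [hT.2]; omega)

theorem near_of_path (hd : 1 ≤ d) (hM : D.mesh.IsQuasiUniform D.h ρ) {𝒯 : Set (Finset (E d))}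
    (h𝒯 : 𝒯 ⊆ D.mesh.elements) {T T' : Finset (E d)} (hp : HasFacePath 𝒯 N T T') :
    D.Near N T T' := fun _ hx _ hz => hp.dist_le hd hM D.h_pos h𝒯 hx hz

open Classical in
/-- The large elements near `T`. -/
def nearLarge (D : Discretization d k Ω γ) (r : ℝ) (T : Finset (E d)) : Finset (Finset (E d)) :=
  (D.mesh.finite_active Ω).toFinset.filter fun T' => T' ∈ D.mesh.large Ω γ ∧ D.Near r T T'

theorem mem_nearLarge {r : ℝ} {T T' : Finset (E d)} :
    T' ∈ D.nearLarge r T ↔ T' ∈ D.mesh.large Ω γ ∧ D.Near r T T' := by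
  simp only [nearLarge, Finset.mem_filter, Set.Finite.mem_toFinset, and_iff_right_iff_imp]
  exact fun h => h.1.1

/-- On a small element, the local coefficients of `v - (v|_{S_h(T)})^e` are controlled by the
stabilization and by the energy of large elements nearby. -/
theorem abs_coeff_sub_le [Finite κ] {θ C Cψ R : ℝ} (hC : ScaledBound d k R θ C) (hC0 : 0 < C)
    (hd : 1 ≤ d) (hM : D.mesh.IsQuasiUniform D.h ρ) (hρ : 0 < ρ) (hθ : θ ≤ ballVolume d * ρ ^ d)
    (hR : 1 ≤ R) (hRN : 2 * N ≤ R)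
    (hA : D.IsAffineFamily ψ) (hp : D.HasPaths N) (hlp : D.HasLargePaths N)
    (hCψ : ∀ T ∈ D.mesh.active Ω, ∀ (c : D.ι → ℝ) (B : ℝ),
        (∀ x ∈ cell T, |(∑ j, c j • D.shape j) x| ≤ B) → ∀ i ∈ D.localIdx T, |c i| ≤ Cψ * B)
    {v : E d → ℝ} (hv : v ∈ D.V) {T : Finset (E d)} (hT : T ∈ D.mesh.small Ω γ) {i : D.ι}
    (hi : i ∈ D.localIdx T) [Decidable (i ∈ D.smallIdx)] :
    |D.coeff hv i - D.polyCoeff (Mesh.polyExt_spec hv (D.S_mem T hT).1).1 i| ≤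
      (if i ∈ D.smallIdx then |D.jumpDof v i| else 0) +
        Cψ * (N * (2 * Real.sqrt (C * (∑ T' ∈ D.nearLarge (2 * N) T, energy k T' v) / D.h ^ d) *
          (R * D.h))) := by
  have hTST : D.Near N T (D.S T) := near_of_path hd hM active_subset_elements (hp T hT)
  -- comparison of the extensions from two large elements joined by a path
  have key : ∀ T₁ (hT₁ : T₁ ∈ D.mesh.large Ω γ), HasFacePath (D.mesh.large Ω γ) N T₁ (D.S T) →
      |D.polyCoeff (Mesh.polyExt_spec hv hT₁.1).1 i -
        D.polyCoeff (Mesh.polyExt_spec hv (D.S_mem T hT).1).1 i| ≤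
        Cψ * (N * (2 * Real.sqrt (C * (∑ T' ∈ D.nearLarge (2 * N) T, energy k T' v) / D.h ^ d) *
          (R * D.h))) := by
    rintro T₁ hT₁ ⟨n, P, hn, hP0, hPn, hP, hN⟩
    have hh := D.h_pos
    -- At most N h from T to S_h(T) by the first path condition, and at most N h more along the path
    -- of large elements.
    have hnear : ∀ j ≤ n, D.Near (2 * N) T (P j) := by
      intro j hj
      have h1 : D.Near N (D.S T) (P j) := by
        intro x hx z hz
        rw [dist_comm]
        rw [← hPn] at hx
        refine (dist_le_of_path hd hM (fun j hj => large_subset_elements (hP j hj)) hN hj le_rfl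
          hz hx).trans ?_
        refine mul_le_mul_of_nonneg_right ?_ hh.le
        have : ((n - j + 1 : ℕ) : ℝ) ≤ N := by exact_mod_cast (by omega : n - j + 1 ≤ N)
        simpa using this
      have h2 := near_trans hTST h1 (Mesh.nonempty_of_mem_elements (D.S_mem T hT).1.1)
      rwa [← two_mul] at h2
    rw [← polyCoeff_sub]
    refine hCψ T hT.1 (D.polyCoeff (sub_mem (Mesh.polyExt_spec hv hT₁.1).1
      (Mesh.polyExt_spec hv (D.S_mem T hT).1).1)) _ ?_ i hi
    intro x hx
    rw [← sum_polyCoeff (sub_mem (Mesh.polyExt_spec hv hT₁.1).1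
      (Mesh.polyExt_spec hv (D.S_mem T hT).1).1) hT.1 hx, Pi.sub_apply, ← hP0, ← hPn]
    have h3 := abs_polyExt_sub_le_of_path hC hC0 hd hM hh hρ hθ hR hv (n := n) (P := P) (x := x)
      (B := ∑ T' ∈ D.nearLarge (2 * N) T, energy k T' v)
      (fun j hj => (hP j hj).1) hN
      (fun j hj z hz => (hnear j hj x hx z hz).trans (by gcongr))
      (fun j hj => Finset.single_le_sum (f := fun T' => energy k T' v)
        (fun _ _ => energy_nonneg _ _) (mem_nearLarge.2 ⟨hP j hj, hnear j hj⟩))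
    refine h3.trans (mul_le_mul_of_nonneg_right ?_ (by positivity))
    exact_mod_cast (by omega : n ≤ N)
  -- For a small index the intermediate polynomial comes from S_h(T_i), and the error is the
  -- stabilization functional. For a large index it comes from a large element in the support, where
  -- the coefficient of v is reproduced exactly.
  by_cases his : i ∈ D.smallIdx
  · rw [if_pos his]
    have h1 := (hlp i (D.node i) T (D.node_subset i) hi hT).1 (node_mem_small his)
    have h2 := key _ (D.S_mem _ (node_mem_small his)) h1
    have h3 := jumpDof_eq hM hρ hA hv his
    have h4 := abs_sub_le (D.coeff hv i) (D.polyCoeff (Mesh.polyExt_spec hv (S_node_mem his)).1 i)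
      (D.polyCoeff (Mesh.polyExt_spec hv (D.S_mem T hT).1).1 i)
    rw [← h3] at h4
    linarith
  · rw [if_neg his, zero_add]
    obtain ⟨T₁, hT₁, hiT₁⟩ : ∃ T₁ ∈ D.mesh.large Ω γ, i ∈ D.localIdx T₁ := by
      by_contra! hcon
      exact his hcon
    have h2 := key T₁ hT₁ ((hlp i T₁ T hiT₁ hi hT).2 hT₁)
    rwa [← dof_poly hM hρ hA hT₁.1 (Mesh.polyExt_spec hv hT₁.1).1 hiT₁,
      dof_polyExt hM hρ hA hT₁.1 hv hiT₁] at h2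

end Discretization
end CutFEM

/-! ### Energy on small elements -/

namespace CutFEM

namespace Discretization

variable {d k N : ℕ} {Ω : Set (E d)} {γ ρ : ℝ} {D : Discretization d k Ω γ}
variable {κ : Type} {ψ : Module.Basis κ ℝ (polySpace d k)}

theorem volume_cell_le (hM : D.mesh.IsQuasiUniform D.h ρ) {T : Finset (E d)}
    (hT : T ∈ D.mesh.elements) : volume (cell T) ≤ ENNReal.ofReal (ballVolume d * D.h ^ d) := by
  obtain ⟨x, hx⟩ := Mesh.nonempty_of_mem_elements hT
  rw [← volume_closedBall_eq x D.h_pos.le]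
  exact measure_mono (hM.cell_subset_closedBall hT (subset_cell T hx))

theorem setIntegral_cell_le (hM : D.mesh.IsQuasiUniform D.h ρ) {T : Finset (E d)}
    (hT : T ∈ D.mesh.elements) {f : E d → ℝ} {B : ℝ} (hB0 : 0 ≤ B)
    (hf : ∀ x ∈ cell T, |f x| ≤ B) : ∫ x in cell T, f x ≤ B * (ballVolume d * D.h ^ d) := by
  have h1 := norm_setIntegral_le_of_norm_le_const (μ := volume) (s := cell T) (f := f)
    ((volume_cell_le hM hT).trans_lt ENNReal.ofReal_lt_top) hf
  refine (le_abs_self _).trans (h1.trans (mul_le_mul_of_nonneg_left ?_ hB0))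
  have := ballVolume_pos d
  have := D.h_pos
  exact ENNReal.toReal_le_of_le_ofReal (by positivity) (volume_cell_le hM hT)

theorem zpow_sub_two_mul (D : Discretization d k Ω γ) :
    D.h ^ ((d : ℤ) - 2) * D.h ^ 2 = D.h ^ d := by
  have := D.h_pos
  rw [← zpow_natCast, ← zpow_natCast, ← zpow_add₀ this.ne']
  congr 1
  push_cast; ring

theorem mul_add_le_of_nonneg {m b g J B : ℝ} (hm : 0 ≤ m) (hb : 0 ≤ b) (hg : 0 ≤ g) (hJ : 0 ≤ J)
    (hB : 0 ≤ B) : b * (J + m * (g * B)) + B ≤ (1 + b * (1 + m * g)) * (J + B) := by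
  have h1 : 0 ≤ J + b * B + b * (m * g) * J := by positivity
  linarith [(by ring : (1 + b * (1 + m * g)) * (J + B) =
    b * (J + m * (g * B)) + B + (J + b * B + b * (m * g) * J))]

-- With p and q the extensions from T and S_h(T), write ∇p = ∇(p - q) + ∇q. The second term is
-- controlled by the energy of S_h(T), one of the nearby large elements. The first is handled by an
-- inverse inequality, since p - q = ∑ e_i φ_i on T with coefficients bounded by `abs_coeff_sub_le`.
open Classical in
theorem energy_small_le [Fintype κ] {θ C Cψ Cφ R : ℝ} (hC : ScaledBound d k R θ C) (hC0 : 0 < C)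
    (hd : 1 ≤ d) (hM : D.mesh.IsQuasiUniform D.h ρ) (hρ : 0 < ρ) (hθ : θ ≤ ballVolume d * ρ ^ d)
    (hR : 1 ≤ R) (hRN : 2 * N ≤ R)
    (hA : D.IsAffineFamily ψ) (hp : D.HasPaths N) (hlp : D.HasLargePaths N)
    (hCψ : ∀ T ∈ D.mesh.active Ω, ∀ (c : D.ι → ℝ) (B : ℝ),
        (∀ x ∈ cell T, |(∑ j, c j • D.shape j) x| ≤ B) → ∀ i ∈ D.localIdx T, |c i| ≤ Cψ * B)
    (hCφ : ∀ T ∈ D.mesh.active Ω, ∀ i ∈ D.localIdx T, ∀ x ∈ cell T, |D.shape i x| ≤ Cφ)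
    {v : E d → ℝ} (hv : v ∈ D.V) {T : Finset (E d)} (hT : T ∈ D.mesh.small Ω γ) :
    energy k T v ≤ 2 * C * ballVolume d * (1 + ballVolume d * (2 * Fintype.card κ * Cφ ^ 2) *
        (1 + Fintype.card κ * ((2 * Cψ * N * R) ^ 2 * C))) *
      ((∑ i with i ∈ D.localIdx T ∧ i ∈ D.smallIdx, D.h ^ ((d : ℤ) - 2) * |D.jumpDof v i| ^ 2) +
        ∑ T' ∈ D.nearLarge (2 * N) T, energy k T' v) := by
  set B := ∑ T' ∈ D.nearLarge (2 * N) T, energy k T' v with hB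
  have hB0 : 0 ≤ B := Finset.sum_nonneg fun _ _ => energy_nonneg _ _
  set m := (Fintype.card κ : ℝ) with hm
  have hm0 : 0 ≤ m := by positivity
  set K := Cψ * (N * (2 * Real.sqrt (C * B / D.h ^ d) * (R * D.h))) with hK
  have hh := D.h_pos
  have hω := ballVolume_pos d
  have hST := D.S_mem T hT
  set q := polyExt k (D.S T) v with hq
  set p := polyExt k T v with hpdef
  have hqs := Mesh.polyExt_spec hv hST.1
  have hps := Mesh.polyExt_spec hv hT.1
  set e : D.ι → ℝ := fun i => D.coeff hv i - D.polyCoeff hqs.1 i with he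
  have hei : ∀ i ∈ D.localIdx T, |e i| ≤ (if i ∈ D.smallIdx then |D.jumpDof v i| else 0) + K :=
    fun i hi => abs_coeff_sub_le hC hC0 hd hM hρ hθ hR hRN hA hp hlp hCψ hv hT hi
  set J := ∑ i with i ∈ D.localIdx T ∧ i ∈ D.smallIdx, |D.jumpDof v i| ^ 2 with hJ
  have hJ0 : 0 ≤ J := Finset.sum_nonneg fun _ _ => sq_nonneg _
  have hesum : ∑ i with i ∈ D.localIdx T, e i ^ 2 ≤ 2 * J + 2 * (m * K ^ 2) := by
    have h1 : ∀ i ∈ Finset.univ.filter (· ∈ D.localIdx T), e i ^ 2 ≤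
        2 * (if i ∈ D.smallIdx then |D.jumpDof v i| ^ 2 else 0) + 2 * K ^ 2 := by
      intro i hi
      have h2 := hei i (Finset.mem_filter.1 hi).2
      have h3 : e i ^ 2 ≤ ((if i ∈ D.smallIdx then |D.jumpDof v i| else 0) + K) ^ 2 := by
        rw [← sq_abs]; exact pow_le_pow_left₀ (abs_nonneg _) h2 2
      refine h3.trans ?_
      split_ifs
      · nlinarith [sq_nonneg (|D.jumpDof v i| - K)]
      · nlinarith [sq_nonneg K]
    refine (Finset.sum_le_sum h1).trans (le_of_eq ?_)
    rw [Finset.sum_add_distrib, ← Finset.mul_sum, ← Finset.sum_filter, Finset.filter_filter,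
      Finset.sum_const, hA.card_localIdx hT.1, nsmul_eq_mul]
    ring
  have hdiff : ∀ x ∈ cell T, (p - q) x ^ 2 ≤ 2 * m * Cφ ^ 2 * (J + m * K ^ 2) := by
    intro x hx
    have h1 : (p - q) x = ∑ i with i ∈ D.localIdx T, e i * D.shape i x := by
      rw [← sum_local hM hρ hT.1 e hx]
      simp only [he, sub_smul, Finset.sum_sub_distrib, Pi.sub_apply]
      rw [← sum_polyCoeff hqs.1 hT.1 hx, sum_coeff hv, hps.2 hx]
    rw [h1]
    refine (sq_sum_le_card_mul_sum_sq).trans ?_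
    rw [hA.card_localIdx hT.1, ← hm]
    have h2 : ∑ i with i ∈ D.localIdx T, (e i * D.shape i x) ^ 2 ≤
        (∑ i with i ∈ D.localIdx T, e i ^ 2) * Cφ ^ 2 := by
      rw [Finset.sum_mul]
      refine Finset.sum_le_sum fun i hi => ?_
      rw [mul_pow, ← sq_abs (D.shape i x)]
      exact mul_le_mul_of_nonneg_left (pow_le_pow_left₀ (abs_nonneg _)
        (hCφ T hT.1 i (Finset.mem_filter.1 hi).2 x hx) 2) (sq_nonneg _)
    calc m * ∑ i with i ∈ D.localIdx T, (e i * D.shape i x) ^ 2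
        ≤ m * ((2 * J + 2 * (m * K ^ 2)) * Cφ ^ 2) :=
          mul_le_mul_of_nonneg_left (h2.trans (mul_le_mul_of_nonneg_right hesum (sq_nonneg _))) hm0
      _ = _ := by ring
  set Q := 2 * m * Cφ ^ 2 * (J + m * K ^ 2) with hQ
  have hQ0 : 0 ≤ Q := by positivity
  have hgd : ∀ x ∈ cell T, ‖gradient (p - q) x‖ ^ 2 ≤ C * ballVolume d * Q / D.h ^ 2 := by
    intro x hx
    have h1 := (hC D.h x (cell T) hh (measurableSet_cell T)
      ((hM.cell_subset_closedBall hT.1.1 hx).trans (Metric.closedBall_subset_closedBall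
        (by nlinarith))) (le_trans (ENNReal.ofReal_le_ofReal (by gcongr))
          (hM.le_volume_cell hh hρ hT.1.1)) _ (sub_mem hps.1 hqs.1) x
          (Metric.mem_closedBall_self (by positivity))).2.1
    have h2 := setIntegral_cell_le hM hT.1.1 hQ0 (f := fun y => (p - q) y ^ 2) (fun y hy => by
      rw [abs_of_nonneg (sq_nonneg _)]; exact hdiff y hy)
    have h3 := h1.trans (mul_le_mul_of_nonneg_left h2 hC0.le)
    rw [le_div_iff₀ (by positivity)]
    refine le_of_mul_le_mul_left ?_ (by positivity : 0 < D.h ^ d)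
    calc _ = D.h ^ d * (D.h ^ 2 * ‖gradient (p - q) x‖ ^ 2) := by ring
      _ ≤ _ := h3
      _ = _ := by ring
  have hgq : ∀ x ∈ cell T, ‖gradient q x‖ ^ 2 ≤ C * B / D.h ^ d := by
    intro x hx
    obtain ⟨z, hz⟩ := Mesh.nonempty_of_mem_elements hST.1.1
    have hN0 : (0:ℝ) ≤ N := Nat.cast_nonneg N
    have hnear : D.Near N T (D.S T) := near_of_path hd hM active_subset_elements (hp T hT)
    have hmem : D.S T ∈ D.nearLarge (2 * N) T := by
      refine mem_nearLarge.2 ⟨hST, fun x hx z hz => (hnear x hx z hz).trans ?_⟩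
      gcongr; linarith
    have h1 := norm_gradient_le_of_energy_le (B := B) hC hM hh hρ hθ hR hv hST.1 (subset_cell _ hz)
      (x := x) ((hnear x hx z (subset_cell _ hz)).trans (by gcongr; linarith))
      (mul_le_mul_of_nonneg_left (Finset.single_le_sum (f := fun T' => energy k T' v)
        (fun _ _ => energy_nonneg _ _) hmem) hC0.le)
    calc _ ≤ Real.sqrt (C * B / D.h ^ d) ^ 2 := pow_le_pow_left₀ (norm_nonneg _) h1 2
      _ = _ := Real.sq_sqrt (by positivity)
  have hgp : ∀ x ∈ cell T, |‖gradient p x‖ ^ 2| ≤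
      2 * (C * ballVolume d * Q / D.h ^ 2) + 2 * (C * B / D.h ^ d) := by
    intro x hx
    rw [abs_of_nonneg (sq_nonneg _)]
    have h1 : ‖gradient p x‖ ≤ ‖gradient (p - q) x‖ + ‖gradient q x‖ := by
      rw [gradient_sub_of_mem hps.1 hqs.1]
      simpa using norm_add_le (gradient p x - gradient q x) (gradient q x)
    have h2 := hgd x hx
    have h3 := hgq x hx
    have h4 := pow_le_pow_left₀ (norm_nonneg _) h1 2
    nlinarith [sq_nonneg (‖gradient (p - q) x‖ - ‖gradient q x‖)]
  have hfin := setIntegral_cell_le hM hT.1.1 (by positivity) hgp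
  have hz := D.zpow_sub_two_mul
  set z := D.h ^ ((d : ℤ) - 2) with hzdef
  have hz0 : 0 < z := by positivity
  -- The weight h^{d-2} of the stabilization is exactly the one that cancels all powers of h here.
  have hK2 : z * K ^ 2 = (2 * Cψ * N * R) ^ 2 * C * B := by
    have h1 : Real.sqrt (C * B / D.h ^ d) ^ 2 = C * B / D.h ^ d := Real.sq_sqrt (by positivity)
    calc z * K ^ 2 = (2 * Cψ * N * R) ^ 2 * (Real.sqrt (C * B / D.h ^ d) ^ 2) * (z * D.h ^ 2) := by
          rw [hK]; ring
      _ = _ := by rw [h1, hz]; field_simp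
  have h5 : (2 * (C * ballVolume d * Q / D.h ^ 2) + 2 * (C * B / D.h ^ d)) * (ballVolume d * D.h ^ d)
      = 2 * C * ballVolume d * (ballVolume d * (2 * m * Cφ ^ 2) *
        (z * J + m * (z * K ^ 2)) + B) := by
    rw [hQ, ← hz]
    field_simp
  refine hfin.trans ?_
  rw [h5, hK2, ← Finset.mul_sum, ← hJ]
  have h6 := mul_add_le_of_nonneg hm0
    (by positivity : 0 ≤ ballVolume d * (2 * m * Cφ ^ 2))
    (by positivity : 0 ≤ (2 * Cψ * N * R) ^ 2 * C) (by positivity : 0 ≤ z * J) hB0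
  calc _ ≤ 2 * C * ballVolume d * _ := mul_le_mul_of_nonneg_left h6 (by positivity)
    _ = _ := by ring

end Discretization
end CutFEM

/-! ### Gradients on the active mesh and the global energy bound -/

namespace CutFEM

namespace Mesh

variable {d k : ℕ} {M : Mesh d} {Ω : Set (E d)} {v w : E d → ℝ}

theorem eventuallyEq_polyExt (hv : v ∈ M.activeSpace Ω k) {T : Finset (E d)} (hT : T ∈ M.active Ω)
    {x : E d} (hx : x ∈ interior (cell T)) : v =ᶠ[𝓝 x] polyExt k T v := by
  filter_upwards [isOpen_interior.mem_nhds hx] with y hy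
  exact (polyExt_spec hv hT).2 (interior_subset hy)

theorem gradient_eq_of_mem_interior (hv : v ∈ M.activeSpace Ω k) {T : Finset (E d)}
    (hT : T ∈ M.active Ω) {x : E d} (hx : x ∈ interior (cell T)) :
    gradient v x = gradient (polyExt k T v) x := by
  rw [gradient, (eventuallyEq_polyExt hv hT hx).fderiv_eq, gradient]

theorem differentiableAt_of_mem_interior (hv : v ∈ M.activeSpace Ω k) {T : Finset (E d)}
    (hT : T ∈ M.active Ω) {x : E d} (hx : x ∈ interior (cell T)) : DifferentiableAt ℝ v x :=
  (differentiable_of_mem_polySpace (polyExt_spec hv hT).1 x).congr_of_eventuallyEq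
    (eventuallyEq_polyExt hv hT hx)

theorem measurable_gradient (v : E d → ℝ) : Measurable (gradient v) :=
  (InnerProductSpace.toDual ℝ (E d)).symm.continuous.measurable.comp (measurable_fderiv ℝ v)

theorem ae_differentiableAt (hΩm : MeasurableSet Ω) (hΩ : Ω ⊆ M.complex.space)
    (hv : v ∈ M.activeSpace Ω k) : ∀ᵐ x ∂volume.restrict Ω, DifferentiableAt ℝ v x := by
  rw [ae_restrict_iff' hΩm]
  filter_upwards [ae_mem_interior hΩ] with x hx hxΩ
  obtain ⟨T, hT, hxT⟩ := hx hxΩ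
  exact differentiableAt_of_mem_interior hv hT hxT

theorem exists_gradient_bound (hv : v ∈ M.activeSpace Ω k) : ∃ B, 0 ≤ B ∧ ∀ T ∈ M.active Ω,
    ∀ x ∈ cell T, ‖gradient (polyExt k T v) x‖ ≤ B := by
  have h1 : ∀ T ∈ M.active Ω, ∃ B, ∀ x ∈ cell T, ‖gradient (polyExt k T v) x‖ ≤ B := by
    intro T hT
    obtain ⟨B, hB⟩ := ((isCompact_cell T).image_of_continuousOn
      (continuous_gradient_of_mem_polySpace (polyExt_spec hv hT).1).norm.continuousOn).bddAbove
    exact ⟨B, fun x hx => hB ⟨x, hx, rfl⟩⟩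
  choose! b hb using h1
  refine ⟨∑ T ∈ (M.finite_active Ω).toFinset, |b T|, Finset.sum_nonneg fun _ _ => abs_nonneg _,
    fun T hT x hx => (hb T hT x hx).trans ((le_abs_self _).trans ?_)⟩
  exact Finset.single_le_sum (f := fun T => |b T|) (fun _ _ => abs_nonneg _)
    ((M.finite_active Ω).mem_toFinset.2 hT)

theorem ae_gradient_bound (hΩm : MeasurableSet Ω) (hΩ : Ω ⊆ M.complex.space)
    (hv : v ∈ M.activeSpace Ω k) : ∃ B, 0 ≤ B ∧ ∀ᵐ x ∂volume.restrict Ω, ‖gradient v x‖ ≤ B := by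
  obtain ⟨B, hB0, hB⟩ := exists_gradient_bound hv
  refine ⟨B, hB0, ?_⟩
  rw [ae_restrict_iff' hΩm]
  filter_upwards [ae_mem_interior hΩ] with x hx hxΩ
  obtain ⟨T, hT, hxT⟩ := hx hxΩ
  rw [gradient_eq_of_mem_interior hv hT hxT]
  exact hB T hT x (interior_subset hxT)

theorem integrable_inner_gradient (hΩc : IsCompact Ω) (hΩ : Ω ⊆ M.complex.space)
    (hv : v ∈ M.activeSpace Ω k) (hw : w ∈ M.activeSpace Ω k) :
    Integrable (fun x => inner ℝ (gradient v x) (gradient w x)) (volume.restrict Ω) := by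
  have hΩm := hΩc.measurableSet
  have : IsFiniteMeasure (volume.restrict Ω) := ⟨by simpa using hΩc.measure_lt_top⟩
  obtain ⟨B, hB0, hB⟩ := ae_gradient_bound hΩm hΩ hv
  obtain ⟨B', hB0', hB'⟩ := ae_gradient_bound hΩm hΩ hw
  refine Integrable.of_bound
    ((measurable_gradient v).inner (measurable_gradient w)).aestronglyMeasurable (B * B') ?_
  filter_upwards [hB, hB'] with x hx hx'
  exact (norm_inner_le_norm _ _).trans (mul_le_mul hx hx' (norm_nonneg _) hB0)

theorem integrable_norm_gradient_sq (hΩc : IsCompact Ω) (hΩ : Ω ⊆ M.complex.space)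
    (hv : v ∈ M.activeSpace Ω k) :
    Integrable (fun x => ‖gradient v x‖ ^ 2) (volume.restrict Ω) := by
  simpa only [real_inner_self_eq_norm_sq] using integrable_inner_gradient hΩc hΩ hv hv

theorem setIntegral_gradient_cell (hΩm : MeasurableSet Ω) (hv : v ∈ M.activeSpace Ω k)
    {T : Finset (E d)} (hT : T ∈ M.active Ω) :
    ∫ x in cell T ∩ Ω, ‖gradient (polyExt k T v) x‖ ^ 2 = ∫ x in cell T ∩ Ω, ‖gradient v x‖ ^ 2 := by
  refine setIntegral_congr_ae ((measurableSet_cell T).inter hΩm) ?_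
  have h1 : ∀ᵐ x : E d, x ∉ frontier (cell T) :=
    measure_eq_zero_iff_ae_notMem.1 ((convex_cell T).addHaar_frontier volume)
  filter_upwards [h1] with x hx hxT
  rw [(isCompact_cell T).isClosed.frontier_eq] at hx
  have : x ∈ interior (cell T) := by
    by_contra hni
    exact hx ⟨hxT.1, hni⟩
  rw [gradient_eq_of_mem_interior hv hT this]

theorem sum_setIntegral_le {F : Finset (Finset (E d))} (hF : ∀ T ∈ F, T ∈ M.elements)
    (hΩm : MeasurableSet Ω)
    {f : E d → ℝ} (hf : Integrable f (volume.restrict Ω)) (hf0 : ∀ x, 0 ≤ f x) :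
    ∑ T ∈ F, ∫ x in cell T ∩ Ω, f x ≤ ∫ x in Ω, f x := by
  have hsub : (⋃ T : F, cell (T : Finset (E d)) ∩ Ω) ⊆ Ω := Set.iUnion_subset fun _ => Set.inter_subset_right
  have h1 := integral_iUnion_ae (μ := volume) (f := f)
    (s := fun T : F => cell (T : Finset (E d)) ∩ Ω)
    (fun T => ((measurableSet_cell _).inter hΩm).nullMeasurableSet)
    (fun T T' hne => measure_mono_null
      (Set.inter_subset_inter Set.inter_subset_left Set.inter_subset_left)
      (volume_cell_inter (hF T T.2) (hF T' T'.2) fun h => hne (Subtype.ext h)))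
    (hf.mono_measure (Measure.restrict_mono hsub le_rfl))
  rw [tsum_fintype, Finset.sum_coe_sort F (fun T => ∫ x in cell T ∩ Ω, f x)] at h1
  rw [← h1]
  exact setIntegral_mono_set hf (ae_of_all _ hf0) hsub.eventuallyLE

end Mesh

namespace Discretization

variable {d k N : ℕ} {Ω : Set (E d)} {γ ρ : ℝ} {D : Discretization d k Ω γ}
variable {κ : Type} {ψ : Module.Basis κ ℝ (polySpace d k)}

/-- The uncut energy is recovered from T ∩ Ω alone, whose volume is at least γ|T|. -/
theorem energy_large_le {θ C R : ℝ} (hC : ScaledBound d k R θ C) (hC0 : 0 < C)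
    (hM : D.mesh.IsQuasiUniform D.h ρ) (hρ : 0 < ρ) (hγ : 0 ≤ γ)
    (hθ : θ ≤ γ * (ballVolume d * ρ ^ d)) (hR : 1 ≤ R) (hΩm : MeasurableSet Ω)
    {v : E d → ℝ} (hv : v ∈ D.V) {T : Finset (E d)} (hT : T ∈ D.mesh.large Ω γ) :
    energy k T v ≤ C * ballVolume d * ∫ x in cell T ∩ Ω, ‖gradient v x‖ ^ 2 := by
  have hh := D.h_pos
  have hω := ballVolume_pos d
  rw [← Mesh.setIntegral_gradient_cell hΩm hv hT.1]
  set I := ∫ x in cell T ∩ Ω, ‖gradient (polyExt k T v) x‖ ^ 2 with hI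
  have hI0 : 0 ≤ I := integral_nonneg fun _ => sq_nonneg _
  have h1 : ∀ x ∈ cell T, |‖gradient (polyExt k T v) x‖ ^ 2| ≤ C * I / D.h ^ d := by
    intro x hx
    have hvol : ENNReal.ofReal (θ * D.h ^ d) ≤ volume (cell T ∩ Ω) := by
      refine le_trans ?_ hT.2
      refine le_trans ?_ (mul_le_mul_right (hM.le_volume_cell hh hρ hT.1.1) _)
      rw [← ENNReal.ofReal_mul hγ]
      refine ENNReal.ofReal_le_ofReal ?_
      rw [← mul_assoc]
      gcongr
    have := (hC D.h x (cell T ∩ Ω) hh ((measurableSet_cell T).inter hΩm)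
      (Set.inter_subset_left.trans ((hM.cell_subset_closedBall hT.1.1 hx).trans
        (Metric.closedBall_subset_closedBall (by nlinarith)))) hvol _ (Mesh.polyExt_spec hv hT.1).1 x
        (Metric.mem_closedBall_self (by positivity))).2.2
    rw [abs_of_nonneg (sq_nonneg _), le_div_iff₀ (by positivity)]
    linarith
  refine (setIntegral_cell_le hM hT.1.1 (by positivity) h1).trans (le_of_eq ?_)
  field_simp

/-- The support of a basis function is not assumed local; its small elements are confined through
the chain T, S_h(T), S_h(T_i), T_i, each link of length at most N h. -/
theorem near_of_mem_localIdx (hd : 1 ≤ d) (hM : D.mesh.IsQuasiUniform D.h ρ)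
    (hp : D.HasPaths N) (hlp : D.HasLargePaths N) {i : D.ι} (hi : i ∈ D.smallIdx)
    {T : Finset (E d)} (hT : T ∈ D.mesh.small Ω γ) (hiT : i ∈ D.localIdx T) :
    D.Near (3 * N) T (D.node i) := by
  have hU := node_mem_small hi
  have h1 := near_of_path hd hM active_subset_elements (hp T hT)
  have h2 := near_of_path hd hM active_subset_elements (hp _ hU)
  have h3 := near_of_path hd hM large_subset_elements
    ((hlp i T (D.node i) hiT (D.node_subset i) hU).1 hT)
  have h4 := near_trans (near_trans h1 h3 (Mesh.nonempty_of_mem_elements (D.S_mem T hT).1.1))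
    (near_symm h2) (Mesh.nonempty_of_mem_elements (D.S_mem _ hU).1.1)
  convert h4 using 1
  ring

theorem card_near_le (hM : D.mesh.IsQuasiUniform D.h ρ) (hρ : 0 < ρ) {r : ℝ} (hr : 0 ≤ r)
    {F : Finset (Finset (E d))} (hF : ∀ T ∈ F, T ∈ D.mesh.elements) {T' : Finset (E d)}
    (hT' : T' ∈ D.mesh.elements) (hnear : ∀ T ∈ F, D.Near r T T') :
    (F.card : ℝ) ≤ (r / ρ) ^ d := by
  obtain ⟨z, hz⟩ := Mesh.nonempty_of_mem_elements hT'
  exact hM.card_le D.h_pos hρ (x := z) hr hF fun T hT x hx => hnear T hT x hx z (subset_cell T' hz)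

/-- The squared seminorm associated with the stabilization, `∑ h^{d-2} |φ*_{i,T_i}([v])|²`. -/
def stabSq (D : Discretization d k Ω γ) (v : E d → ℝ) : ℝ :=
  open Classical in ∑ i with i ∈ D.smallIdx, D.h ^ ((d : ℤ) - 2) * |D.jumpDof v i| ^ 2

theorem stabSq_nonneg (D : Discretization d k Ω γ) (v : E d → ℝ) : 0 ≤ D.stabSq v := by
  have := D.h_pos
  exact Finset.sum_nonneg fun _ _ => by positivity

/-- The energy on the whole active mesh is controlled by the energy on the domain and the
stabilization. -/
theorem exists_energy_bound (d k N : ℕ) (hd : 1 ≤ d) {γ ρ : ℝ} (hγ : 0 < γ) (hγ' : γ ≤ 1)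
    (hρ : 0 < ρ) {κ : Type} [Finite κ] (ψ : Module.Basis κ ℝ (polySpace d k)) :
    ∃ C > 0, ∀ (Ω : Set (E d)) (D : Discretization d k Ω γ), IsCompact Ω →
      D.mesh.IsQuasiUniform D.h ρ → D.IsAffineFamily ψ → D.HasPaths N → D.HasLargePaths N →
      ∀ v ∈ D.V, ∑ T ∈ (D.mesh.finite_active Ω).toFinset, energy k T v ≤
        C * ((∫ x in Ω, ‖gradient v x‖ ^ 2) + D.stabSq v) := by
  classical
  have := Fintype.ofFinite κ
  have hω := ballVolume_pos d
  set R : ℝ := 2 * N + 1 with hR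
  have hN0 : (0:ℝ) ≤ N := Nat.cast_nonneg N
  set θ : ℝ := γ * (ballVolume d * ρ ^ d) with hθ
  obtain ⟨C, hC0, hC⟩ := exists_scaled_bounds d k R θ (by positivity)
  obtain ⟨Cψ, _, hCψ⟩ := IsAffineFamily.coeff_bound ψ
  obtain ⟨Cφ, hCφ0, hCφ⟩ := IsAffineFamily.shape_bound ψ
  set C₁ := 2 * C * ballVolume d * (1 + ballVolume d * (2 * Fintype.card κ * Cφ ^ 2) *
        (1 + Fintype.card κ * ((2 * Cψ * N * R) ^ 2 * C))) with hC₁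
  have hC₁0 : 0 < C₁ := by positivity
  -- Bounds the number of elements within distance 3 N h of a given one, hence both overlap counts
  -- below: small elements sharing a small index, and small elements near a given large one.
  set c₀ : ℝ := (3 * N / ρ) ^ d with hc₀
  have hc₀0 : 0 ≤ c₀ := by positivity
  refine ⟨(C₁ * c₀ + 1) * (C * ballVolume d + 1), by positivity, ?_⟩
  intro Ω D hΩc hM hA hp hlp v hv
  have hΩm := hΩc.measurableSet
  set A := (D.mesh.finite_active Ω).toFinset with hAdef
  have hAmem : ∀ T, T ∈ A ↔ T ∈ D.mesh.active Ω := fun T => Set.Finite.mem_toFinset _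
  set L := A.filter (· ∈ D.mesh.large Ω γ) with hL
  set Sm := A.filter (· ∉ D.mesh.large Ω γ) with hSm
  have hSmem : ∀ T ∈ Sm, T ∈ D.mesh.small Ω γ := fun T hT =>
    ⟨(hAmem T).1 (Finset.mem_filter.1 hT).1, (Finset.mem_filter.1 hT).2⟩
  have hLmem : ∀ T ∈ L, T ∈ D.mesh.large Ω γ := fun T hT => (Finset.mem_filter.1 hT).2
  set X := D.stabSq v with hX
  have hX0 := D.stabSq_nonneg v
  set I := ∫ x in Ω, ‖gradient v x‖ ^ 2 with hI
  have hI0 : 0 ≤ I := integral_nonneg fun _ => sq_nonneg _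
  have hLarge : ∑ T ∈ L, energy k T v ≤ C * ballVolume d * I := by
    refine (Finset.sum_le_sum fun T hT => energy_large_le hC hC0 hM hρ hγ.le le_rfl
      (by linarith) hΩm hv (hLmem T hT)).trans ?_
    rw [← Finset.mul_sum]
    refine mul_le_mul_of_nonneg_left ?_ (by positivity)
    exact Mesh.sum_setIntegral_le (fun T hT => (hLmem T hT).1.1) hΩm
      (Mesh.integrable_norm_gradient_sq hΩc (D.covers) hv) fun x => sq_nonneg _
  have hθ' : θ ≤ ballVolume d * ρ ^ d :=
    mul_le_of_le_one_left (by positivity) hγ'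
  have hsm : ∀ T ∈ Sm, energy k T v ≤ C₁ *
      ((∑ i with i ∈ D.localIdx T ∧ i ∈ D.smallIdx, D.h ^ ((d : ℤ) - 2) * |D.jumpDof v i| ^ 2) +
        ∑ T' ∈ D.nearLarge (2 * N) T, energy k T' v) := fun T hT =>
    energy_small_le hC hC0 hd hM hρ hθ' (by linarith) (by linarith) hA hp hlp
      (fun T hT c B => hCψ Ω γ ρ D hρ hM hA T hT c B) (hCφ Ω γ D hA) hv (hSmem T hT)
  have hsum1 : ∑ T ∈ Sm, ∑ i with i ∈ D.localIdx T ∧ i ∈ D.smallIdx,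
      D.h ^ ((d : ℤ) - 2) * |D.jumpDof v i| ^ 2 ≤ c₀ * X := by
    have h1 : ∀ T, ∑ i with i ∈ D.localIdx T ∧ i ∈ D.smallIdx,
        D.h ^ ((d : ℤ) - 2) * |D.jumpDof v i| ^ 2 = ∑ i with i ∈ D.smallIdx,
        if i ∈ D.localIdx T then D.h ^ ((d : ℤ) - 2) * |D.jumpDof v i| ^ 2 else 0 := by
      intro T
      rw [← Finset.sum_filter, Finset.filter_filter]
      refine Finset.sum_congr (Finset.filter_congr fun i _ => and_comm) fun _ _ => rfl
    simp_rw [h1]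
    -- After exchanging the sums, each small index is counted once for every small element in its
    -- support.
    rw [Finset.sum_comm, hX, stabSq, Finset.mul_sum]
    refine Finset.sum_le_sum fun i hi => ?_
    rw [← Finset.sum_filter, Finset.sum_const, nsmul_eq_mul]
    have hi' := (Finset.mem_filter.1 hi).2
    have := D.h_pos
    refine mul_le_mul_of_nonneg_right ?_ (by positivity)
    refine card_near_le hM hρ (by positivity) (fun T hT =>
      (hSmem T (Finset.mem_filter.1 hT).1).1.1) (D.node_mem i).1 (fun T hT => ?_)
    exact near_of_mem_localIdx hd hM hp hlp hi' (hSmem T (Finset.mem_filter.1 hT).1)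
      (Finset.mem_filter.1 hT).2
  have hsum2 : ∑ T ∈ Sm, ∑ T' ∈ D.nearLarge (2 * N) T, energy k T' v ≤
      c₀ * ∑ T ∈ L, energy k T v := by
    have h1 : ∀ T, ∑ T' ∈ D.nearLarge (2 * N) T, energy k T' v =
        ∑ T' ∈ L, if D.Near (2 * N) T T' then energy k T' v else 0 := by
      intro T
      rw [← Finset.sum_filter, hL, Finset.filter_filter]
      rfl
    simp_rw [h1]
    -- Likewise each large element is counted once for every small element within 2 N h of it.
    rw [Finset.sum_comm, Finset.mul_sum]
    refine Finset.sum_le_sum fun T' hT' => ?_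
    rw [← Finset.sum_filter, Finset.sum_const, nsmul_eq_mul]
    refine mul_le_mul_of_nonneg_right ?_ (energy_nonneg _ _)
    refine (card_near_le hM hρ (by positivity) (fun T hT =>
      (hSmem T (Finset.mem_filter.1 hT).1).1.1) (hLmem T' hT').1.1
      (fun T hT => (Finset.mem_filter.1 hT).2)).trans ?_
    rw [hc₀]
    gcongr
    linarith
  have hSmall : ∑ T ∈ Sm, energy k T v ≤ C₁ * (c₀ * X + c₀ * ∑ T ∈ L, energy k T v) := by
    refine (Finset.sum_le_sum hsm).trans ?_
    rw [← Finset.mul_sum, Finset.sum_add_distrib]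
    exact mul_le_mul_of_nonneg_left (add_le_add hsum1 hsum2) hC₁0.le
  have hsplit : ∑ T ∈ A, energy k T v = ∑ T ∈ L, energy k T v + ∑ T ∈ Sm, energy k T v :=
    (Finset.sum_filter_add_sum_filter_not _ _ _).symm
  rw [hsplit]
  have h7 : 0 ≤ C₁ * c₀ := by positivity
  have h8 : 0 ≤ C * ballVolume d := by positivity
  calc _ ≤ (C₁ * c₀ + 1) * ∑ T ∈ L, energy k T v + C₁ * c₀ * X := by linarith
    _ ≤ (C₁ * c₀ + 1) * (C * ballVolume d * I) + C₁ * c₀ * X := by gcongr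
    _ ≤ (C₁ * c₀ + 1) * ((C * ballVolume d + 1) * I) +
        (C₁ * c₀ + 1) * (C * ballVolume d + 1) * X := by
      have h9 : C₁ * c₀ ≤ (C₁ * c₀ + 1) * (C * ballVolume d + 1) := by nlinarith
      refine add_le_add (mul_le_mul_of_nonneg_left ?_ (by linarith))
        (mul_le_mul_of_nonneg_right h9 hX0)
      linarith
    _ = _ := by ring

end Discretization

end CutFEM

namespace CutFEM

/-! ### Surface measure -/

theorem _root_.LipschitzWith.euclideanHausdorffMeasure_image_le {X Y : Type*} [EMetricSpace X]
    [MeasurableSpace X] [BorelSpace X] [EMetricSpace Y] [MeasurableSpace Y] [BorelSpace Y]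
    {K : NNReal} {f : X → Y} (h : LipschitzWith K f) (m : ℕ) (s : Set X) :
    μHE[m] (f '' s) ≤ (K : ENNReal) ^ m * μHE[m] s := by
  simp only [Measure.euclideanHausdorffMeasure_def, Measure.smul_apply]
  have h1 := h.hausdorffMeasure_image_le (d := m) (by positivity) s
  rw [ENNReal.rpow_natCast] at h1
  calc _ ≤ _ := smul_le_smul_of_nonneg_left h1 (by positivity)
    _ = _ := by simp only [ENNReal.smul_def, smul_eq_mul]; ring

variable {d : ℕ} {Ω : Set (E d)}

/-- Locally the part of the boundary inside a ball of radius h is contained in the image, under the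
Lipschitz graph map, of a ball of radius h in the (d-1)-dimensional space orthogonal to e.
Compactness of the boundary reduces everything to finitely many graphs. -/
theorem IsLipschitzDomain.exists_surface_bound (hd : 1 ≤ d) (hΩ : IsLipschitzDomain Ω) :
    ∃ C > 0, ∀ (x : E d) (h : ℝ), 0 < h →
      surfaceMeasure Ω (Metric.closedBall x h) ≤ ENNReal.ofReal (C * h ^ (d - 1)) := by
  obtain ⟨m, rfl⟩ : ∃ m, d = m + 1 := ⟨d - 1, by omega⟩
  have hcpt : IsCompact (frontier Ω) :=
    hΩ.isCompact.of_isClosed_subset isClosed_frontier hΩ.isCompact.isClosed.frontier_subset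
  have hmain : ∃ C > 0, ∀ (x : E (m + 1)) (h : ℝ), 0 < h →
      μHE[m] (Metric.closedBall x h ∩ (frontier Ω ∩ frontier Ω)) ≤ ENNReal.ofReal (C * h ^ m) := by
    refine hcpt.induction_on (p := fun s => ∃ C > 0, ∀ (x : E (m + 1)) (h : ℝ), 0 < h →
      μHE[m] (Metric.closedBall x h ∩ (s ∩ frontier Ω)) ≤ ENNReal.ofReal (C * h ^ m)) ?_ ?_ ?_ ?_
    · exact ⟨1, one_pos, by simp⟩
    · rintro s t hst ⟨C, hC, H⟩
      exact ⟨C, hC, fun x h hh => (measure_mono (by gcongr)).trans (H x h hh)⟩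
    · rintro s t ⟨C, hC, H⟩ ⟨C', hC', H'⟩
      refine ⟨C + C', by positivity, fun x h hh => ?_⟩
      rw [Set.union_inter_distrib_right, Set.inter_union_distrib_left, add_mul,
        ENNReal.ofReal_add (by positivity) (by positivity)]
      exact (measure_union_le _ _).trans (add_le_add (H x h hh) (H' x h hh))
    · intro x₀ hx₀
      obtain ⟨e, he, L, g, hg, hev⟩ := hΩ.locally_subgraph x₀ hx₀
      obtain ⟨U, hU, hUo, hxU⟩ := eventually_nhds_iff.1 hev
      have he0 : e ≠ 0 := by rintro rfl; simp at he
      set W := (Submodule.span ℝ {e})ᗮ with hW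
      have hfr : Module.finrank ℝ W = m := by
        have : Fact (Module.finrank ℝ (E (m + 1)) = m + 1) := ⟨by simp⟩
        exact Submodule.finrank_orthogonal_span_singleton he0
      set Φ : W → E (m + 1) := fun w => (w : E (m + 1)) + g w • e with hΦ
      have hΦL : LipschitzWith (1 + L) Φ := by
        refine LipschitzWith.add (LipschitzWith.subtype_val _) ?_
        refine LipschitzWith.of_dist_le_mul fun w w' => ?_
        rw [dist_eq_norm, ← sub_smul, norm_smul, he, mul_one]
        exact (hg.dist_le_mul (w : E (m + 1)) w')
      have hmemW : ∀ y : E (m + 1), y - (inner ℝ e y) • e ∈ W := by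
        intro y
        rw [hW, Submodule.mem_orthogonal_singleton_iff_inner_right, inner_sub_right,
          real_inner_smul_right, real_inner_self_eq_norm_sq, he]
        ring
      have hnorm : ∀ y : E (m + 1), ‖y - (inner ℝ e y) • e‖ ≤ ‖y‖ := by
        intro y
        refine le_of_sq_le_sq ?_ (norm_nonneg _)
        rw [norm_sub_sq_real, norm_smul, real_inner_smul_right, real_inner_comm y e, he,
          Real.norm_eq_abs, mul_one, sq_abs]
        nlinarith [sq_nonneg (inner ℝ e y)]
      -- A boundary point cannot lie strictly below the graph, since a neighborhood of it would then
      -- belong to Ω.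
      have hgraph : ∀ y ∈ U ∩ frontier Ω, inner ℝ e y = g (y - (inner ℝ e y) • e) := by
        rintro y ⟨hyU, hyF⟩
        have hyΩ := hΩ.isCompact.isClosed.frontier_subset hyF
        refine le_antisymm ((hU y hyU).1 hyΩ) ?_
        by_contra hlt
        rw [not_le] at hlt
        have hc : Continuous fun z : E (m + 1) => g (z - (inner ℝ e z) • e) :=
          hg.continuous.comp (by fun_prop)
        have hc' : Continuous fun z : E (m + 1) => inner ℝ e z := by fun_prop
        have : y ∈ interior Ω := by
          rw [mem_interior_iff_mem_nhds]
          filter_upwards [(isOpen_lt hc' hc).mem_nhds hlt, hUo.mem_nhds hyU] with z hz hzU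
          exact (hU z hzU).2 (le_of_lt hz)
        exact hyF.2 this
      set b := (volume (Metric.ball (0 : W) 1)) with hb
      have hbt : b ≠ ⊤ := measure_ball_lt_top.ne
      refine ⟨U, mem_nhdsWithin_of_mem_nhds (hUo.mem_nhds hxU),
        (1 + L) ^ m * (b.toReal + 1), by positivity, fun x h hh => ?_⟩
      have hsub : Metric.closedBall x h ∩ (U ∩ frontier Ω) ⊆
          Φ '' Metric.closedBall (⟨x - (inner ℝ e x) • e, hmemW x⟩ : W) h := by
        rintro y ⟨hyB, hy⟩
        refine ⟨⟨y - (inner ℝ e y) • e, hmemW y⟩, ?_, ?_⟩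
        · rw [Metric.mem_closedBall, dist_eq_norm] at hyB ⊢
          refine le_trans ?_ hyB
          refine le_trans (le_of_eq ?_) (hnorm (y - x))
          rw [Submodule.coe_norm]
          congr 1
          simp only [AddSubgroupClass.coe_sub, inner_sub_right, sub_smul]
          abel
        · simp only [hΦ]
          rw [← hgraph y hy]
          abel
      refine (measure_mono hsub).trans ((hΦL.euclideanHausdorffMeasure_image_le m _).trans ?_)
      have hvol : (μHE[m] : Measure W) = volume := by
        rw [← InnerProductSpace.euclideanHausdorffMeasure_eq_volume, hfr]
      rw [hvol, Measure.addHaar_closedBall volume _ hh.le, hfr, ← hb]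
      rw [mul_assoc, ENNReal.ofReal_mul (by positivity), mul_comm (b.toReal + 1),
        ENNReal.ofReal_mul (by positivity)]
      gcongr
      · rw [ENNReal.ofReal_pow (by positivity)]
        gcongr
        rw [ENNReal.ofReal_add zero_le_one (by positivity)]
        simp
      · rw [← ENNReal.ofReal_toReal hbt]
        exact ENNReal.ofReal_le_ofReal (by simp)
  obtain ⟨C, hC, H⟩ := hmain
  refine ⟨C, hC, fun x h hh => ?_⟩
  have h1 := H x h hh
  rw [Set.inter_self] at h1
  rw [surfaceMeasure, Measure.restrict_apply Metric.isClosed_closedBall.measurableSet]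
  exact h1

theorem IsLipschitzDomain.isFiniteMeasure_surfaceMeasure (hd : 1 ≤ d) (hΩ : IsLipschitzDomain Ω) :
    IsFiniteMeasure (surfaceMeasure Ω) := by
  obtain ⟨C, hC, H⟩ := hΩ.exists_surface_bound hd
  obtain ⟨r, hr⟩ := hΩ.isCompact.isBounded.subset_closedBall 0
  have hsub : frontier Ω ⊆ Metric.closedBall 0 (max r 1) :=
    hΩ.isCompact.isClosed.frontier_subset.trans
      (hr.trans (Metric.closedBall_subset_closedBall (le_max_left _ _)))
  refine ⟨?_⟩
  have h1 := H 0 (max r 1) (by positivity)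
  rw [surfaceMeasure, Measure.restrict_apply Metric.isClosed_closedBall.measurableSet,
    Set.inter_eq_self_of_subset_right hsub] at h1
  rw [surfaceMeasure, Measure.restrict_apply MeasurableSet.univ, Set.univ_inter]
  exact h1.trans_lt ENNReal.ofReal_lt_top

theorem ae_surfaceMeasure_mem (Ω : Set (E d)) : ∀ᵐ x ∂surfaceMeasure Ω, x ∈ frontier Ω :=
  ae_restrict_mem isClosed_frontier.measurableSet

end CutFEM

namespace CutFEM

/-! ### A Friedrichs inequality -/

variable {m : ℕ}

/-- The point with first coordinate `z.2` and remaining coordinates `z.1`. -/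
def lift (z : E m × ℝ) : E (m + 1) := WithLp.toLp 2 (Fin.cons z.2 (WithLp.ofLp z.1))

/-- The projection that forgets the first coordinate. -/
def dropFirst (x : E (m + 1)) : E m := WithLp.toLp 2 (fun i => x i.succ)

theorem dropFirst_lift (z : E m × ℝ) : dropFirst (lift z) = z.1 := by
  ext i; simp [dropFirst, lift]

theorem lift_zero (z : E m × ℝ) : lift z 0 = z.2 := by simp [lift]

theorem lift_add (w : E m) (s t : ℝ) :
    lift (w, s + t) = lift (w, s) + t • EuclideanSpace.single 0 (1 : ℝ) := by
  ext i
  refine Fin.cases ?_ (fun i => ?_) i <;> simp [lift]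

theorem measurePreserving_lift : MeasurePreserving (lift : E m × ℝ → E (m + 1)) := by
  have h1 : MeasurePreserving (Prod.map (WithLp.ofLp : E m → (Fin m → ℝ)) (id : ℝ → ℝ)) :=
    (PiLp.volume_preserving_ofLp (Fin m)).prod (MeasurePreserving.id volume)
  have h2 := (PiLp.volume_preserving_toLp (Fin (m + 1))).comp ((measurePreserving_cons m).comp h1)
  exact h2

theorem continuous_lift (w : E m) : Continuous fun t : ℝ => lift (w, t) := by
  have : (fun t : ℝ => lift (w, t)) = fun t => lift (w, 0) + t • EuclideanSpace.single 0 (1 : ℝ) := by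
    ext1 t; rw [← lift_add, zero_add]
  rw [this]; fun_prop

theorem lipschitzWith_dropFirst : LipschitzWith 1 (dropFirst : E (m + 1) → E m) := by
  refine LipschitzWith.of_dist_le_mul fun x y => ?_
  rw [NNReal.coe_one, one_mul, EuclideanSpace.dist_eq, EuclideanSpace.dist_eq]
  refine Real.sqrt_le_sqrt ?_
  rw [Fin.sum_univ_succ (n := m)]
  simp only [dropFirst]
  exact le_add_of_nonneg_left (sq_nonneg _)

/-- The projection is 1-Lipschitz and the normalized Hausdorff measure on ℝ^m is Lebesgue measure.
This replaces a trace or divergence theorem on the boundary. -/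
theorem volume_dropFirst_image_le (A : Set (E (m + 1))) :
    volume (dropFirst '' A) ≤ μHE[m] A := by
  have h := (lipschitzWith_dropFirst (m := m)).euclideanHausdorffMeasure_image_le m A
  rw [EuclideanSpace.euclideanHausdorffMeasure_eq_volume] at h
  simpa using h

/-- Supremum of `v ^ 2` over the boundary points above `w`. -/
def fibreSup (Ω : Set (E (m + 1))) (v : E (m + 1) → ℝ) (w : E m) : ENNReal :=
  ⨆ y, ⨆ (_ : y ∈ frontier Ω ∧ dropFirst y = w), ENNReal.ofReal (v y ^ 2)

theorem setOf_lt_fibreSup (Ω : Set (E (m + 1))) (v : E (m + 1) → ℝ) (a : ENNReal) :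
    {w | a < fibreSup Ω v w} = dropFirst '' {y | y ∈ frontier Ω ∧ a < ENNReal.ofReal (v y ^ 2)} := by
  ext w
  simp only [fibreSup, lt_iSup_iff, Set.mem_ofPred_eq, Set.mem_image, exists_prop]
  constructor
  · rintro ⟨y, ⟨h1, h2⟩, h3⟩; exact ⟨y, ⟨h1, h3⟩, h2⟩
  · rintro ⟨y, ⟨h1, h3⟩, h2⟩; exact ⟨y, ⟨h1, h2⟩, h3⟩

variable {Ω : Set (E (m + 1))} {v : E (m + 1) → ℝ}

/-- A superlevel set is the projection of a relatively open subset of the compact boundary. Such a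
subset is a countable union of compact sets, so its projection is an F_σ. -/
theorem measurable_fibreSup (hΩ : IsCompact Ω) (hv : ContinuousOn v Ω) :
    Measurable (fibreSup Ω v) := by
  refine measurable_of_Ioi fun a => ?_
  have hF : IsCompact (frontier Ω) :=
    hΩ.of_isClosed_subset isClosed_frontier hΩ.isClosed.frontier_subset
  have hc : ContinuousOn (fun y => ENNReal.ofReal (v y ^ 2)) (frontier Ω) :=
    ENNReal.continuous_ofReal.comp_continuousOn ((hv.mono hΩ.isClosed.frontier_subset).pow 2)
  obtain ⟨U, hU, hUeq⟩ := (continuousOn_iff'.1 hc) (Set.Ioi a) isOpen_Ioi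
  obtain ⟨K, hK, -, hKU, -⟩ := hU.exists_iUnion_isClosed
  have h1 : (fibreSup Ω v ⁻¹' Set.Ioi a) = ⋃ n, dropFirst '' (K n ∩ frontier Ω) := by
    have h2 := setOf_lt_fibreSup Ω v a
    have h3 : {y | y ∈ frontier Ω ∧ a < ENNReal.ofReal (v y ^ 2)} = U ∩ frontier Ω := by
      rw [← hUeq]; ext y; exact and_comm
    rw [h3, ← hKU, Set.iUnion_inter, Set.image_iUnion] at h2
    exact h2
  rw [h1]
  refine MeasurableSet.iUnion fun n => ?_
  exact ((hF.inter_left (hK n)).image lipschitzWith_dropFirst.continuous).isClosed.measurableSet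

/-- Layer cake: each superlevel set of the fibre supremum is the projection of the boundary points
with v² above that level, and projecting does not increase the measure. -/
theorem lintegral_fibreSup_le (hΩ : IsCompact Ω) (hv : ContinuousOn v Ω) (hvm : Measurable v) :
    ∫⁻ w, fibreSup Ω v w ≤ ∫⁻ y, ENNReal.ofReal (v y ^ 2) ∂surfaceMeasure Ω := by
  obtain ⟨B, hB⟩ := (hΩ.image_of_continuousOn (hv.pow 2)).bddAbove
  have hfin : ∀ w, fibreSup Ω v w ≠ ⊤ := by
    intro w
    refine ne_top_of_le_ne_top (ENNReal.ofReal_ne_top (r := B)) ?_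
    refine iSup₂_le fun y hy => ENNReal.ofReal_le_ofReal ?_
    exact hB ⟨y, hΩ.isClosed.frontier_subset hy.1, rfl⟩
  have h1 : ∫⁻ w, fibreSup Ω v w = ∫⁻ w, ENNReal.ofReal ((fibreSup Ω v w).toReal) :=
    lintegral_congr fun w => (ENNReal.ofReal_toReal (hfin w)).symm
  rw [h1, lintegral_eq_lintegral_meas_lt volume (ae_of_all _ fun _ => ENNReal.toReal_nonneg)
    (measurable_fibreSup hΩ hv).ennreal_toReal.aemeasurable,
    lintegral_eq_lintegral_meas_lt (surfaceMeasure Ω) (ae_of_all _ fun _ => sq_nonneg _)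
    (hvm.pow_const 2).aemeasurable]
  refine setLIntegral_mono' measurableSet_Ioi fun t ht => ?_
  have h2 : {w | t < (fibreSup Ω v w).toReal} = {w | ENNReal.ofReal t < fibreSup Ω v w} := by
    ext w
    exact (ENNReal.ofReal_lt_iff_lt_toReal (le_of_lt ht) (hfin w)).symm
  rw [h2, setOf_lt_fibreSup]
  refine (volume_dropFirst_image_le _).trans ?_
  rw [surfaceMeasure, Measure.restrict_apply (measurableSet_lt measurable_const (hvm.pow_const 2))]
  refine measure_mono ?_
  rintro y ⟨hy, hlt⟩
  refine ⟨?_, hy⟩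
  exact (ENNReal.ofReal_lt_ofReal_iff' .. |>.1 hlt).1

theorem sq_intervalIntegral_le {f : ℝ → ℝ} {a b r : ℝ} (hab : a ≤ b) (hr : b - a ≤ r) (hr0 : 0 < r)
    (hf : IntervalIntegrable f volume a b)
    (hf2 : IntervalIntegrable (fun t => f t ^ 2) volume a b) :
    (∫ t in a..b, f t) ^ 2 ≤ r * ∫ t in a..b, f t ^ 2 := by
  set I := ∫ t in a..b, f t with hI
  -- Cauchy–Schwarz by integrating (f - c)² ≥ 0. Dividing by r rather than by b - a keeps the
  -- degenerate interval harmless.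
  set c := I / r with hc
  have h1 : ∫ t in a..b, (2 * c * f t - c ^ 2) ≤ ∫ t in a..b, f t ^ 2 := by
    refine intervalIntegral.integral_mono_on hab
      ((hf.const_mul _).sub intervalIntegrable_const) hf2 fun t _ => ?_
    nlinarith [sq_nonneg (f t - c)]
  rw [intervalIntegral.integral_sub (hf.const_mul _) intervalIntegrable_const,
    intervalIntegral.integral_const_mul, intervalIntegral.integral_const, ← hI, smul_eq_mul] at h1
  have h2 : (b - a) * c ^ 2 ≤ r * c ^ 2 := mul_le_mul_of_nonneg_right hr (sq_nonneg _)
  have h3 : I = c * r := by rw [hc]; field_simp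
  have h4 : 2 * c * I - r * c ^ 2 ≤ ∫ t in a..b, f t ^ 2 := by linarith
  calc I ^ 2 = r * (2 * c * I - r * c ^ 2) := by rw [h3]; ring
    _ ≤ _ := mul_le_mul_of_nonneg_left h4 hr0.le

end CutFEM

/-! ### Friedrichs' inequality along lines and its integration -/

namespace CutFEM

/-- Take the supremum of all t for which the segment from t₀ stays in ℓ. On a line through Ω this is
a boundary point reached without leaving Ω. -/
theorem exists_exit {ℓ : Set ℝ} (hℓ : IsClosed ℓ) (hb : BddAbove ℓ) {t₀ : ℝ} (ht₀ : t₀ ∈ ℓ) :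
    ∃ t₁, t₀ ≤ t₁ ∧ Set.Icc t₀ t₁ ⊆ ℓ ∧ ℓ ∉ 𝓝 t₁ := by
  set S := {t | t₀ ≤ t ∧ Set.Icc t₀ t ⊆ ℓ} with hS
  have h0 : t₀ ∈ S := ⟨le_rfl, by simpa using ht₀⟩
  have hSb : BddAbove S := hb.mono fun t ht => ht.2 ⟨ht.1, le_rfl⟩
  set t₁ := sSup S with ht₁
  have h01 : t₀ ≤ t₁ := le_csSup hSb h0
  have hlt : ∀ s, t₀ ≤ s → s < t₁ → s ∈ ℓ := by
    intro s hs hst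
    obtain ⟨t, ht, hst'⟩ := exists_lt_of_lt_csSup ⟨t₀, h0⟩ hst
    exact ht.2 ⟨hs, hst'.le⟩
  have h1 : t₁ ∈ ℓ := by
    have := csSup_mem_closure ⟨t₀, h0⟩ hSb
    exact hℓ.closure_subset_iff.2 (fun t ht => ht.2 ⟨ht.1, le_rfl⟩) this
  have hIcc : Set.Icc t₀ t₁ ⊆ ℓ := fun s hs =>
    (lt_or_eq_of_le hs.2).elim (hlt s hs.1) (fun h => h ▸ h1)
  refine ⟨t₁, h01, hIcc, fun hn => ?_⟩
  obtain ⟨ε, hε, hball⟩ := Metric.mem_nhds_iff.1 hn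
  have h2 : t₁ + ε / 2 ∈ S := by
    refine ⟨by linarith, fun s hs => ?_⟩
    by_cases hst : s ≤ t₁
    · exact hIcc ⟨hs.1, hst⟩
    · refine hball ?_
      rw [Metric.mem_ball, Real.dist_eq, abs_lt]
      constructor <;> linarith [hs.2, not_le.1 hst]
  have := le_csSup hSb h2
  linarith

variable {m : ℕ} {Ω : Set (E (m + 1))} {v g : E (m + 1) → ℝ}

/-- `g` bounds the derivative of `v` in the first coordinate direction, taken from the right along
segments in `Ω`. -/
def RightDerivBound (Ω : Set (E (m + 1))) (v g : E (m + 1) → ℝ) : Prop :=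
  ∀ x ∈ Ω, (∀ᶠ t in 𝓝[>] (0 : ℝ), x + t • EuclideanSpace.single 0 (1 : ℝ) ∈ Ω) →
    ∃ D, |D| ≤ g x ∧
      HasDerivWithinAt (fun t : ℝ => v (x + t • EuclideanSpace.single 0 (1 : ℝ))) D (Set.Ioi 0) 0

/-- Integrate the derivative from t₀ to the exit point and apply Cauchy–Schwarz on a segment of
length at most 2R. One-sided derivatives suffice in the mean value estimate, which suits functions
that are only piecewise smooth along the line. -/
theorem sq_le_on_line (hΩ : IsCompact Ω) (hv : ContinuousOn v Ω) (hgm : Measurable g) {B : ℝ}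
    (hg0 : ∀ x, 0 ≤ g x)
    (hgB : ∀ x, g x ≤ B) (hder : RightDerivBound Ω v g) {R : ℝ} (hR : 0 < R)
    (hΩR : ∀ x ∈ Ω, |x 0| ≤ R) (w : E m) {t₀ : ℝ} (ht₀ : lift (w, t₀) ∈ Ω) :
    ENNReal.ofReal (v (lift (w, t₀)) ^ 2) ≤ 2 * fibreSup Ω v w +
      ENNReal.ofReal (4 * R) *
        ∫⁻ t, Ω.indicator (fun x => ENNReal.ofReal (g x ^ 2)) (lift (w, t)) := by
  have hlc := continuous_lift w
  set ℓ := (fun t => lift (w, t)) ⁻¹' Ω with hℓ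
  have hℓc : IsClosed ℓ := hΩ.isClosed.preimage hlc
  have hℓR : ∀ t ∈ ℓ, |t| ≤ R := fun t ht => by simpa [lift_zero] using hΩR _ ht
  obtain ⟨t₁, h01, hIcc, hn⟩ := exists_exit hℓc ⟨R, fun t ht => (abs_le.1 (hℓR t ht)).2⟩
    (show t₀ ∈ ℓ from ht₀)
  have hfront : lift (w, t₁) ∈ frontier Ω := by
    refine ⟨subset_closure (hIcc ⟨h01, le_rfl⟩), fun hint => hn ?_⟩
    exact hlc.continuousAt.preimage_mem_nhds (mem_interior_iff_mem_nhds.1 hint)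
  set G : ℝ → ℝ := fun t => g (lift (w, t)) with hG
  have hGm : Measurable G := hgm.comp hlc.measurable
  have hGB : ∀ t, ‖G t‖ ≤ B := fun t => by
    rw [Real.norm_eq_abs, abs_of_nonneg (hg0 _)]; exact hgB _
  have hGint : IntegrableOn G (Set.Icc t₀ t₁) :=
    Measure.integrableOn_of_bounded measure_Icc_lt_top.ne hGm.aestronglyMeasurable
      (ae_of_all _ hGB)
  have hG2int : IntegrableOn (fun t => G t ^ 2) (Set.Icc t₀ t₁) :=
    Measure.integrableOn_of_bounded measure_Icc_lt_top.ne (hGm.pow_const 2).aestronglyMeasurable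
      (M := B ^ 2) (ae_of_all _ fun t => by
        rw [norm_pow]; exact pow_le_pow_left₀ (norm_nonneg _) (hGB t) 2)
  have hcont : ContinuousOn (fun t => v (lift (w, t))) (Set.Icc t₀ t₁) :=
    hv.comp hlc.continuousOn hIcc
  have hD : ∀ t ∈ Set.Ioo t₀ t₁, ∃ D, |D| ≤ G t ∧
      HasDerivWithinAt (fun s => v (lift (w, s))) D (Set.Ioi t) t := by
    intro t ht
    obtain ⟨D, hDg, hD⟩ := hder (lift (w, t)) (hIcc ⟨ht.1.le, ht.2.le⟩) (by
      filter_upwards [Ioo_mem_nhdsGT (show (0:ℝ) < t₁ - t by linarith [ht.2])] with s hs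
      rw [← lift_add]
      exact hIcc ⟨by linarith [ht.1, hs.1], by linarith [hs.2]⟩)
    refine ⟨D, hDg, ?_⟩
    have h1 : HasDerivWithinAt (fun s : ℝ => s - t) 1 (Set.Ioi t) t :=
      ((hasDerivAt_id t).sub_const t).hasDerivWithinAt
    have h2 : HasDerivWithinAt (fun r : ℝ => v (lift (w, t) + r • EuclideanSpace.single 0 (1 : ℝ))) D
        (Set.Ioi 0) (t - t) := by rwa [sub_self]
    have h3 := HasDerivWithinAt.comp t (h := fun s : ℝ => s - t) h2 h1 (fun s (hs : t < s) => by
      simpa using hs)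
    rw [mul_one] at h3
    refine h3.congr (fun s _ => ?_) ?_
    · simp only [Function.comp]
      rw [← lift_add]; congr 3; ring
    · simp only [Function.comp]
      rw [← lift_add]; congr 3; ring
  choose! D hDG hDd using hD
  have h1 := intervalIntegral.sub_le_integral_of_hasDeriv_right_of_le h01 hcont hDd hGint
    fun t ht => (abs_le.1 (hDG t ht)).2
  have h2 := intervalIntegral.sub_le_integral_of_hasDeriv_right_of_le h01 hcont.neg
    (g' := fun t => - D t) (fun t ht => (hDd t ht).neg) hGint
    fun t ht => by linarith [(abs_le.1 (hDG t ht)).1]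
  have h3 : (v (lift (w, t₁)) - v (lift (w, t₀))) ^ 2 ≤ (∫ t in t₀..t₁, G t) ^ 2 := by
    refine sq_le_sq' ?_ ?_
    · simp only [Pi.neg_apply] at h2; linarith
    · exact h1
  have hlen : t₁ - t₀ ≤ 2 * R := by
    have := abs_le.1 (hℓR t₁ (hIcc ⟨h01, le_rfl⟩))
    have := abs_le.1 (hℓR t₀ ht₀)
    linarith
  have h4 := sq_intervalIntegral_le h01 hlen (by positivity)
    ((intervalIntegrable_iff_integrableOn_Icc_of_le h01).2 hGint)
    ((intervalIntegrable_iff_integrableOn_Icc_of_le h01).2 hG2int)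
  set I := ∫ t in t₀..t₁, G t ^ 2 with hI
  -- With δ = v(t₁) - v(t₀) this is (v(t₁) - δ)² ≤ 2 v(t₁)² + 2 δ², together with δ² ≤ 2 R I.
  have h5 : v (lift (w, t₀)) ^ 2 ≤ 2 * v (lift (w, t₁)) ^ 2 + 4 * R * I := by
    nlinarith [sq_nonneg (v (lift (w, t₁)) + (v (lift (w, t₁)) - v (lift (w, t₀))))]
  have hI0 : 0 ≤ I := intervalIntegral.integral_nonneg h01 fun _ _ => sq_nonneg _
  refine (ENNReal.ofReal_le_ofReal h5).trans ?_
  rw [ENNReal.ofReal_add (by positivity) (by positivity), ENNReal.ofReal_mul zero_le_two,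
    ENNReal.ofReal_mul (by positivity), ENNReal.ofReal_ofNat]
  gcongr
  · exact le_iSup₂_of_le (lift (w, t₁)) ⟨hfront, dropFirst_lift _⟩ le_rfl
  · rw [hI, intervalIntegral.integral_of_le h01, ofReal_integral_eq_lintegral_ofReal
      (hG2int.mono_set Set.Ioc_subset_Icc_self) (ae_of_all _ fun _ => sq_nonneg _),
      ← lintegral_indicator measurableSet_Ioc]
    refine lintegral_mono fun t => ?_
    by_cases ht : t ∈ Set.Ioc t₀ t₁
    · have : lift (w, t) ∈ Ω := hIcc ⟨ht.1.le, ht.2⟩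
      simp [ht, this, hG]
    · simp [ht]

theorem lintegral_sq_le (hΩ : IsCompact Ω) (hv : ContinuousOn v Ω) (hvm : Measurable v)
    (hgm : Measurable g) {B : ℝ} (hg0 : ∀ x, 0 ≤ g x)
    (hgB : ∀ x, g x ≤ B) (hder : RightDerivBound Ω v g) {R : ℝ} (hR : 0 < R)
    (hΩR : ∀ x ∈ Ω, |x 0| ≤ R) :
    ∫⁻ x in Ω, ENNReal.ofReal (v x ^ 2) ≤ ENNReal.ofReal (2 * R) *
      (2 * (∫⁻ y, ENNReal.ofReal (v y ^ 2) ∂surfaceMeasure Ω) +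
        ENNReal.ofReal (4 * R) * ∫⁻ x in Ω, ENNReal.ofReal (g x ^ 2)) := by
  have hΩm := hΩ.measurableSet
  have hfub : ∀ f : E (m + 1) → ENNReal, Measurable f →
      ∫⁻ x in Ω, f x = ∫⁻ w, ∫⁻ t, Ω.indicator f (lift (w, t)) := by
    intro f hf
    rw [← lintegral_indicator hΩm, ← measurePreserving_lift.lintegral_comp (hf.indicator hΩm),
      Measure.volume_eq_prod, lintegral_prod (fun z : E m × ℝ => Ω.indicator f (lift z))
        ((hf.indicator hΩm).comp measurePreserving_lift.measurable).aemeasurable]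
  have hg2 : Measurable fun x => ENNReal.ofReal (g x ^ 2) := (hgm.pow_const 2).ennreal_ofReal
  have hv2 : Measurable fun x => ENNReal.ofReal (v x ^ 2) := (hvm.pow_const 2).ennreal_ofReal
  set H : E m → ENNReal := fun w => 2 * fibreSup Ω v w + ENNReal.ofReal (4 * R) *
        ∫⁻ t, Ω.indicator (fun x => ENNReal.ofReal (g x ^ 2)) (lift (w, t)) with hH
  -- The line bound does not depend on t, so integrating it over [-R, R] costs the factor 2R.
  have hline : ∀ w, ∫⁻ t, Ω.indicator (fun x => ENNReal.ofReal (v x ^ 2)) (lift (w, t)) ≤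
      ENNReal.ofReal (2 * R) * H w := by
    intro w
    have h1 : ∀ t, Ω.indicator (fun x => ENNReal.ofReal (v x ^ 2)) (lift (w, t)) ≤
        (Set.Icc (-R) R).indicator (fun _ => H w) t := by
      intro t
      by_cases ht : lift (w, t) ∈ Ω
      · have h2 : t ∈ Set.Icc (-R) R := by
          have := hΩR _ ht
          rw [lift_zero] at this
          exact abs_le.1 this
        rw [Set.indicator_of_mem ht, Set.indicator_of_mem h2]
        exact sq_le_on_line hΩ hv hgm hg0 hgB hder hR hΩR w ht
      · rw [Set.indicator_of_notMem ht]; exact zero_le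
    refine (lintegral_mono h1).trans (le_of_eq ?_)
    rw [lintegral_indicator measurableSet_Icc, setLIntegral_const, Real.volume_Icc, mul_comm]
    congr 2
    ring
  rw [hfub _ hv2, hfub _ hg2]
  refine (lintegral_mono hline).trans ?_
  rw [lintegral_const_mul' _ _ ENNReal.ofReal_ne_top]
  gcongr
  rw [hH, lintegral_add_left ((measurable_fibreSup hΩ hv).const_mul 2),
    lintegral_const_mul' _ _ (by simp), lintegral_const_mul' _ _ ENNReal.ofReal_ne_top]
  gcongr
  exact lintegral_fibreSup_le hΩ hv hvm

theorem setIntegral_sq_le [IsFiniteMeasure (surfaceMeasure Ω)] (hΩ : IsCompact Ω)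
    (hv : ContinuousOn v Ω) (hvm : Measurable v)
    (hgm : Measurable g) {B : ℝ} (hg0 : ∀ x, 0 ≤ g x)
    (hgB : ∀ x, g x ≤ B) (hder : RightDerivBound Ω v g) {R : ℝ} (hR : 0 < R)
    (hΩR : ∀ x ∈ Ω, |x 0| ≤ R) :
    ∫ x in Ω, v x ^ 2 ≤ 2 * R * (2 * (∫ y, v y ^ 2 ∂surfaceMeasure Ω) +
        4 * R * ∫ x in Ω, g x ^ 2) := by
  have hΩm := hΩ.measurableSet
  have : IsFiniteMeasure (volume.restrict Ω) := ⟨by simpa using hΩ.measure_lt_top⟩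
  obtain ⟨B', hB'⟩ := (hΩ.image_of_continuousOn (hv.pow 2)).bddAbove
  have hb : ∀ x ∈ Ω, ‖v x ^ 2‖ ≤ B' := fun x hx => by
    rw [Real.norm_eq_abs, abs_of_nonneg (sq_nonneg _)]; exact hB' ⟨x, hx, rfl⟩
  have hi1 : Integrable (fun x => v x ^ 2) (volume.restrict Ω) :=
    Integrable.of_bound (hvm.pow_const 2).aestronglyMeasurable B'
      ((ae_restrict_iff' hΩm).2 (ae_of_all _ hb))
  have hi2 : Integrable (fun x => v x ^ 2) (surfaceMeasure Ω) :=
    Integrable.of_bound (hvm.pow_const 2).aestronglyMeasurable B' (by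
      filter_upwards [ae_surfaceMeasure_mem Ω] with x hx
      exact hb x (hΩ.isClosed.frontier_subset hx))
  have hi3 : Integrable (fun x => g x ^ 2) (volume.restrict Ω) :=
    Integrable.of_bound (hgm.pow_const 2).aestronglyMeasurable (B ^ 2) (ae_of_all _ fun x => by
      rw [Real.norm_eq_abs, abs_of_nonneg (sq_nonneg _)]
      exact pow_le_pow_left₀ (hg0 x) (hgB x) 2)
  have h := lintegral_sq_le hΩ hv hvm hgm hg0 hgB hder hR hΩR
  have n1 : 0 ≤ ∫ y, v y ^ 2 ∂surfaceMeasure Ω := integral_nonneg fun _ => sq_nonneg _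
  have n2 : 0 ≤ ∫ x in Ω, g x ^ 2 := integral_nonneg fun _ => sq_nonneg _
  have h2 : ∀ X : ℝ, 2 * ENNReal.ofReal X = ENNReal.ofReal (2 * X) := fun X => by
    rw [ENNReal.ofReal_mul zero_le_two, ENNReal.ofReal_ofNat]
  rw [← ofReal_integral_eq_lintegral_ofReal hi1 (ae_of_all _ fun _ => sq_nonneg _),
    ← ofReal_integral_eq_lintegral_ofReal hi2 (ae_of_all _ fun _ => sq_nonneg _),
    ← ofReal_integral_eq_lintegral_ofReal hi3 (ae_of_all _ fun _ => sq_nonneg _),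
    h2, ← ENNReal.ofReal_mul (by positivity),
    ← ENNReal.ofReal_add (by positivity) (by positivity), ← ENNReal.ofReal_mul (by positivity),
    ENNReal.ofReal_le_ofReal_iff (by positivity)] at h
  exact h

end CutFEM

namespace CutFEM

/-! ### The exterior normal field -/

section Normal

variable {d : ℕ} {Ω : Set (E d)}

theorem IsOuterNormal.unique {x ν ν' : E d} (h : IsOuterNormal Ω x ν) (h' : IsOuterNormal Ω x ν') :
    ν = ν' := by
  by_contra hne
  set w := ν - ν' with hw
  have hw0 : 0 < ‖w‖ := norm_pos_iff.2 (sub_ne_zero.2 hne)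
  have h1 : inner ℝ ν w = ‖w‖ ^ 2 / 2 := by
    have : ‖w‖ ^ 2 = ‖ν‖ ^ 2 - 2 * inner ℝ ν ν' + ‖ν'‖ ^ 2 := norm_sub_sq_real ν ν'
    rw [hw, inner_sub_right, real_inner_self_eq_norm_sq, ← hw, this, h.1, h'.1]; ring
  have h2 : inner ℝ ν' w = -(‖w‖ ^ 2 / 2) := by
    have : ‖w‖ ^ 2 = ‖ν‖ ^ 2 - 2 * inner ℝ ν ν' + ‖ν'‖ ^ 2 := norm_sub_sq_real ν ν'
    rw [hw, inner_sub_right, real_inner_self_eq_norm_sq, ← hw, this, h.1, h'.1, real_inner_comm]; ring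
  -- In direction w both normals have slope of size ‖w‖²/2, with opposite signs, which exceeds ε‖w‖
  -- = ‖w‖²/4. Hence short steps along w are forced both out of Ω and into Ω.
  have hε : 0 < ‖w‖ / 4 := by positivity
  have ht : Tendsto (fun t : ℝ => x + t • w) (𝓝[>] 0) (𝓝 x) := by
    have : Tendsto (fun t : ℝ => x + t • w) (𝓝 0) (𝓝 (x + (0:ℝ) • w)) :=
      (by fun_prop : Continuous fun t : ℝ => x + t • w).tendsto 0
    rw [zero_smul, add_zero] at this
    exact this.mono_left nhdsWithin_le_nhds
  obtain ⟨t, ⟨ht1, ht2⟩, ht0⟩ := ((ht.eventually ((h.2 _ hε).and (h'.2 _ hε))).and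
    (eventually_mem_nhdsWithin)).exists
  have ht0 : 0 < t := ht0
  rw [add_sub_cancel_left, norm_smul, Real.norm_eq_abs, abs_of_pos ht0, real_inner_smul_right] at ht1 ht2
  refine ht1.2 ?_ (ht2.1 ?_)
  · rw [h1]; nlinarith [mul_pos ht0 (pow_pos hw0 2)]
  · rw [h2]; nlinarith [mul_pos ht0 (pow_pos hw0 2)]

theorem outerNormal_spec {x : E d} (h : ∃ ν, IsOuterNormal Ω x ν) :
    IsOuterNormal Ω x (outerNormal Ω x) := by
  rw [outerNormal, dif_pos h]; exact h.choose_spec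

theorem outerNormal_of_not {x : E d} (h : ¬ ∃ ν, IsOuterNormal Ω x ν) : outerNormal Ω x = 0 := by
  rw [outerNormal, dif_neg h]

theorem norm_outerNormal_le (x : E d) : ‖outerNormal Ω x‖ ≤ 1 := by
  by_cases h : ∃ ν, IsOuterNormal Ω x ν
  · exact (outerNormal_spec h).1.le
  · simp [outerNormal_of_not h]

/-- For fixed ε and δ the condition is closed, whatever Ω is: each y imposes an implication between
strict inequalities continuous in (x, ν). Countably many ε and δ suffice. -/
theorem measurableSet_isOuterNormal (Ω : Set (E d)) :
    MeasurableSet {p : E d × E d | IsOuterNormal Ω p.1 p.2} := by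
  let Cl : ℝ → ℝ → Set (E d × E d) := fun ε δ => {p | ∀ y, dist y p.1 < δ →
    (inner ℝ p.2 (y - p.1) < -ε * ‖y - p.1‖ → y ∈ Ω) ∧ (inner ℝ p.2 (y - p.1) > ε * ‖y - p.1‖ → y ∉ Ω)}
  have hCl : ∀ ε δ, IsClosed (Cl ε δ) := by
    intro ε δ
    have : Cl ε δ = ⋂ y, {p | dist y p.1 < δ →
      (inner ℝ p.2 (y - p.1) < -ε * ‖y - p.1‖ → y ∈ Ω) ∧
        (inner ℝ p.2 (y - p.1) > ε * ‖y - p.1‖ → y ∉ Ω)} := by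
      ext p; simp [Cl]
    rw [this]
    refine isClosed_iInter fun y => ?_
    have hc1 : Continuous fun p : E d × E d => dist y p.1 := by fun_prop
    have hc2 : Continuous fun p : E d × E d => inner ℝ p.2 (y - p.1) := by fun_prop
    have hc3 : ∀ ε : ℝ, Continuous fun p : E d × E d => ε * ‖y - p.1‖ := fun ε => by fun_prop
    rw [← isOpen_compl_iff]
    by_cases hy : y ∈ Ω
    · convert (isOpen_lt hc1 (continuous_const (y := δ))).inter (isOpen_lt (hc3 ε) hc2) using 1
      ext p
      simp [hy]
    · convert (isOpen_lt hc1 (continuous_const (y := δ))).inter (isOpen_lt hc2 (hc3 (-ε))) using 1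
      ext p
      simp [hy]
  have heq : {p : E d × E d | IsOuterNormal Ω p.1 p.2} = {p | ‖p.2‖ = 1} ∩
      ⋂ n : ℕ, ⋃ l : ℕ, Cl (1 / ((n:ℝ) + 1)) (1 / ((l:ℝ) + 1)) := by
    ext ⟨x, ν⟩
    simp only [IsOuterNormal, Set.mem_ofPred_eq, Set.mem_inter_iff, Set.mem_iInter, Set.mem_iUnion]
    refine and_congr_right fun _ => ⟨fun H n => ?_, fun H ε hε => ?_⟩
    · obtain ⟨δ, hδ, hball⟩ := Metric.eventually_nhds_iff.1 (H _ (Nat.one_div_pos_of_nat (n := n)))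
      obtain ⟨l, hl⟩ := exists_nat_one_div_lt hδ
      exact ⟨l, fun y hy => hball (lt_trans hy hl)⟩
    · obtain ⟨n, hn⟩ := exists_nat_one_div_lt hε
      obtain ⟨l, hl⟩ := H n
      refine Metric.eventually_nhds_iff.2 ⟨_, Nat.one_div_pos_of_nat (n := l), fun y hy => ?_⟩
      have h1 := hl y hy
      have h2 : 1 / ((n:ℝ) + 1) * ‖y - x‖ ≤ ε * ‖y - x‖ := by gcongr
      exact ⟨fun h3 => h1.1 (by simp only; linarith), fun h3 => h1.2 (by simp only; linarith)⟩
  rw [heq]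
  refine MeasurableSet.inter ?_ (MeasurableSet.iInter fun n => MeasurableSet.iUnion fun l =>
    (hCl _ _).measurableSet)
  exact (isClosed_eq (by fun_prop) continuous_const).measurableSet

/-- The pairs of point and normal form a Borel set on which, by uniqueness, the first projection is
injective. The Lusin–Souslin theorem then makes its images Borel. -/
theorem measurable_outerNormal (Ω : Set (E d)) : Measurable (outerNormal Ω) := by
  have hinj : ∀ B : Set (E d), Set.InjOn Prod.fst
      ({p : E d × E d | IsOuterNormal Ω p.1 p.2} ∩ Prod.snd ⁻¹' B) := by
    rintro B ⟨x, ν⟩ ⟨h, -⟩ ⟨x', ν'⟩ ⟨h', -⟩ (rfl : x = x')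
    exact Prod.ext rfl (IsOuterNormal.unique h h')
  have himg : ∀ B : Set (E d), MeasurableSet B → MeasurableSet (Prod.fst ''
      ({p : E d × E d | IsOuterNormal Ω p.1 p.2} ∩ Prod.snd ⁻¹' B)) := fun B hB =>
    ((measurableSet_isOuterNormal Ω).inter (measurable_snd hB)).image_of_measurable_injOn
      measurable_fst (hinj B)
  intro B hB
  have h1 : outerNormal Ω ⁻¹' B = (Prod.fst ''
      ({p : E d × E d | IsOuterNormal Ω p.1 p.2} ∩ Prod.snd ⁻¹' B)) ∪
      ((Prod.fst '' ({p : E d × E d | IsOuterNormal Ω p.1 p.2} ∩ Prod.snd ⁻¹' Set.univ))ᶜ ∩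
        {_x | (0 : E d) ∈ B}) := by
    ext x
    by_cases h : ∃ ν, IsOuterNormal Ω x ν
    · have hs := outerNormal_spec h
      have hmem : x ∈ Prod.fst '' ({p : E d × E d | IsOuterNormal Ω p.1 p.2} ∩
          Prod.snd ⁻¹' Set.univ) := ⟨(x, outerNormal Ω x), ⟨hs, trivial⟩, rfl⟩
      constructor
      · intro hx
        exact Or.inl ⟨(x, outerNormal Ω x), ⟨hs, hx⟩, rfl⟩
      · rintro (⟨⟨x', ν⟩, ⟨hν, hB'⟩, rfl⟩ | ⟨hx, -⟩)
        · have : outerNormal Ω x' = ν := hs.unique hν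
          show outerNormal Ω x' ∈ B
          rw [this]; exact hB'
        · exact absurd hmem hx
    · have hnot : ∀ B', x ∉ Prod.fst '' ({p : E d × E d | IsOuterNormal Ω p.1 p.2} ∩
          Prod.snd ⁻¹' B') := by
        rintro B' ⟨⟨x', ν⟩, ⟨hν, -⟩, rfl⟩
        exact h ⟨ν, hν⟩
      constructor
      · intro hx
        refine Or.inr ⟨hnot _, ?_⟩
        have hx : outerNormal Ω x ∈ B := hx
        rwa [outerNormal_of_not h] at hx
      · rintro (hx | ⟨-, hx⟩)
        · exact absurd hx (hnot _)
        · show outerNormal Ω x ∈ B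
          rw [outerNormal_of_not h]; exact hx
  rw [h1]
  exact (himg B hB).union ((himg _ MeasurableSet.univ).compl.inter (MeasurableSet.const _))

/-- Moving from a boundary point against the exterior normal leads into the domain. -/
theorem eventually_sub_outerNormal_mem (hΩ : IsClosed Ω) {x : E d} (hx : x ∈ frontier Ω) :
    ∀ᶠ t in 𝓝[>] (0 : ℝ), x + t • (-outerNormal Ω x) ∈ Ω := by
  by_cases h : ∃ ν, IsOuterNormal Ω x ν
  · have hs := outerNormal_spec h
    set n := outerNormal Ω x
    have ht : Tendsto (fun t : ℝ => x + t • (-n)) (𝓝[>] 0) (𝓝 x) := by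
      have : Tendsto (fun t : ℝ => x + t • (-n)) (𝓝 0) (𝓝 (x + (0:ℝ) • (-n))) :=
        (by fun_prop : Continuous fun t : ℝ => x + t • (-n)).tendsto 0
      rw [zero_smul, add_zero] at this
      exact this.mono_left nhdsWithin_le_nhds
    filter_upwards [ht.eventually (hs.2 (1 / 2) (by norm_num)), eventually_mem_nhdsWithin] with t h1 h0
    have h0 : 0 < t := h0
    refine h1.1 ?_
    rw [add_sub_cancel_left, norm_smul, Real.norm_eq_abs, abs_of_pos h0, real_inner_smul_right,
      inner_neg_right, real_inner_self_eq_norm_sq, norm_neg, hs.1]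
    linarith
  -- With the default value zero the ray is constant, and x itself lies in the closed set Ω.
  · rw [outerNormal_of_not h]
    simpa using hΩ.frontier_subset hx

end Normal

/-! ### One-sided derivatives of finite element functions -/

section Ray

variable {d k : ℕ} {M : Mesh d} {Ω : Set (E d)} {v w : E d → ℝ}

/-- A short enough initial segment contained in a mesh is contained in a single element. -/
theorem exists_cell_of_eventually {F : Set (Finset (E d))} (hF : F.Finite) {x e : E d}
    (h : ∀ᶠ t in 𝓝[>] (0 : ℝ), x + t • e ∈ ⋃ T ∈ F, cell T) :
    ∃ T ∈ F, x ∈ cell T ∧ ∃ δ : ℝ, 0 < δ ∧ ∀ t ∈ Set.Icc (0 : ℝ) δ, x + t • e ∈ cell T := by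
  -- Pigeonhole over finitely many cells: one contains ray points arbitrarily close to x. Closedness
  -- gives x, and convexity fills in the segment.
  obtain ⟨T, hT, hfreq⟩ : ∃ T ∈ F, ∃ᶠ t in 𝓝[>] (0 : ℝ), x + t • e ∈ cell T := by
    by_contra! hcon
    have h1 : ∀ᶠ t in 𝓝[>] (0 : ℝ), ∀ T ∈ F, x + t • e ∉ cell T :=
      (hF.eventually_all).2 fun T hT => hcon T hT
    obtain ⟨t, ht1, ht2⟩ := (h.and h1).exists
    obtain ⟨T, hT, hmem⟩ := Set.mem_iUnion₂.1 ht1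
    exact ht2 T hT hmem
  have hxT : x ∈ cell T := by
    have ht : Tendsto (fun t : ℝ => x + t • e) (𝓝[>] 0) (𝓝 x) := by
      have : Tendsto (fun t : ℝ => x + t • e) (𝓝 0) (𝓝 (x + (0:ℝ) • e)) :=
        (by fun_prop : Continuous fun t : ℝ => x + t • e).tendsto 0
      rw [zero_smul, add_zero] at this
      exact this.mono_left nhdsWithin_le_nhds
    exact (isCompact_cell T).isClosed.mem_of_frequently_of_tendsto hfreq ht
  obtain ⟨δ, hδ, hδ0⟩ := (hfreq.and_eventually eventually_mem_nhdsWithin).exists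
  have hδ0 : 0 < δ := hδ0
  refine ⟨T, hT, hxT, δ, hδ0, fun t ht => ?_⟩
  have := (convex_cell T).add_smul_mem hxT hδ (t := t / δ)
    ⟨div_nonneg ht.1 hδ0.le, (div_le_one hδ0).2 ht.2⟩
  rwa [smul_smul, div_mul_cancel₀ _ hδ0.ne'] at this

theorem hasDerivWithinAt_ray (hv : v ∈ M.activeSpace Ω k) {T : Finset (E d)} (hT : T ∈ M.active Ω)
    {x e : E d} {δ : ℝ} (hδ : 0 < δ) (hseg : ∀ t ∈ Set.Icc (0 : ℝ) δ, x + t • e ∈ cell T) :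
    HasDerivWithinAt (fun t : ℝ => v (x + t • e)) (inner ℝ (gradient (polyExt k T v) x) e)
      (Set.Ici 0) 0 := by
  have hp := Mesh.polyExt_spec hv hT
  have h1 : HasDerivAt (fun t : ℝ => polyExt k T v (x + t • e))
      (inner ℝ (gradient (polyExt k T v) x) e) 0 := by
    have h2 : HasDerivAt (fun t : ℝ => x + t • e) e 0 := by
      simpa using ((hasDerivAt_id (0:ℝ)).smul_const e).const_add x
    have h3 := (differentiable_of_mem_polySpace hp.1 (x + (0:ℝ) • e)).hasFDerivAt.comp_hasDerivAt
      (0 : ℝ) h2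
    rw [zero_smul, add_zero] at h3
    rw [gradient, InnerProductSpace.toDual_symm_apply]
    exact h3
  refine (h1.hasDerivWithinAt (s := Set.Ici 0)).congr_of_eventuallyEq ?_
    (hp.2 (hseg 0 ⟨le_rfl, hδ.le⟩))
  filter_upwards [Icc_mem_nhdsGE hδ] with t ht
  exact hp.2 (hseg t ht)

/-- The normal derivative at a boundary point is the trace of the gradient from one active element,
which does not depend on the function. -/
theorem exists_normalDeriv_eq (hΩc : IsClosed Ω) (hΩ : Ω ⊆ M.complex.space) {x : E d}
    (hx : x ∈ frontier Ω) : ∃ T ∈ M.active Ω, x ∈ cell T ∧ ∀ v ∈ M.activeSpace Ω k,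
      normalDeriv Ω v x = inner ℝ (gradient (polyExt k T v) x) (outerNormal Ω x) ∧
      HasDerivWithinAt (fun t : ℝ => v (x - t • outerNormal Ω x)) (-normalDeriv Ω v x)
        (Set.Ici 0) 0 := by
  obtain ⟨T, hT, hxT, δ, hδ, hseg⟩ := exists_cell_of_eventually (M.finite_active Ω)
    ((eventually_sub_outerNormal_mem hΩc hx).mono fun t ht => Mesh.subset_activeDomain hΩ ht)
  refine ⟨T, hT, hxT, fun v hv => ?_⟩
  have h1 := hasDerivWithinAt_ray hv hT hδ hseg
  have h2 : (fun t : ℝ => v (x + t • (-outerNormal Ω x))) =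
      fun t : ℝ => v (x - t • outerNormal Ω x) := by
    ext t; rw [smul_neg, sub_eq_add_neg]
  rw [h2] at h1
  have h3 : -normalDeriv Ω v x = inner ℝ (gradient (polyExt k T v) x) (-outerNormal Ω x) := by
    rw [normalDeriv, neg_neg]
    exact h1.derivWithin (uniqueDiffOn_Ici (0:ℝ) 0 Set.self_mem_Ici)
  refine ⟨?_, by rwa [h3]⟩
  rw [inner_neg_right] at h3
  linarith

theorem aestronglyMeasurable_normalDeriv (hΩc : IsClosed Ω) (hΩ : Ω ⊆ M.complex.space)
    (hv : v ∈ M.activeSpace Ω k) :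
    AEStronglyMeasurable (normalDeriv Ω v) (surfaceMeasure Ω) := by
  have hvm := Mesh.measurable_of_mem_activeSpace hv
  let t : ℕ → ℝ := fun n => 1 / ((n:ℝ) + 1)
  -- Measurable difference quotients with steps t n ↓ 0, converging at every boundary point.
  let f : ℕ → E d → ℝ := fun n x => -((t n)⁻¹ * (v (x - t n • outerNormal Ω x) - v x))
  have hfm : ∀ n, AEMeasurable (f n) (surfaceMeasure Ω) := by
    intro n
    refine Measurable.aemeasurable ?_
    refine Measurable.neg (Measurable.const_mul (Measurable.sub (hvm.comp ?_) hvm) _)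
    exact measurable_id.sub ((measurable_outerNormal Ω).const_smul (t n))
  refine (aemeasurable_of_tendsto_metrizable_ae atTop hfm ?_).aestronglyMeasurable
  filter_upwards [ae_surfaceMeasure_mem Ω] with x hx
  obtain ⟨T, -, -, H⟩ := exists_normalDeriv_eq (k := k) hΩc hΩ hx
  have h1 := (H v hv).2
  have h2 := (hasDerivWithinAt_iff_tendsto_slope'
    (s := Set.Ioi (0:ℝ)) (by simp)).1 (h1.mono Set.Ioi_subset_Ici_self)
  have ht : Tendsto t atTop (𝓝[>] 0) := by
    refine tendsto_nhdsWithin_iff.2 ⟨tendsto_one_div_add_atTop_nhds_zero_nat, ?_⟩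
    exact Eventually.of_forall fun n => (Nat.one_div_pos_of_nat : 0 < 1 / ((n:ℝ) + 1))
  have h3 := (h2.comp ht).neg
  rw [neg_neg] at h3
  refine h3.congr fun n => ?_
  simp [f, slope, Function.comp]

theorem normalDeriv_add (hΩc : IsClosed Ω) (hΩ : Ω ⊆ M.complex.space) {x : E d}
    (hx : x ∈ frontier Ω) (hv : v ∈ M.activeSpace Ω k) (hw : w ∈ M.activeSpace Ω k) :
    normalDeriv Ω (v + w) x = normalDeriv Ω v x + normalDeriv Ω w x := by
  obtain ⟨T, -, -, H⟩ := exists_normalDeriv_eq (k := k) hΩc hΩ hx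
  have h1 := (H v hv).2.add (H w hw).2
  have h2 := h1.derivWithin (uniqueDiffOn_Ici (0:ℝ) 0 Set.self_mem_Ici)
  rw [normalDeriv]
  have h3 : (fun t : ℝ => (v + w) (x - t • outerNormal Ω x)) =
    (fun t : ℝ => v (x - t • outerNormal Ω x)) + fun t : ℝ => w (x - t • outerNormal Ω x) := rfl
  rw [h3, h2]; ring

theorem normalDeriv_smul (hΩc : IsClosed Ω) (hΩ : Ω ⊆ M.complex.space) {x : E d}
    (hx : x ∈ frontier Ω) (hv : v ∈ M.activeSpace Ω k) (c : ℝ) :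
    normalDeriv Ω (c • v) x = c * normalDeriv Ω v x := by
  obtain ⟨T, -, -, H⟩ := exists_normalDeriv_eq (k := k) hΩc hΩ hx
  have h1 := (H v hv).2.const_mul c
  have h2 := h1.derivWithin (uniqueDiffOn_Ici (0:ℝ) 0 Set.self_mem_Ici)
  rw [normalDeriv]
  have h3 : (fun t : ℝ => (c • v) (x - t • outerNormal Ω x)) =
    (fun t : ℝ => c * v (x - t • outerNormal Ω x)) := rfl
  rw [h3, h2]; ring

end Ray

end CutFEM

/-! ### Friedrichs' inequality for V_h and the inverse trace estimate -/

namespace CutFEM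

section

variable {d k : ℕ} {M : Mesh d} {Ω : Set (E d)} {v : E d → ℝ}

/-- The largest gradient at a point of the polynomials from the adjacent active elements. -/
def maxGrad (M : Mesh d) (Ω : Set (E d)) (k : ℕ) (v : E d → ℝ) (x : E d) : NNReal :=
  (M.finite_active Ω).toFinset.sup fun T =>
    (cell T).indicator (fun y => ‖gradient (polyExt k T v) y‖₊) x

theorem le_maxGrad {T : Finset (E d)} (hT : T ∈ M.active Ω) {x : E d} (hx : x ∈ cell T) :
    ‖gradient (polyExt k T v) x‖ ≤ maxGrad M Ω k v x := by
  have h := Finset.le_sup (f := fun T => (cell T).indicator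
    (fun y => ‖gradient (polyExt k T v) y‖₊) x) ((M.finite_active Ω).mem_toFinset.2 hT)
  simp only [Set.indicator_of_mem hx] at h
  exact_mod_cast h

theorem maxGrad_le {x : E d} {B : ℝ} (hB0 : 0 ≤ B)
    (hB : ∀ T ∈ M.active Ω, x ∈ cell T → ‖gradient (polyExt k T v) x‖ ≤ B) :
    (maxGrad M Ω k v x : ℝ) ≤ B := by
  lift B to NNReal using hB0
  rw [NNReal.coe_le_coe, maxGrad]
  refine Finset.sup_le fun T hT => ?_
  by_cases hx : x ∈ cell T
  · rw [Set.indicator_of_mem hx]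
    exact_mod_cast hB T ((M.finite_active Ω).mem_toFinset.1 hT) hx
  · rw [Set.indicator_of_notMem hx]; exact zero_le

theorem measurable_maxGrad : Measurable (maxGrad M Ω k v) := by
  have : maxGrad M Ω k v = (M.finite_active Ω).toFinset.sup fun T =>
      (cell T).indicator (fun y => ‖gradient (polyExt k T v) y‖₊) := by
    ext x; rw [maxGrad, Finset.sup_apply]
  rw [this]
  exact Finset.sup_induction (p := Measurable) measurable_const (fun f hf g hg => hf.sup hg)
    fun T _ => (Mesh.measurable_gradient _).nnnorm.indicator (measurableSet_cell T)

/-- Off the null set of cell boundaries, every cell containing x has it in its interior, where its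
polynomial gradient is ∇v. -/
theorem ae_maxGrad_le (hΩm : MeasurableSet Ω)
    (hv : v ∈ M.activeSpace Ω k) :
    ∀ᵐ x ∂volume.restrict Ω, (maxGrad M Ω k v x : ℝ) ≤ ‖gradient v x‖ := by
  rw [ae_restrict_iff' hΩm]
  have h1 : ∀ T ∈ M.active Ω, ∀ᵐ x : E d, x ∉ frontier (cell T) := fun T _ =>
    measure_eq_zero_iff_ae_notMem.1 ((convex_cell T).addHaar_frontier volume)
  filter_upwards [(ae_ball_iff (M.finite_active Ω).countable).2 h1] with x hx hxΩ
  refine maxGrad_le (norm_nonneg _) fun T hT hxT => ?_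
  have h2 := hx T hT
  rw [(isCompact_cell T).isClosed.frontier_eq] at h2
  have h3 : x ∈ interior (cell T) := by
    by_contra hni
    exact h2 ⟨hxT, hni⟩
  rw [Mesh.gradient_eq_of_mem_interior hv hT h3]

end

namespace Discretization

variable {d k N : ℕ} {Ω : Set (E d)} {γ ρ : ℝ}

/-- Friedrichs' inequality for finite element functions. -/
theorem exists_friedrichs (hd : 1 ≤ d) (hΩ : IsLipschitzDomain Ω) :
    ∃ C > 0, ∀ (γ : ℝ) (D : Discretization d k Ω γ), ∀ v ∈ D.V,
      ∫ x in Ω, v x ^ 2 ≤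
        C * ((∫ x in Ω, ‖gradient v x‖ ^ 2) + ∫ y, v y ^ 2 ∂surfaceMeasure Ω) := by
  obtain ⟨m, rfl⟩ : ∃ m, d = m + 1 := ⟨d - 1, by omega⟩
  have := hΩ.isFiniteMeasure_surfaceMeasure hd
  obtain ⟨R, hR⟩ := hΩ.isCompact.isBounded.subset_closedBall 0
  set R' := max R 1 with hR'
  have hR'0 : 0 < R' := by positivity
  refine ⟨2 * R' * (4 * R' + 2), by positivity, fun γ D v hv => ?_⟩
  have hΩm := hΩ.isCompact.measurableSet
  have hcov := Mesh.subset_activeDomain D.covers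
  obtain ⟨B, hB0, hB⟩ := Mesh.exists_gradient_bound hv
  -- The gradient of v itself need not bound one-sided derivatives on mesh faces, where v may have a
  -- kink. The maximum over adjacent cells does, at every point.
  have h := setIntegral_sq_le (v := v) (g := fun x => maxGrad D.mesh Ω k v x) (B := B) (R := R')
    hΩ.isCompact ((Mesh.continuousOn_of_mem_activeSpace hv).mono hcov)
    (Mesh.measurable_of_mem_activeSpace hv) measurable_maxGrad.coe_nnreal_real
    (fun x => NNReal.coe_nonneg _) (fun x => maxGrad_le hB0 fun T hT hx => hB T hT x hx) ?_ hR'0 ?_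
  · have h2 : ∫ x in Ω, (maxGrad D.mesh Ω k v x : ℝ) ^ 2 ≤ ∫ x in Ω, ‖gradient v x‖ ^ 2 := by
      refine integral_mono_of_nonneg (ae_of_all _ fun _ => sq_nonneg _)
        (Mesh.integrable_norm_gradient_sq hΩ.isCompact D.covers hv) ?_
      filter_upwards [ae_maxGrad_le hΩm hv] with x hx
      exact pow_le_pow_left₀ (NNReal.coe_nonneg _) hx 2
    refine h.trans ?_
    rw [mul_assoc (2 * R')]
    refine mul_le_mul_of_nonneg_left ?_ (by positivity)
    have n1 : 0 ≤ ∫ y, v y ^ 2 ∂surfaceMeasure Ω := integral_nonneg fun _ => sq_nonneg _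
    have n2 : 0 ≤ ∫ x in Ω, ‖gradient v x‖ ^ 2 := integral_nonneg fun _ => sq_nonneg _
    nlinarith [mul_le_mul_of_nonneg_left h2 hR'0.le, mul_nonneg hR'0.le n1]
  · intro x hx hev
    obtain ⟨T, hT, hxT, δ, hδ, hseg⟩ := exists_cell_of_eventually (D.mesh.finite_active Ω)
      (hev.mono fun t ht => hcov ht)
    refine ⟨_, ?_, (hasDerivWithinAt_ray hv hT hδ hseg).mono Set.Ioi_subset_Ici_self⟩
    refine (abs_real_inner_le_norm _ _).trans ?_
    simpa using le_maxGrad hT hxT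
  · intro x hx
    have h1 := hR hx
    rw [mem_closedBall_zero_iff] at h1
    exact (PiLp.norm_apply_le x 0).trans (h1.trans (le_max_left _ _))

theorem abs_normalDeriv_le {D : Discretization d k Ω γ} (hΩc : IsClosed Ω) {v : E d → ℝ}
    (hv : v ∈ D.V) {x : E d}
    (hx : x ∈ frontier Ω) : |normalDeriv Ω v x| ≤ maxGrad D.mesh Ω k v x := by
  obtain ⟨T, hT, hxT, H⟩ := exists_normalDeriv_eq (k := k) hΩc D.covers hx
  rw [(H v hv).1]
  refine (abs_real_inner_le_norm _ _).trans ((mul_le_of_le_one_right (norm_nonneg _)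
    (norm_outerNormal_le x)).trans (le_maxGrad hT hxT))

theorem maxGrad_sq_le (D : Discretization d k Ω γ) (v : E d → ℝ) (x : E d) :
    (maxGrad D.mesh Ω k v x : ℝ) ^ 2 ≤ ∑ T ∈ (D.mesh.finite_active Ω).toFinset,
      (cell T).indicator (fun y => ‖gradient (polyExt k T v) y‖ ^ 2) x := by
  have h0 : ∀ T ∈ (D.mesh.finite_active Ω).toFinset,
      0 ≤ (cell T).indicator (fun y => ‖gradient (polyExt k T v) y‖ ^ 2) x := fun T _ =>
    Set.indicator_nonneg (fun _ _ => sq_nonneg _) _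
  have h1 := maxGrad_le (M := D.mesh) (Ω := Ω) (k := k) (v := v) (x := x) (B := Real.sqrt
    (∑ T ∈ (D.mesh.finite_active Ω).toFinset,
      (cell T).indicator (fun y => ‖gradient (polyExt k T v) y‖ ^ 2) x)) (Real.sqrt_nonneg _)
    fun T hT hxT => Real.le_sqrt_of_sq_le (by
      refine le_trans (le_of_eq ?_) (Finset.single_le_sum h0 ((D.mesh.finite_active Ω).mem_toFinset.2 hT))
      rw [Set.indicator_of_mem hxT])
  calc _ ≤ _ := pow_le_pow_left₀ (NNReal.coe_nonneg _) h1 2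
    _ = _ := Real.sq_sqrt (Finset.sum_nonneg h0)

/-- The normal derivative on the boundary is controlled by the energy on the active mesh. -/
theorem exists_normalDeriv_bound (k : ℕ) (hd : 1 ≤ d) (hΩ : IsLipschitzDomain Ω) (hρ : 0 < ρ) :
    ∃ C > 0, ∀ (γ : ℝ) (D : Discretization d k Ω γ), D.mesh.IsQuasiUniform D.h ρ → ∀ v ∈ D.V,
      D.h * ∫ x, normalDeriv Ω v x ^ 2 ∂surfaceMeasure Ω ≤
        C * ∑ T ∈ (D.mesh.finite_active Ω).toFinset, energy k T v := by
  have hfin := hΩ.isFiniteMeasure_surfaceMeasure hd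
  have hω := ballVolume_pos d
  obtain ⟨C, hC0, hC⟩ := exists_scaled_bounds d k 1 (ballVolume d * ρ ^ d) (by positivity)
  obtain ⟨Cs, hCs0, hCs⟩ := hΩ.exists_surface_bound hd
  refine ⟨C * Cs, by positivity, fun γ D hM v hv => ?_⟩
  have hh := D.h_pos
  set A := (D.mesh.finite_active Ω).toFinset with hA
  have hcell : ∀ T ∈ A, ∀ x ∈ cell T, ‖gradient (polyExt k T v) x‖ ^ 2 ≤
      C * energy k T v / D.h ^ d := by
    intro T hT x hx
    have hT' := (D.mesh.finite_active Ω).mem_toFinset.1 hT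
    have := (hC D.h x (cell T) hh (measurableSet_cell T)
      (by rw [one_mul]; exact hM.cell_subset_closedBall hT'.1 hx) (hM.le_volume_cell hh hρ hT'.1) _
      (Mesh.polyExt_spec hv hT').1 x (Metric.mem_closedBall_self (by positivity))).2.2
    rw [le_div_iff₀ (by positivity), mul_comm]
    exact this
  have hE0 : ∀ T, 0 ≤ C * energy k T v / D.h ^ d := fun T => by
    have := energy_nonneg (k := k) T v; positivity
  have hpt : ∀ᵐ x ∂surfaceMeasure Ω, normalDeriv Ω v x ^ 2 ≤
      ∑ T ∈ A, (cell T).indicator (fun _ => C * energy k T v / D.h ^ d) x := by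
    filter_upwards [ae_surfaceMeasure_mem Ω] with x hx
    have h1 := abs_normalDeriv_le hΩ.isCompact.isClosed hv hx
    calc _ = |normalDeriv Ω v x| ^ 2 := (sq_abs _).symm
      _ ≤ _ := pow_le_pow_left₀ (abs_nonneg _) h1 2
      _ ≤ _ := D.maxGrad_sq_le v x
      _ ≤ _ := Finset.sum_le_sum fun T hT => Set.indicator_le_indicator' (hcell T hT x)
  have hint : ∀ T ∈ A, Integrable ((cell T).indicator (fun _ => C * energy k T v / D.h ^ d))
      (surfaceMeasure Ω) := fun T _ => (integrable_const _).indicator (measurableSet_cell T)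
  have h1 : ∫ x, normalDeriv Ω v x ^ 2 ∂surfaceMeasure Ω ≤
      ∑ T ∈ A, C * energy k T v / D.h ^ d * (Cs * D.h ^ (d - 1)) := by
    refine (integral_mono_of_nonneg (ae_of_all _ fun _ => sq_nonneg _)
      (integrable_finsetSum _ hint) hpt).trans ?_
    rw [integral_finsetSum _ hint]
    refine Finset.sum_le_sum fun T hT => ?_
    have hT' := (D.mesh.finite_active Ω).mem_toFinset.1 hT
    rw [integral_indicator (measurableSet_cell T), setIntegral_const, smul_eq_mul, mul_comm]
    refine mul_le_mul_of_nonneg_left ?_ (hE0 T)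
    obtain ⟨x, hx⟩ := Mesh.nonempty_of_mem_elements hT'.1
    exact ENNReal.toReal_le_of_le_ofReal (by positivity) ((measure_mono
      (hM.cell_subset_closedBall hT'.1 (subset_cell T hx))).trans (hCs x D.h hh))
  -- The factor h compensates the missing dimension of the boundary, and h^d cancels the scaling of
  -- the pointwise gradient bound.
  have h2 : D.h * D.h ^ (d - 1) = D.h ^ d := by
    rw [← pow_succ']; congr 1; omega
  calc _ ≤ D.h * ∑ T ∈ A, C * energy k T v / D.h ^ d * (Cs * D.h ^ (d - 1)) :=
        mul_le_mul_of_nonneg_left h1 hh.le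
    _ = C * Cs * ∑ T ∈ A, energy k T v := by
      rw [Finset.mul_sum, Finset.mul_sum]
      refine Finset.sum_congr rfl fun T _ => ?_
      have : D.h ^ d ≠ 0 := by positivity
      calc _ = C * energy k T v / D.h ^ d * Cs * (D.h * D.h ^ (d - 1)) := by ring
        _ = _ := by rw [h2]; field_simp

end Discretization

end CutFEM

/-! ### Abstract penalty limit in finite dimension -/

namespace CutFEM

section Limit

variable {V : Type*} [AddCommGroup V] [Module ℝ V] [FiniteDimensional ℝ V]

/-- A positive definite form on a finite-dimensional space represents every linear functional. -/
theorem exists_apply_eq_of_pos (b : V →ₗ[ℝ] V →ₗ[ℝ] ℝ) (hb : ∀ v, v ≠ 0 → 0 < b v v)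
    (F : V →ₗ[ℝ] ℝ) : ∃ u, ∀ v, b u v = F v := by
  have hinj : Function.Injective b := by
    rw [injective_iff_map_eq_zero]
    intro v hv
    by_contra hne
    have := hb v hne
    rw [hv] at this
    simp at this
  obtain ⟨u, hu⟩ := (LinearMap.injective_iff_surjective_of_finrank_eq_finrank
    (Subspace.dual_finrank_eq (K := ℝ) (V := V)).symm).1 hinj F
  exact ⟨u, fun v => by rw [hu]⟩

/-- The range of a symmetric form consists of all functionals that vanish on its kernel. -/
theorem exists_apply_eq_of_ker (s : V →ₗ[ℝ] V →ₗ[ℝ] ℝ) (hs : ∀ v w, s v w = s w v)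
    (R : V →ₗ[ℝ] ℝ) (hR : ∀ v, s v = 0 → R v = 0) : ∃ w, ∀ v, R v = s w v := by
  have hle : LinearMap.range s ≤ (LinearMap.ker s).dualAnnihilator := by
    rintro _ ⟨w, rfl⟩
    rw [Submodule.mem_dualAnnihilator]
    intro v hv
    rw [hs, LinearMap.mem_ker.1 hv, LinearMap.zero_apply]
  have h1 := LinearMap.finrank_range_add_finrank_ker s
  have h2 := Subspace.finrank_add_finrank_dualAnnihilator_eq (LinearMap.ker s)
  have heq := Submodule.eq_of_le_of_finrank_eq hle
    (Nat.add_right_cancel (h1.trans (h2.symm.trans (add_comm _ _))))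
  have hmem : R ∈ LinearMap.range s := by
    rw [heq, Submodule.mem_dualAnnihilator]
    exact fun v hv => hR v hv
  obtain ⟨w, hw⟩ := hmem
  exact ⟨w, fun v => by rw [hw]⟩

/-- The penalty limit: the solutions of `a(u,v) + τ s(u,v) = F(v)` converge, as `τ → ∞`, to an
element of the kernel of `s`. -/
theorem exists_penalty_limit (a s : V →ₗ[ℝ] V →ₗ[ℝ] ℝ) (ha : ∀ v w, a v w = a w v)
    (hs : ∀ v w, s v w = s w v) (hs0 : ∀ v, 0 ≤ s v v) (τ₀ : ℝ)
    (hpos : ∀ v, v ≠ 0 → 0 < a v v + τ₀ * s v v) (F : V →ₗ[ℝ] ℝ) (u : ℝ → V)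
    (hu : ∀ τ, τ₀ ≤ τ → ∀ v, a (u τ) v + τ * s (u τ) v = F v) :
    ∃ u' : V, s u' = 0 ∧ ∀ ℓ : V →ₗ[ℝ] ℝ, Tendsto (fun τ => ℓ (u τ)) atTop (𝓝 (ℓ u')) := by
  set b : V →ₗ[ℝ] V →ₗ[ℝ] ℝ := a + τ₀ • s with hbdef
  have hb : ∀ v w, b v w = a v w + τ₀ * s v w := fun v w => by simp [hbdef]
  have hb0 : ∀ v, v ≠ 0 → 0 < b v v := fun v hv => by rw [hb]; exact hpos v hv
  have hbnn : ∀ v, 0 ≤ b v v := fun v => by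
    rcases eq_or_ne v 0 with rfl | hv
    · simp
    · exact (hb0 v hv).le
  have hbs : ∀ v w, b v w = b w v := fun v w => by rw [hb, hb, ha, hs]
  set K := LinearMap.ker s with hK
  -- The candidate limit solves the problem restricted to ker s, where the value of τ no longer
  -- matters.
  obtain ⟨u', hu'⟩ := exists_apply_eq_of_pos (V := K) (b.domRestrict₁₂ K K)
    (fun v hv => by
      rw [LinearMap.domRestrict₁₂_apply]
      exact hb0 v (by simpa using hv)) (F.domRestrict K)
  have hsu : s (u' : V) = 0 := LinearMap.mem_ker.1 u'.2
  -- The residual vanishes on ker s, hence is represented by s. The element w acts as a Lagrange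
  -- multiplier and yields a rate.
  obtain ⟨w, hw⟩ := exists_apply_eq_of_ker s hs (F - b u') (fun v hv => by
    have := hu' ⟨v, LinearMap.mem_ker.2 hv⟩
    rw [LinearMap.domRestrict₁₂_apply, LinearMap.domRestrict_apply] at this
    simp only [LinearMap.sub_apply]
    linarith)
  have hsw : 0 ≤ s w w := hs0 w
  have hmain : ∀ τ, τ₀ < τ → b (u τ - u') (u τ - u') ≤ s w w / (4 * (τ - τ₀)) := by
    intro τ hτ
    set e := u τ - u' with he
    have ht : 0 < τ - τ₀ := sub_pos.2 hτ
    have h1 : b e e + (τ - τ₀) * s e e = s w e := by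
      have h2 := hu τ hτ.le e
      have h3 := hw e
      have h4 : s (u τ) e = s e e := by rw [he, map_sub s (u τ), hsu, sub_zero]
      have h5 : b e e = b (u τ) e - b u' e := by rw [he]; simp
      have h6 := hb (u τ) e
      simp only [LinearMap.sub_apply] at h3
      rw [h4] at h6 h2
      linarith
    -- Young's inequality for s: s(w,e) ≤ (τ-τ₀) s(e,e) + s(w,w)/(4(τ-τ₀)), whose first term cancels
    -- against the penalty.
    have h7 := hs0 (w - (2 * (τ - τ₀)) • e)
    simp only [map_sub, map_smul, LinearMap.sub_apply, LinearMap.smul_apply, smul_eq_mul] at h7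
    rw [hs e w] at h7
    rw [le_div_iff₀ (by positivity)]
    nlinarith
  refine ⟨u', hsu, fun ℓ => ?_⟩
  -- Representing ℓ by b lets Cauchy–Schwarz for b turn energy convergence into convergence of ℓ,
  -- with no norm on V.
  obtain ⟨z, hz⟩ := exists_apply_eq_of_pos b hb0 ℓ
  have hlim : Tendsto (fun τ : ℝ => Real.sqrt (b z z * (s w w / (4 * (τ - τ₀))))) atTop (𝓝 0) := by
    have h1 : Tendsto (fun τ : ℝ => 4 * (τ - τ₀)) atTop atTop :=
      (tendsto_atTop_add_const_right _ (-τ₀) tendsto_id).const_mul_atTop (by norm_num)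
    have h2 := ((h1.const_div_atTop (s w w)).const_mul (b z z)).sqrt
    simpa using h2
  rw [tendsto_iff_norm_sub_tendsto_zero]
  refine squeeze_zero' (Eventually.of_forall fun _ => norm_nonneg _) ?_ hlim
  filter_upwards [eventually_gt_atTop τ₀] with τ hτ
  rw [Real.norm_eq_abs]
  refine Real.abs_le_sqrt ?_
  rw [← map_sub, ← hz]
  refine (LinearMap.BilinForm.apply_sq_le_of_symm b hbnn ⟨fun v w => hbs v w⟩ z _).trans ?_
  exact mul_le_mul_of_nonneg_left (hmain τ hτ) (hbnn z)

end Limit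

section Uniform

variable {X κ : Type*} [Fintype κ]

/-- Linear combinations of bounded functions converge uniformly if their coefficients converge. -/
theorem tendstoUniformly_sum {g : κ → X → ℝ} (hg : ∀ i, ∃ B, ∀ x, |g i x| ≤ B) {l : Filter ℝ}
    {c : ℝ → κ → ℝ} {c' : κ → ℝ} (hc : ∀ i, Tendsto (fun τ => c τ i) l (𝓝 (c' i))) :
    TendstoUniformly (fun τ => ∑ i, c τ i • g i) (∑ i, c' i • g i) l := by
  choose B hB using hg
  rw [Metric.tendstoUniformly_iff]
  intro ε hε
  have hlim : Tendsto (fun τ => ∑ i, |c' i - c τ i| * B i) l (𝓝 0) := by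
    have : Tendsto (fun τ => ∑ i, |c' i - c τ i| * B i) l (𝓝 (∑ i, |c' i - c' i| * B i)) :=
      tendsto_finsetSum _ fun i _ => ((tendsto_const_nhds.sub (hc i)).abs).mul_const _
    simpa using this
  filter_upwards [hlim.eventually (gt_mem_nhds hε)] with τ hτ x
  refine lt_of_le_of_lt ?_ hτ
  rw [Real.dist_eq, Finset.sum_apply, Finset.sum_apply, ← Finset.sum_sub_distrib]
  refine (Finset.abs_sum_le_sum_abs _ _).trans (Finset.sum_le_sum fun i _ => ?_)
  simp only [Pi.smul_apply, smul_eq_mul]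
  rw [← sub_mul, abs_mul]
  exact mul_le_mul_of_nonneg_left (hB i x) (abs_nonneg _)

end Uniform

end CutFEM

/-! ### The forms and the load as linear maps on V_h -/

namespace CutFEM

namespace Discretization

variable {d k : ℕ} {Ω : Set (E d)} {γ ρ : ℝ} {D : Discretization d k Ω γ} {v w v' f : E d → ℝ}

theorem integrable_normalDeriv_mul (hd : 1 ≤ d) (hΩ : IsLipschitzDomain Ω) (hv : v ∈ D.V)
    (hw : w ∈ D.V) : Integrable (fun x => normalDeriv Ω v x * w x) (surfaceMeasure Ω) := by
  have := hΩ.isFiniteMeasure_surfaceMeasure hd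
  obtain ⟨B, hB0, hB⟩ := Mesh.exists_gradient_bound hv
  obtain ⟨B', hB'⟩ := Mesh.exists_abs_le_of_mem_activeSpace hw
  refine Integrable.of_bound ((aestronglyMeasurable_normalDeriv hΩ.isCompact.isClosed D.covers
    hv).mul (Mesh.measurable_of_mem_activeSpace hw).aestronglyMeasurable) (B * B') ?_
  filter_upwards [ae_surfaceMeasure_mem Ω] with x hx
  rw [norm_mul, Real.norm_eq_abs, Real.norm_eq_abs]
  exact mul_le_mul ((abs_normalDeriv_le hΩ.isCompact.isClosed hv hx).trans
    (maxGrad_le hB0 fun T hT hxT => hB T hT x hxT)) (hB' x) (abs_nonneg _) hB0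

theorem integrable_normalDeriv_sq (hd : 1 ≤ d) (hΩ : IsLipschitzDomain Ω) (hv : v ∈ D.V) :
    Integrable (fun x => normalDeriv Ω v x ^ 2) (surfaceMeasure Ω) := by
  have := hΩ.isFiniteMeasure_surfaceMeasure hd
  obtain ⟨B, hB0, hB⟩ := Mesh.exists_gradient_bound hv
  refine Integrable.of_bound ((aestronglyMeasurable_normalDeriv hΩ.isCompact.isClosed D.covers
    hv).pow 2) (B ^ 2) ?_
  filter_upwards [ae_surfaceMeasure_mem Ω] with x hx
  rw [norm_pow, Real.norm_eq_abs]
  exact pow_le_pow_left₀ (abs_nonneg _) ((abs_normalDeriv_le hΩ.isCompact.isClosed hv hx).trans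
    (maxGrad_le hB0 fun T hT hxT => hB T hT x hxT)) 2

theorem memLp_of_mem (μ : Measure (E d)) [IsFiniteMeasure μ] (hv : v ∈ D.V) : MemLp v 2 μ := by
  obtain ⟨B, hB⟩ := Mesh.exists_abs_le_of_mem_activeSpace hv
  exact MemLp.of_bound (Mesh.measurable_of_mem_activeSpace hv).aestronglyMeasurable B
    (ae_of_all _ hB)

theorem integrable_boundary_mul (hd : 1 ≤ d) (hΩ : IsLipschitzDomain Ω) (hv : v ∈ D.V)
    (hw : w ∈ D.V) : Integrable (fun x => v x * w x) (surfaceMeasure Ω) := by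
  have := hΩ.isFiniteMeasure_surfaceMeasure hd
  exact (memLp_of_mem _ hv).integrable_mul (memLp_of_mem _ hw)

theorem integrable_data_mul (hΩ : IsCompact Ω) (hf : MemLp f 2 (volume.restrict Ω))
    (hv : v ∈ D.V) : Integrable (fun x => f x * v x) (volume.restrict Ω) := by
  have : IsFiniteMeasure (volume.restrict Ω) := ⟨by simpa using hΩ.measure_lt_top⟩
  exact hf.integrable_mul (memLp_of_mem _ hv)

theorem nitsche_comm (β : ℝ) (v w : E d → ℝ) : D.nitsche β v w = D.nitsche β w v := by
  simp only [nitsche, mul_comm (v _), mul_comm (normalDeriv Ω v _), real_inner_comm (gradient w _)]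
  ring

theorem nitsche_add (hd : 1 ≤ d) (hΩ : IsLipschitzDomain Ω) (β : ℝ) (hv : v ∈ D.V)
    (hv' : v' ∈ D.V) (hw : w ∈ D.V) :
    D.nitsche β (v + v') w = D.nitsche β v w + D.nitsche β v' w := by
  have hc := hΩ.isCompact
  have hm := hc.measurableSet
  have h1 : ∫ x in Ω, inner ℝ (gradient (v + v') x) (gradient w x) =
      (∫ x in Ω, inner ℝ (gradient v x) (gradient w x)) +
        ∫ x in Ω, inner ℝ (gradient v' x) (gradient w x) := by
    rw [← integral_add (Mesh.integrable_inner_gradient hc D.covers hv hw)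
      (Mesh.integrable_inner_gradient hc D.covers hv' hw)]
    refine integral_congr_ae ?_
    filter_upwards [Mesh.ae_differentiableAt hm D.covers hv,
      Mesh.ae_differentiableAt hm D.covers hv'] with x hx hx'
    simp only [← inner_add_left, gradient, fderiv_add hx hx', map_add]
  have h2 : ∫ x, normalDeriv Ω (v + v') x * w x ∂surfaceMeasure Ω =
      (∫ x, normalDeriv Ω v x * w x ∂surfaceMeasure Ω) +
        ∫ x, normalDeriv Ω v' x * w x ∂surfaceMeasure Ω := by
    rw [← integral_add (integrable_normalDeriv_mul hd hΩ hv hw)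
      (integrable_normalDeriv_mul hd hΩ hv' hw)]
    refine integral_congr_ae ?_
    filter_upwards [ae_surfaceMeasure_mem Ω] with x hx
    rw [normalDeriv_add hc.isClosed D.covers hx hv hv', add_mul]
  have h3 : ∫ x, (v + v') x * normalDeriv Ω w x ∂surfaceMeasure Ω =
      (∫ x, v x * normalDeriv Ω w x ∂surfaceMeasure Ω) +
        ∫ x, v' x * normalDeriv Ω w x ∂surfaceMeasure Ω := by
    rw [← integral_add ((integrable_normalDeriv_mul hd hΩ hw hv).congr
      (ae_of_all _ fun x => mul_comm _ _)) ((integrable_normalDeriv_mul hd hΩ hw hv').congr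
      (ae_of_all _ fun x => mul_comm _ _))]
    simp only [Pi.add_apply, add_mul]
  have h4 : ∫ x, (v + v') x * w x ∂surfaceMeasure Ω =
      (∫ x, v x * w x ∂surfaceMeasure Ω) + ∫ x, v' x * w x ∂surfaceMeasure Ω := by
    rw [← integral_add (integrable_boundary_mul hd hΩ hv hw)
      (integrable_boundary_mul hd hΩ hv' hw)]
    simp only [Pi.add_apply, add_mul]
  simp only [nitsche, h1, h2, h3, h4]
  ring

theorem nitsche_smul (hΩ : IsLipschitzDomain Ω) (β c : ℝ) (hv : v ∈ D.V) :
    D.nitsche β (c • v) w = c * D.nitsche β v w := by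
  have hc := hΩ.isCompact
  have h1 : ∫ x in Ω, inner ℝ (gradient (c • v) x) (gradient w x) =
      c * ∫ x in Ω, inner ℝ (gradient v x) (gradient w x) := by
    rw [← integral_const_mul]
    refine integral_congr_ae ?_
    filter_upwards [Mesh.ae_differentiableAt hc.measurableSet D.covers hv] with x hx
    simp only [← real_inner_smul_left, gradient, fderiv_const_smul hx, map_smul]
  have h2 : ∫ x, normalDeriv Ω (c • v) x * w x ∂surfaceMeasure Ω =
      c * ∫ x, normalDeriv Ω v x * w x ∂surfaceMeasure Ω := by
    rw [← integral_const_mul]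
    refine integral_congr_ae ?_
    filter_upwards [ae_surfaceMeasure_mem Ω] with x hx
    rw [normalDeriv_smul hc.isClosed D.covers hx hv, mul_assoc]
  simp only [nitsche, h1, h2, Pi.smul_apply, smul_eq_mul, mul_assoc c, integral_const_mul]
  ring

/-- The Nitsche form as a bilinear form on the finite element space. -/
def nitscheForm (D : Discretization d k Ω γ) (hd : 1 ≤ d) (hΩ : IsLipschitzDomain Ω) (β : ℝ) :
    D.V →ₗ[ℝ] D.V →ₗ[ℝ] ℝ :=
  LinearMap.mk₂ ℝ (fun v w => D.nitsche β v w)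
    (fun v v' w => nitsche_add hd hΩ β v.2 v'.2 w.2)
    (fun c v _ => nitsche_smul hΩ β c v.2)
    (fun v w w' => by
      rw [nitsche_comm, nitsche_comm β (v : E d → ℝ) w, nitsche_comm β (v : E d → ℝ) w']
      exact nitsche_add hd hΩ β w.2 w'.2 v.2)
    (fun c v w => by
      rw [nitsche_comm, nitsche_comm β (v : E d → ℝ) w]
      exact nitsche_smul hΩ β c w.2)

/-- The load functional on the finite element space. -/
def load (D : Discretization d k Ω γ) (hΩ : IsCompact Ω) (hf : MemLp f 2 (volume.restrict Ω)) :
    D.V →ₗ[ℝ] ℝ where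
  toFun v := ∫ x in Ω, f x * (v : E d → ℝ) x
  map_add' v w := by
    rw [← integral_add (integrable_data_mul hΩ hf v.2) (integrable_data_mul hΩ hf w.2)]
    simp [mul_add]
  map_smul' c v := by
    rw [RingHom.id_apply, smul_eq_mul, ← integral_const_mul]
    simp [mul_left_comm]

variable {κ : Type} [Finite κ] {ψ : Module.Basis κ ℝ (polySpace d k)}

theorem dof_add (hM : D.mesh.IsQuasiUniform D.h ρ) (hρ : 0 < ρ) (hA : D.IsAffineFamily ψ)
    {T : Finset (E d)} (hT : T ∈ D.mesh.active Ω) {p q : E d → ℝ} (hp : p ∈ polySpace d k)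
    (hq : q ∈ polySpace d k) {i : D.ι} (hi : i ∈ D.localIdx T) :
    D.dof T i (p + q) = D.dof T i p + D.dof T i q := by
  rw [dof_poly hM hρ hA hT hp hi, dof_poly hM hρ hA hT hq hi]
  refine dof_eq (c := fun j => D.polyCoeff hp j + D.polyCoeff hq j) hM hρ hA hT (fun x hx => ?_) hi
  rw [Pi.add_apply, sum_polyCoeff hp hT hx, sum_polyCoeff hq hT hx]
  simp [add_mul, Finset.sum_add_distrib]

theorem dof_smul (hM : D.mesh.IsQuasiUniform D.h ρ) (hρ : 0 < ρ) (hA : D.IsAffineFamily ψ)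
    {T : Finset (E d)} (hT : T ∈ D.mesh.active Ω) {p : E d → ℝ} (hp : p ∈ polySpace d k) (c : ℝ)
    {i : D.ι} (hi : i ∈ D.localIdx T) :
    D.dof T i (c • p) = c * D.dof T i p := by
  rw [dof_poly hM hρ hA hT hp hi]
  refine dof_eq (c := fun j => c * D.polyCoeff hp j) hM hρ hA hT (fun x hx => ?_) hi
  rw [Pi.smul_apply, sum_polyCoeff hp hT hx]
  simp [Finset.mul_sum, mul_assoc]

theorem jump_mem (hv : v ∈ D.V) {i : D.ι} (hi : i ∈ D.smallIdx) :
    jump k (D.node i) (D.S (D.node i)) v ∈ polySpace d k :=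
  sub_mem (Mesh.polyExt_spec hv (D.node_mem i)).1 (Mesh.polyExt_spec hv (S_node_mem hi)).1

/-- The stabilization functional as a linear functional on the finite element space. -/
def jumpForm (hM : D.mesh.IsQuasiUniform D.h ρ) (hρ : 0 < ρ) (hA : D.IsAffineFamily ψ)
    {i : D.ι} (hi : i ∈ D.smallIdx) : D.V →ₗ[ℝ] ℝ where
  toFun v := D.jumpDof v i
  map_add' v w := by
    rw [jumpDof, jumpDof, jumpDof, ← dof_add hM hρ hA (D.node_mem i) (jump_mem v.2 hi)
      (jump_mem w.2 hi) (D.node_subset i), Submodule.coe_add, jump, jump, jump,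
      hM.polyExt_add D.h_pos hρ v.2 w.2 (D.node_mem i),
      hM.polyExt_add D.h_pos hρ v.2 w.2 (S_node_mem hi)]
    congr 1
    abel
  map_smul' c v := by
    rw [jumpDof, jumpDof, RingHom.id_apply, smul_eq_mul, ← dof_smul hM hρ hA (D.node_mem i)
      (jump_mem v.2 hi) c (D.node_subset i), Submodule.coe_smul, jump, jump,
      hM.polyExt_smul D.h_pos hρ v.2 c (D.node_mem i),
      hM.polyExt_smul D.h_pos hρ v.2 c (S_node_mem hi), smul_sub]

open Classical in
/-- The stabilization form for `τ = 1` as a bilinear form on the finite element space. -/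
def stabForm (hM : D.mesh.IsQuasiUniform D.h ρ) (hρ : 0 < ρ) (hA : D.IsAffineFamily ψ) :
    D.V →ₗ[ℝ] D.V →ₗ[ℝ] ℝ :=
  ∑ i : {i // i ∈ D.smallIdx}, (D.h ^ ((d : ℤ) - 2)) •
    (jumpForm hM hρ hA i.2).smulRight (jumpForm hM hρ hA i.2)

open Classical in
theorem stabForm_apply (hM : D.mesh.IsQuasiUniform D.h ρ) (hρ : 0 < ρ) (hA : D.IsAffineFamily ψ)
    (v w : D.V) : stabForm hM hρ hA v w =
      ∑ i with i ∈ D.smallIdx, D.h ^ ((d : ℤ) - 2) * (D.jumpDof v i * D.jumpDof w i) := by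
  rw [stabForm, LinearMap.sum_apply, LinearMap.sum_apply,
    Finset.sum_subtype (p := fun i => i ∈ D.smallIdx) _ (by simp)]
  rfl

theorem mul_stabForm (hM : D.mesh.IsQuasiUniform D.h ρ) (hρ : 0 < ρ) (hA : D.IsAffineFamily ψ)
    (τ : ℝ) (v w : D.V) : τ * stabForm hM hρ hA v w = D.stab τ v w := by
  rw [stabForm_apply, Finset.mul_sum]
  refine Finset.sum_congr rfl fun i _ => ?_
  rw [jumpDof, jumpDof]
  ring

theorem stabForm_self (hM : D.mesh.IsQuasiUniform D.h ρ) (hρ : 0 < ρ) (hA : D.IsAffineFamily ψ)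
    (v : D.V) : stabForm hM hρ hA v v = D.stabSq v := by
  rw [stabForm_apply]
  refine Finset.sum_congr rfl fun i _ => ?_
  rw [sq_abs, sq]

theorem stabForm_comm (hM : D.mesh.IsQuasiUniform D.h ρ) (hρ : 0 < ρ) (hA : D.IsAffineFamily ψ)
    (v w : D.V) : stabForm hM hρ hA v w = stabForm hM hρ hA w v := by
  simp only [stabForm_apply, mul_comm (D.jumpDof (v : E d → ℝ) _)]

end Discretization

end CutFEM

/-! ### Coercivity, definiteness, and the correction by jumps -/

namespace CutFEM

namespace Discretization

variable {d k : ℕ} {Ω : Set (E d)} {γ ρ : ℝ} {D : Discretization d k Ω γ} {v f : E d → ℝ}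

/-- Half of the boundary penalty pays for the v-part of the consistency terms. The normal derivative
part costs (2 Cn/β)(G + s), which is at most G/2 if β ≥ 4 Cn and at most τ s/2 if τ ≥ 4 Cn/β in the
respective terms. -/
theorem coercive_aux {G B A X s h β Cn τ : ℝ} (hh : 0 < h) (hβ : 0 < β) (hβn : 4 * Cn ≤ β)
    (hτ : 4 * Cn / β ≤ τ) (hG : 0 ≤ G) (hs : 0 ≤ s) (hA : h * A ≤ Cn * (G + s))
    (hX : 2 * X ≤ 2 * h / β * A + β / (2 * h) * B) :
    G / 2 + β / (2 * h) * B + τ / 2 * s ≤ G - X - X + β * h⁻¹ * B + τ * s := by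
  have h1 : 2 * h / β * A ≤ 2 / β * (Cn * (G + s)) := by
    calc _ = 2 / β * (h * A) := by ring
      _ ≤ _ := mul_le_mul_of_nonneg_left hA (by positivity)
  have h2 : 2 / β * Cn ≤ 1 / 2 := by
    rw [div_mul_eq_mul_div, div_le_iff₀ hβ]; linarith
  have h3 : 2 / β * Cn ≤ τ / 2 := by
    have : 2 / β * Cn = 4 * Cn / β / 2 := by ring
    rw [this]; linarith
  have h4 : 2 / β * (Cn * (G + s)) = 2 / β * Cn * G + 2 / β * Cn * s := by ring
  have h5 := mul_le_mul_of_nonneg_right h2 hG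
  have h6 := mul_le_mul_of_nonneg_right h3 hs
  have h7 : β * h⁻¹ * B = β / (2 * h) * B + β / (2 * h) * B := by
    field_simp; ring
  linarith

/-- Coercivity of the stabilized Nitsche form. -/
theorem nitsche_coercive (hd : 1 ≤ d) (hΩ : IsLipschitzDomain Ω) (hv : v ∈ D.V) {β Cn τ : ℝ}
    (hβ : 0 < β) (hβn : 4 * Cn ≤ β) (hτ : 4 * Cn / β ≤ τ)
    (hA : D.h * ∫ x, normalDeriv Ω v x ^ 2 ∂surfaceMeasure Ω ≤
      Cn * ((∫ x in Ω, ‖gradient v x‖ ^ 2) + D.stabSq v)) :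
    (∫ x in Ω, ‖gradient v x‖ ^ 2) / 2 + β / (2 * D.h) * (∫ x, v x ^ 2 ∂surfaceMeasure Ω) +
      τ / 2 * D.stabSq v ≤ D.nitsche β v v + τ * D.stabSq v := by
  have hh := D.h_pos
  have hX : 2 * ∫ x, normalDeriv Ω v x * v x ∂surfaceMeasure Ω ≤
      2 * D.h / β * (∫ x, normalDeriv Ω v x ^ 2 ∂surfaceMeasure Ω) +
        β / (2 * D.h) * ∫ x, v x ^ 2 ∂surfaceMeasure Ω := by
    have i1 := integrable_normalDeriv_mul hd hΩ hv hv
    have i2 := integrable_normalDeriv_sq hd hΩ hv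
    have i3 : Integrable (fun x => v x ^ 2) (surfaceMeasure Ω) := by
      simpa only [sq] using integrable_boundary_mul hd hΩ hv hv
    rw [← integral_const_mul, ← integral_const_mul, ← integral_const_mul,
      ← integral_add (i2.const_mul _) (i3.const_mul _)]
    refine integral_mono (i1.const_mul _) ((i2.const_mul _).add (i3.const_mul _)) fun x => ?_
    have h0 : 0 ≤ β / (2 * D.h) * (v x - 2 * D.h / β * normalDeriv Ω v x) ^ 2 := by positivity
    have h1 : β / (2 * D.h) * (v x - 2 * D.h / β * normalDeriv Ω v x) ^ 2 =
        2 * D.h / β * normalDeriv Ω v x ^ 2 + β / (2 * D.h) * v x ^ 2 -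
          2 * (normalDeriv Ω v x * v x) := by
      field_simp; ring
    show 2 * (normalDeriv Ω v x * v x) ≤ _
    linarith
  have h := coercive_aux hh hβ hβn hτ (integral_nonneg fun _ => sq_nonneg _)
    (D.stabSq_nonneg v) hA hX
  refine h.trans (le_of_eq ?_)
  simp only [nitsche, real_inner_self_eq_norm_sq, mul_comm (v _) (normalDeriv Ω v _), ← sq]

variable {κ : Type} [Finite κ] {ψ : Module.Basis κ ℝ (polySpace d k)}

theorem jumpDof_eq_zero_of_stabSq (h : D.stabSq v = 0) {i : D.ι} (hi : i ∈ D.smallIdx) :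
    D.jumpDof v i = 0 := by
  classical
  have hh := D.h_pos
  rw [stabSq, Finset.sum_eq_zero_iff_of_nonneg fun _ _ => by positivity] at h
  have := h i (by simpa using hi)
  simpa [(zpow_pos hh _).ne'] using this

/-- A finite element function that vanishes in `Ω` and whose stabilization vanishes is zero. -/
theorem eq_zero_of_stabSq (hM : D.mesh.IsQuasiUniform D.h ρ) (hρ : 0 < ρ) (hA : D.IsAffineFamily ψ)
    (hγ : 0 < γ) (hΩ : IsCompact Ω) (hv : v ∈ D.V) (h0 : ∫ x in Ω, v x ^ 2 = 0)
    (hs : D.stabSq v = 0) : v = 0 := by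
  have hfin : IsFiniteMeasure (volume.restrict Ω) := ⟨by simpa using hΩ.measure_lt_top⟩
  have hae : ∀ᵐ x ∂volume.restrict Ω, v x = 0 := by
    have h1 := (integral_eq_zero_iff_of_nonneg (fun _ => sq_nonneg _)
      (memLp_of_mem (volume.restrict Ω) hv).integrable_sq).1 h0
    filter_upwards [h1] with x hx
    exact pow_eq_zero_iff two_ne_zero |>.1 hx
  -- A large element meets Ω in positive volume, where the polynomial vanishes almost everywhere.
  have hlarge : ∀ T ∈ D.mesh.large Ω γ, polyExt k T v = 0 := by
    intro T hT
    have hspec := Mesh.polyExt_spec hv hT.1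
    have hvol : volume (cell T ∩ Ω) ≠ 0 := by
      refine (lt_of_lt_of_le ?_ hT.2).ne'
      exact ENNReal.mul_pos (ENNReal.ofReal_pos.2 hγ).ne' (hM.volume_cell_ne_zero D.h_pos hρ hT.1.1)
    refine eq_of_eqOn_of_volume_ne_zero hspec.1 (zero_mem _) (A := {x ∈ cell T ∩ Ω | v x = 0}) ?_
      fun x hx => by rw [← hspec.2 hx.1.1, hx.2]; rfl
    rw [ae_restrict_iff' hΩ.measurableSet] at hae
    rwa [measure_congr (t := cell T ∩ Ω)]
    filter_upwards [hae] with x hx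
    exact propext ⟨fun h => h.1, fun h => ⟨h, hx h.2⟩⟩
  have hcoeff : ∀ i, D.coeff hv i = 0 := by
    intro i
    by_cases hi : i ∈ D.smallIdx
    · have h1 := jumpDof_eq hM hρ hA hv hi
      have h2 : D.dof (D.node i) i 0 = 0 := by
        rw [dof_eq (c := fun _ => 0) hM hρ hA (D.node_mem i) (by simp [Set.eqOn_refl])
          (D.node_subset i)]
      rw [jumpDof_eq_zero_of_stabSq hs hi, ← dof_poly hM hρ hA (D.node_mem i)
        (Mesh.polyExt_spec hv (S_node_mem hi)).1 (D.node_subset i),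
        hlarge _ (D.S_mem _ (node_mem_small hi)), h2] at h1
      linarith
    · simp only [smallIdx, Set.mem_ofPred_eq, not_forall, not_not] at hi
      obtain ⟨T, hT, hi⟩ := hi
      rw [← dof_polyExt hM hρ hA hT.1 hv hi, hlarge T hT,
        dof_eq (c := fun _ => 0) hM hρ hA hT.1 (by simp [Set.eqOn_refl]) hi]
  rw [← sum_coeff hv]
  simp [hcoeff]

open Classical in
/-- The discrete extension operator corrects the degrees of freedom by the jumps. -/
theorem extOp_eq (hM : D.mesh.IsQuasiUniform D.h ρ) (hρ : 0 < ρ) (hA : D.IsAffineFamily ψ)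
    (hv : v ∈ D.V) : D.extOp v =
      ∑ i, (D.coeff hv i - if i ∈ D.smallIdx then D.jumpDof v i else 0) • D.shape i := by
  rw [extOp, ← Finset.sum_filter_add_sum_filter_not Finset.univ (· ∈ D.smallIdx)
    (fun i => (D.coeff hv i - if i ∈ D.smallIdx then D.jumpDof v i else 0) • D.shape i)]
  congr 1
  · refine Finset.sum_congr rfl fun i hi => ?_
    have hi : i ∈ D.smallIdx := by simpa using hi
    rw [if_pos hi, jumpDof_eq hM hρ hA hv hi, dof_poly hM hρ hA (D.node_mem i)
      (Mesh.polyExt_spec hv (S_node_mem hi)).1 (D.node_subset i), sub_sub_cancel]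
  · refine Finset.sum_congr rfl fun i hi => ?_
    have hi : i ∉ D.smallIdx := by simpa using hi
    rw [if_neg hi, dof_of_mem hM hρ hA (D.node_mem i) hv (D.node_subset i), sub_zero]

/-- Identifies the left-hand side of the second claim with the stabilization seminorm. -/
theorem dof_sub_extOp (hM : D.mesh.IsQuasiUniform D.h ρ) (hρ : 0 < ρ) (hA : D.IsAffineFamily ψ)
    (hv : v ∈ D.V) {i : D.ι} (hi : i ∈ D.smallIdx) :
    D.dof (D.node i) i (v - D.extOp v) = D.jumpDof v i := by
  classical
  have := dof_eq (p := v - D.extOp v) (c := fun j => if j ∈ D.smallIdx then D.jumpDof v j else 0)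
    hM hρ hA (D.node_mem i) (fun x _ => ?_) (D.node_subset i)
  · rw [this, if_pos hi]
  · rw [extOp_eq hM hρ hA hv, Pi.sub_apply, ← congrFun (sum_coeff hv) x]
    simp only [Finset.sum_apply, Pi.smul_apply, smul_eq_mul, ← Finset.sum_sub_distrib, ← sub_mul,
      sub_sub_cancel]

end Discretization

end CutFEM

/-! ### Positive definiteness and the a priori bound -/

namespace CutFEM

namespace Discretization

variable {d k : ℕ} {Ω : Set (E d)} {γ ρ : ℝ} {D : Discretization d k Ω γ} {v u f : E d → ℝ}
  {κ : Type} [Finite κ] {ψ : Module.Basis κ ℝ (polySpace d k)}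

theorem nitsche_add_stabSq_pos (hd : 1 ≤ d) (hΩ : IsLipschitzDomain Ω) (hγ : 0 < γ)
    (hM : D.mesh.IsQuasiUniform D.h ρ) (hρ : 0 < ρ) (hA : D.IsAffineFamily ψ) {β Cn CF τ : ℝ}
    (hCn : 0 < Cn) (hβn : 4 * Cn ≤ β) (hτ : 4 * Cn / β ≤ τ) (hv : v ∈ D.V) (hne : v ≠ 0)
    (hB : D.h * ∫ x, normalDeriv Ω v x ^ 2 ∂surfaceMeasure Ω ≤
      Cn * ((∫ x in Ω, ‖gradient v x‖ ^ 2) + D.stabSq v))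
    (hF : ∫ x in Ω, v x ^ 2 ≤
      CF * ((∫ x in Ω, ‖gradient v x‖ ^ 2) + ∫ y, v y ^ 2 ∂surfaceMeasure Ω)) :
    0 < D.nitsche β v v + τ * D.stabSq v := by
  have hβ : 0 < β := by linarith
  have hτ0 : 0 < τ := lt_of_lt_of_le (by positivity) hτ
  have hh := D.h_pos
  have h1 := nitsche_coercive hd hΩ hv hβ hβn hτ hB
  have hG : 0 ≤ ∫ x in Ω, ‖gradient v x‖ ^ 2 := integral_nonneg fun _ => sq_nonneg _
  have hb : 0 ≤ ∫ x, v x ^ 2 ∂surfaceMeasure Ω := integral_nonneg fun _ => sq_nonneg _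
  have hs := D.stabSq_nonneg v
  have hb' : 0 ≤ β / (2 * D.h) * ∫ x, v x ^ 2 ∂surfaceMeasure Ω := by positivity
  have hs' : 0 ≤ τ / 2 * D.stabSq v := by positivity
  by_contra hneg
  have hG0 : ∫ x in Ω, ‖gradient v x‖ ^ 2 = 0 := by linarith
  have hb0 : ∫ x, v x ^ 2 ∂surfaceMeasure Ω = 0 :=
    (mul_eq_zero.1 (show β / (2 * D.h) * _ = 0 by linarith)).resolve_left (by positivity)
  have hs0 : D.stabSq v = 0 :=
    (mul_eq_zero.1 (show τ / 2 * _ = 0 by linarith)).resolve_left (by positivity)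
  rw [hG0, hb0, add_zero, mul_zero] at hF
  exact hne (eq_zero_of_stabSq hM hρ hA hγ hΩ.isCompact hv
    (le_antisymm hF (integral_nonneg fun _ => sq_nonneg _)) hs0)

theorem isSolution_iff (hd : 1 ≤ d) (hΩ : IsLipschitzDomain Ω)
    (hM : D.mesh.IsQuasiUniform D.h ρ) (hρ : 0 < ρ) (hA : D.IsAffineFamily ψ)
    (hf : MemLp f 2 (volume.restrict Ω)) {β τ : ℝ} (u : D.V) :
    D.IsSolution β τ f u ↔ ∀ v : D.V, nitscheForm D hd hΩ β u v + τ * stabForm hM hρ hA u v =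
      load D hΩ.isCompact hf v := by
  simp only [mul_stabForm]
  exact ⟨fun h v => h.2 v v.2, fun h => ⟨u.2, fun v hv => h ⟨v, hv⟩⟩⟩

/-- The stabilization seminorm of the solution decays with the stabilization parameter. -/
theorem stabSq_le_of_isSolution (hd : 1 ≤ d) (hΩ : IsLipschitzDomain Ω)
    (hM : D.mesh.IsQuasiUniform D.h ρ) (hρ : 0 < ρ) (hA : D.IsAffineFamily ψ)
    (hf : MemLp f 2 (volume.restrict Ω)) {β h₀ Cn CF τ : ℝ} (hh₀ : D.h ≤ h₀)
    (hCn : 0 < Cn) (hCF : 0 < CF) (hβn : 4 * Cn ≤ β) (hτ : 4 * Cn / β ≤ τ)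
    (hu : D.IsSolution β τ f u)
    (hB : D.h * ∫ x, normalDeriv Ω u x ^ 2 ∂surfaceMeasure Ω ≤
      Cn * ((∫ x in Ω, ‖gradient u x‖ ^ 2) + D.stabSq u))
    (hF : ∫ x in Ω, u x ^ 2 ≤
      CF * ((∫ x in Ω, ‖gradient u x‖ ^ 2) + ∫ y, u y ^ 2 ∂surfaceMeasure Ω)) :
    D.stabSq u ≤ CF * (2 + 2 * h₀ / (4 * Cn)) / 2 / τ * ∫ x in Ω, f x ^ 2 := by
  have hβ : 0 < β := by linarith
  have hτ0 : 0 < τ := lt_of_lt_of_le (by positivity) hτ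
  have hh := D.h_pos
  have hh₀' : 0 < h₀ := hh.trans_le hh₀
  have hu' := hu.1
  have hfin : IsFiniteMeasure (volume.restrict Ω) := ⟨by simpa using hΩ.isCompact.measure_lt_top⟩
  -- Chosen so that ‖u‖²_Ω ≤ C' (G/2 + β B/(2h)): the 2 serves G, and the other term serves B
  -- because β ≥ 4 Cn and h ≤ h₀. This is how h₀ enters and β drops out.
  set C' := CF * (2 + 2 * h₀ / (4 * Cn)) with hC'
  have hC'0 : 0 < C' := by positivity
  have h1 := nitsche_coercive hd hΩ hu' hβ hβn hτ hB
  have h2 : D.nitsche β u u + τ * D.stabSq u = ∫ x in Ω, f x * u x := by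
    rw [← hu.2 u hu', ← stabForm_self hM hρ hA ⟨u, hu'⟩, mul_stabForm]
  -- Weighted so that the u-part is absorbed entirely by the gradient and boundary terms, leaving
  -- (τ/2) times the stabilization seminorm below (C'/4)‖f‖².
  have h3 : ∫ x in Ω, f x * u x ≤ C' / 4 * (∫ x in Ω, f x ^ 2) + 1 / C' * ∫ x in Ω, u x ^ 2 := by
    have i1 := hf.integrable_sq.const_mul (C' / 4)
    have i2 := (memLp_of_mem (volume.restrict Ω) hu').integrable_sq.const_mul (1 / C')
    rw [← integral_const_mul, ← integral_const_mul, ← integral_add i1 i2]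
    refine integral_mono (integrable_data_mul hΩ.isCompact hf hu') (i1.add i2) fun x => ?_
    have h0 : 0 ≤ 1 / C' * (u x - C' / 2 * f x) ^ 2 := by positivity
    have h4 : 1 / C' * (u x - C' / 2 * f x) ^ 2 =
        C' / 4 * f x ^ 2 + 1 / C' * u x ^ 2 - f x * u x := by
      field_simp; ring
    show f x * u x ≤ C' / 4 * f x ^ 2 + 1 / C' * u x ^ 2
    linarith
  set G := ∫ x in Ω, ‖gradient u x‖ ^ 2
  set B := ∫ x, u x ^ 2 ∂surfaceMeasure Ω
  have hG : 0 ≤ G := integral_nonneg fun _ => sq_nonneg _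
  have hB0 : 0 ≤ B := integral_nonneg fun _ => sq_nonneg _
  have h5 : CF * (G + B) ≤ C' * (G / 2 + β / (2 * D.h) * B) := by
    have e1 : 1 ≤ (2 + 2 * h₀ / (4 * Cn)) * (β / (2 * D.h)) := by
      have : 1 ≤ 2 * h₀ / (4 * Cn) * (β / (2 * D.h)) := by
        rw [div_mul_div_comm, le_div_iff₀ (by positivity)]
        nlinarith [mul_le_mul hβn hh₀ hh.le hβ.le]
      have h6 : 0 ≤ β / (2 * D.h) := by positivity
      linarith
    have e2 : 1 ≤ (2 + 2 * h₀ / (4 * Cn)) / 2 := by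
      have : 0 ≤ 2 * h₀ / (4 * Cn) := by positivity
      linarith
    have e3 : G + B ≤ (2 + 2 * h₀ / (4 * Cn)) / 2 * G +
        (2 + 2 * h₀ / (4 * Cn)) * (β / (2 * D.h)) * B :=
      add_le_add (le_mul_of_one_le_left hG e2) (le_mul_of_one_le_left hB0 e1)
    calc _ ≤ CF * _ := mul_le_mul_of_nonneg_left e3 hCF.le
      _ = _ := by rw [hC']; ring
  have h6 : 1 / C' * ∫ x in Ω, u x ^ 2 ≤ G / 2 + β / (2 * D.h) * B := by
    rw [one_div, inv_mul_le_iff₀ hC'0]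
    exact hF.trans h5
  rw [div_mul_eq_mul_div, le_div_iff₀ hτ0]
  linarith

end Discretization

end CutFEM

end

/-! ### The main theorem -/

open Classical in
theorem mainTheorem3 (d k N : ℕ) (hd : 1 ≤ d) (hk : 1 ≤ k)
    (Ω : Set (CutFEM.E d)) (hΩ : CutFEM.IsLipschitzDomain Ω)
    (γ ρ h₀ : ℝ) (hγ : 0 < γ) (hγ' : γ ≤ 1) (hρ : 0 < ρ) (hh₀ : 0 < h₀)
    (κ : Type) (ψ : Module.Basis κ ℝ (CutFEM.polySpace d k)) :
    ∃ β₀ > 0, ∃ c₀ > 0, ∃ C > 0,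
      ∀ D : CutFEM.Discretization d k Ω γ,
        D.h ≤ h₀ → D.mesh.IsQuasiUniform D.h ρ → D.IsAffineFamily ψ →
        D.HasPaths N → D.HasLargePaths N →
        ∀ β : ℝ, β₀ ≤ β →
        ∀ f : CutFEM.E d → ℝ, MemLp f 2 (volume.restrict Ω) →
          (∀ τ : ℝ, c₀ / β ≤ τ → ∃! u, D.IsSolution β τ f u) ∧
          ∀ u : ℝ → CutFEM.E d → ℝ, (∀ τ : ℝ, c₀ / β ≤ τ → D.IsSolution β τ f (u τ)) →
            (∀ τ : ℝ, c₀ / β ≤ τ →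
              ∑ i with i ∈ D.smallIdx, D.h ^ ((d : ℤ) - 2) *
                |D.dof (D.node i) i (u τ - D.extOp (u τ))| ^ 2 ≤ C / τ * ∫ x in Ω, f x ^ 2) ∧
            ∃ uLim ∈ D.V,
              TendstoUniformly u uLim atTop ∧
              TendstoUniformly (fun τ => D.extOp (u τ)) uLim atTop ∧
              D.extOp uLim = uLim ∧
              ∀ i ∈ D.smallIdx,
                D.dof (D.node i) i uLim =
                  D.dof (D.node i) i (CutFEM.polyExt k (D.S (D.node i)) uLim) := by
  open CutFEM CutFEM.Discretization in
  have : Finite κ := Module.Finite.finite_basis ψ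
  obtain ⟨CE, hCE0, hCE⟩ := exists_energy_bound d k N hd hγ hγ' hρ ψ
  obtain ⟨Cd, hCd0, hCd⟩ := exists_normalDeriv_bound k hd hΩ hρ
  obtain ⟨CF, hCF0, hCF⟩ := exists_friedrichs (k := k) hd hΩ
  have hCn : 0 < Cd * CE := by positivity
  -- With Cn = Cd CE, the coercivity argument fixes both β₀ and c₀ as 4 Cn.
  refine ⟨4 * (Cd * CE), by positivity, 4 * (Cd * CE), by positivity,
    CF * (2 + 2 * h₀ / (4 * (Cd * CE))) / 2, by positivity,
    fun D hh hM hA hp hlp β hβ f hf => ?_⟩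
  have hB : ∀ v ∈ D.V, D.h * ∫ x, normalDeriv Ω v x ^ 2 ∂surfaceMeasure Ω ≤
      Cd * CE * ((∫ x in Ω, ‖gradient v x‖ ^ 2) + D.stabSq v) := fun v hv => by
    rw [mul_assoc]
    exact (hCd γ D hM v hv).trans
      (mul_le_mul_of_nonneg_left (hCE Ω D hΩ.isCompact hM hA hp hlp v hv) hCd0.le)
  have : FiniteDimensional ℝ D.V := Module.Finite.of_basis D.φ
  set a := nitscheForm D hd hΩ β with ha
  set s := stabForm hM hρ hA with hs
  have hpos : ∀ τ, 4 * (Cd * CE) / β ≤ τ → ∀ v : D.V, v ≠ 0 → 0 < a v v + τ * s v v := by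
    intro τ hτ v hv
    rw [hs, stabForm_self]
    exact nitsche_add_stabSq_pos hd hΩ hγ hM hρ hA hCn hβ hτ v.2 (by simpa using hv)
      (hB v v.2) (hCF γ D v v.2)
  refine ⟨fun τ hτ => ?_, fun u hu => ⟨fun τ hτ => ?_, ?_⟩⟩
  · have hpos' : ∀ v : D.V, v ≠ 0 → 0 < (a + τ • s) v v := fun v hv => by
      simpa using hpos τ hτ v hv
    obtain ⟨u, hu⟩ := exists_apply_eq_of_pos (a + τ • s) hpos' (load D hΩ.isCompact hf)
    refine ⟨u, (isSolution_iff hd hΩ hM hρ hA hf u).2 fun v => by simpa using hu v,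
      fun w (hw : D.IsSolution β τ f w) => ?_⟩
    have hw' := (isSolution_iff hd hΩ hM hρ hA hf ⟨w, hw.1⟩).1 hw
    have hzero : (⟨w, hw.1⟩ : D.V) - u = 0 := by
      by_contra hne
      refine (hpos' _ hne).ne' ?_
      rw [map_sub (a + τ • s), LinearMap.sub_apply, hu, sub_eq_zero]
      exact hw' _
    exact congrArg Subtype.val (sub_eq_zero.1 hzero)
  · rw [Finset.sum_congr rfl fun i hi => by
      rw [dof_sub_extOp hM hρ hA (hu τ hτ).1 (Finset.mem_filter.1 hi).2]]
    exact stabSq_le_of_isSolution hd hΩ hM hρ hA hf hh hCn hCF0 hβ hτ (hu τ hτ)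
      (hB _ (hu τ hτ).1) (hCF γ D _ (hu τ hτ).1)
  -- Below the threshold u is arbitrary and need not lie in V_h. The value zero is substituted
  -- there, which does not affect the limit.
  · have hex : ∀ τ, ∃ w : D.V, 4 * (Cd * CE) / β ≤ τ → u τ = w := fun τ => by
      by_cases hτ : 4 * (Cd * CE) / β ≤ τ
      · exact ⟨⟨u τ, (hu τ hτ).1⟩, fun _ => rfl⟩
      · exact ⟨0, fun h => absurd h hτ⟩
    choose w hw using hex
    obtain ⟨u', hsu, hlim⟩ := exists_penalty_limit a s
      (fun v w => nitsche_comm β (v : E d → ℝ) w) (stabForm_comm hM hρ hA)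
      (fun v => by rw [hs, stabForm_self]; exact D.stabSq_nonneg v) _ (hpos _ le_rfl)
      (load D hΩ.isCompact hf) w fun τ hτ =>
        (isSolution_iff hd hΩ hM hρ hA hf (w τ)).1 (hw τ hτ ▸ hu τ hτ)
    have hstab : D.stabSq u' = 0 := by
      rw [← stabForm_self hM hρ hA u', ← hs, hsu, LinearMap.zero_apply]
    have hjump : ∀ i ∈ D.smallIdx, D.jumpDof (u' : E d → ℝ) i = 0 := fun i hi =>
      jumpDof_eq_zero_of_stabSq hstab hi
    have hcoeff : ∀ i, Tendsto (fun τ => D.coeff (w τ).2 i) atTop (𝓝 (D.coeff u'.2 i)) := fun i =>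
      hlim (D.φ.coord i)
    -- The coefficients of Π̃_h u differ from those of u by jump functionals, which tend to their
    -- value at the limit, namely zero.
    have hcorr : ∀ i, Tendsto (fun τ => D.coeff (w τ).2 i -
        if i ∈ D.smallIdx then D.jumpDof (w τ : E d → ℝ) i else 0) atTop
        (𝓝 (D.coeff u'.2 i)) := fun i => by
      by_cases hi : i ∈ D.smallIdx
      · have h1 := (hcoeff i).sub (hlim (jumpForm hM hρ hA hi))
        have h2 : jumpForm hM hρ hA hi u' = 0 := hjump i hi
        rw [h2, sub_zero] at h1
        simp only [if_pos hi]
        exact h1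
      · simpa only [if_neg hi, sub_zero] using hcoeff i
    have hbdd : ∀ i, ∃ B, ∀ x, |D.shape i x| ≤ B := fun i =>
      Mesh.exists_abs_le_of_mem_activeSpace (shape_mem D i)
    have hext : D.extOp (u' : E d → ℝ) = u' := by
      rw [extOp_eq hM hρ hA u'.2]
      conv_rhs => rw [← sum_coeff u'.2]
      refine Finset.sum_congr rfl fun i _ => ?_
      by_cases hi : i ∈ D.smallIdx
      · rw [if_pos hi, hjump i hi, sub_zero]
      · rw [if_neg hi, sub_zero]
    refine ⟨u', u'.2, ?_, ?_, hext, fun i hi => ?_⟩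
    · have h1 := tendstoUniformly_sum hbdd hcoeff
      rw [sum_coeff u'.2] at h1
      intro U hU
      filter_upwards [h1 U hU, eventually_ge_atTop (4 * (Cd * CE) / β)] with τ h2 hτ
      rw [hw τ hτ]
      simpa only [sum_coeff] using h2
    · have h1 := tendstoUniformly_sum hbdd hcorr
      rw [sum_coeff u'.2] at h1
      intro U hU
      filter_upwards [h1 U hU, eventually_ge_atTop (4 * (Cd * CE) / β)] with τ h2 hτ
      rw [hw τ hτ, extOp_eq hM hρ hA (w τ).2]
      exact h2
    · have h1 := jumpDof_eq hM hρ hA u'.2 hi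
      rw [hjump i hi] at h1
      rw [dof_of_mem hM hρ hA (D.node_mem i) u'.2 (D.node_subset i),
        dof_poly hM hρ hA (D.node_mem i) (Mesh.polyExt_spec u'.2 (S_node_mem hi)).1
          (D.node_subset i)]
      linarith
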